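/- **Setting.** A signature of size $N$ is an $N$-tuple of integers $\lambda_1\ge\dots\ge\lambda_N$. Its rational Schur function is the Laurent polynomial $$s_\lambda(u_1,\dots,u_N)=\frac{\det\big[u_i^{\lambda_j+N-j}\big]_{i,j=1}^N}{\prod_{i<j}(u_i-u_j)},$$ and for $k\le N$ $$S_\lambda(x_1,\dots,x_k;N,1)=\frac{s_\lambda(x_1,\dots,x_k,1,\dots,1)}{s_\lambda(1,\dots,1)}$$ with $N-k$ ones in the numerator and $N$ ones in the denominator. Let $\lambda^+$ be the Young diagram whose row lengths are the positive $\lambda_i$, and $\lambda^-$ the Young diagram whose row lengths are minus the negative $\lambda_i$. The modified Frobenius coordinates of a Young diagram $\mu$ with main diagonal of length $d$ are $p_i=\mu_i-i+\tfrac12$, $q_i=\mu_i'-i+\tfrac12$ for $1\le i\le d$ (where $\mu_i$ are the row lengths and $\mu'_i$ the column lengths), and $p_i=q_i=0$ for $i>d$; those of $\lambda^\pm$ are denoted $p_i^\pm,q_i^\pm$. Let $\omega=(\alpha^+,\alpha^-,\beta^+,\beta^-;\delta^+,\delta^-)$, where $\alpha^\pm=(\alpha_1^\pm\ge\alpha_2^\pm\ge\dots\ge0)$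 and $\beta^\pm=(\beta_1^\pm\ge\beta_2^\pm\ge\dots\ge0)$ are real sequences and $\delta^\pm$ are real numbers with $\sum_{i\ge1}(\alpha_i^\pm+\beta_i^\pm)\le\delta^\pm$ and $\beta_1^++\beta_1^-\le1$. Put $\gamma^\pm=\delta^\pm-\sum_{i\ge1}(\alpha_i^\pm+\beta_i^\pm)$ and $$\Phi_\infty(x)=e^{\gamma^+(x-1)+\gamma^-(x^{-1}-1)}\prod_{i=1}^\infty\frac{1+\beta_i^+(x-1)}{1-\alpha_i^+(x-1)}\cdot\frac{1+\beta_i^-(x^{-1}-1)}{1-\alpha_i^-(x^{-1}-1)}.$$ **Theorem.** Let $\lambda(N)$ be a sequence of signatures, $\lambda(N)$ of size $N$, such that as $N\to\infty$, for every $i\ge1$, $$\frac{p_i^+}{N}\to\alpha_i^+,\qquad\frac{q_i^+}{N}\to\beta_i^+,\qquad\frac{p_i^-}{N}\to\alpha_i^-,\qquad\frac{q_i^-}{N}\to\beta_i^-,$$ and $|\lambda^+|/N\to\delta^+$, $|\lambda^-|/N\to\delta^-$, where $p_i^\pm,q_i^\pm$ and $\lambda^\pm$ are those of $\lambda(N)$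 and $|\mu|$ is the number of boxes of $\mu$. Then there is $\varepsilon\in(0,1)$ such that on the annulus $1-\varepsilon<|x|<1+\varepsilon$ no denominator of $\Phi_\infty$ vanishes and its infinite product converges, and such that for every $k$ (in particular for $k=1$) $$\lim_{N\to\infty}S_{\lambda(N)}(x_1,\dots,x_k;N,1)=\prod_{\ell=1}^k\Phi_\infty(x_\ell)$$ uniformly over the set of $(x_1,\dots,x_k)\in\mathbb C^k$ with $1-\varepsilon<|x_\ell|<1+\varepsilon$, $\ell=1,\dots,k$. -/

import Mathlib

open Filter Topology

noncomputable section

namespace VershikKerov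

/-! ### Signatures, Young diagrams and modified Frobenius coordinates -/

/-- Signatures of size `N`: weakly decreasing `N`-tuples of integers. -/
def Signature (N : ℕ) : Type := {lam : Fin N → ℤ // Antitone lam}

/-- The signature `(-λ_N, …, -λ_1)`. -/
def Signature.dual {N : ℕ} (lam : Signature N) : Signature N :=
  ⟨fun i => -lam.1 i.rev, fun _ _ h => neg_le_neg (lam.2 (Fin.rev_le_rev.mpr h))⟩

/-- The Young diagram `λ⁺`, whose row lengths are the positive entries of `λ`. -/
def Signature.posDiagram {N : ℕ} (lam : Signature N) : YoungDiagram :=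
  YoungDiagram.ofRowLens (List.ofFn fun i => (lam.1 i).toNat)
    (List.sortedGE_ofFn_iff.mpr fun _ _ h => Int.toNat_le_toNat (lam.2 h))

/-- The Young diagram `λ⁻`, whose row lengths are minus the negative entries of `λ`. -/
def Signature.negDiagram {N : ℕ} (lam : Signature N) : YoungDiagram :=
  lam.dual.posDiagram

open Classical in
/-- The modified Frobenius coordinate `p_{i+1} = μ_{i+1} - (i+1) + 1/2` of `μ` if the diagonal cell
`(i, i)` (counted from `0`) lies in `μ`, that is, if `i + 1 ≤ d`, and `0` otherwise. -/
def frobP (μ : YoungDiagram) (i : ℕ) : ℝ :=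
  if (i, i) ∈ μ then (μ.rowLen i : ℝ) - ((i : ℝ) + 1) + 1 / 2 else 0

open Classical in
/-- The modified Frobenius coordinate `q_{i+1} = μ'_{i+1} - (i+1) + 1/2` of `μ` if the diagonal cell
`(i, i)` (counted from `0`) lies in `μ`, that is, if `i + 1 ≤ d`, and `0` otherwise. -/
def frobQ (μ : YoungDiagram) (i : ℕ) : ℝ :=
  if (i, i) ∈ μ then (μ.colLen i : ℝ) - ((i : ℝ) + 1) + 1 / 2 else 0

/-! ### Rational Schur functions -/

/-- The alternant matrix `[X_i ^ a_j]`. -/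
def alternant {N : ℕ} (a : Fin N → ℕ) : Matrix (Fin N) (Fin N) (MvPolynomial (Fin N) ℂ) :=
  Matrix.of fun i j => MvPolynomial.X i ^ a j

/-- The Vandermonde product `∏_{i<j} (X_i - X_j)`. -/
def vandermondePoly (N : ℕ) : MvPolynomial (Fin N) ℂ :=
  ∏ p : Fin N × Fin N with p.1 < p.2, (MvPolynomial.X p.1 - MvPolynomial.X p.2)

lemma X_sub_X_irreducible {N : ℕ} {i j : Fin N} (h : i ≠ j) :
    Irreducible (MvPolynomial.X i - MvPolynomial.X j : MvPolynomial (Fin N) ℂ) := by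
  have hne : (Finsupp.single i 1 : Fin N →₀ ℕ) ≠ Finsupp.single j 1 := by
    intro e
    have := DFunLike.congr_fun e i
    simp [h.symm] at this
  have hc : MvPolynomial.coeff (Finsupp.single i 1)
      (MvPolynomial.X i - MvPolynomial.X j : MvPolynomial (Fin N) ℂ) = 1 := by
    simp [MvPolynomial.coeff_X, hne.symm]
  refine MvPolynomial.irreducible_of_totalDegree_eq_one (le_antisymm ?_ ?_) ?_
  · refine (MvPolynomial.totalDegree_sub _ _).trans ?_
    simp
  · have := MvPolynomial.le_totalDegree (s := Finsupp.single i 1)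
      (p := (MvPolynomial.X i - MvPolynomial.X j : MvPolynomial (Fin N) ℂ))
      (by rw [MvPolynomial.mem_support_iff, hc]; exact one_ne_zero)
    simpa using this
  · intro x hx
    have := hx (Finsupp.single i 1)
    rw [hc] at this
    exact isUnit_of_dvd_one this

lemma X_sub_X_dvd_alternant {N : ℕ} (a : Fin N → ℕ) {i j : Fin N} (h : i ≠ j) :
    (MvPolynomial.X i - MvPolynomial.X j : MvPolynomial (Fin N) ℂ) ∣ (alternant a).det := by
  have h1 := Matrix.det_updateRow_add_smul_self (alternant a) h (-1)
  choose q hq using fun l : Fin N =>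
    sub_dvd_pow_sub_pow (MvPolynomial.X i : MvPolynomial (Fin N) ℂ) (MvPolynomial.X j) (a l)
  have h2 : (alternant a i + (-1 : MvPolynomial (Fin N) ℂ) • alternant a j) =
      (MvPolynomial.X i - MvPolynomial.X j : MvPolynomial (Fin N) ℂ) • q := by
    funext l
    have := hq l
    simp only [alternant, Matrix.of_apply, Pi.add_apply, Pi.smul_apply, smul_eq_mul]
    linear_combination this
  rw [h2, Matrix.det_updateRow_smul] at h1
  exact ⟨_, h1.symm⟩

lemma vandermondePoly_dvd_alternant {N : ℕ} (a : Fin N → ℕ) :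
    vandermondePoly N ∣ (alternant a).det := by
  refine Finset.prod_dvd_of_isRelPrime ?_ ?_
  · rintro ⟨i, j⟩ hp ⟨k, l⟩ hq hne
    simp only [Finset.coe_filter, Finset.mem_univ, true_and, Set.mem_ofPred_eq] at hp hq
    refine (X_sub_X_irreducible hp.ne).isRelPrime_iff_not_dvd.mpr ?_
    rintro ⟨r, hr⟩
    have := congrArg (MvPolynomial.eval fun t : Fin N =>
      (((if t = j then i else t : Fin N) : ℕ) : ℂ)) hr
    simp only [map_sub, map_mul, MvPolynomial.eval_X, if_neg hp.ne, if_true, sub_self, zero_mul,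
      sub_eq_zero, Nat.cast_inj, Fin.val_inj] at this
    apply hne
    ext <;> grind
  · rintro ⟨i, j⟩ hp
    simp only [Finset.mem_filter, Finset.mem_univ, true_and] at hp
    exact X_sub_X_dvd_alternant a hp.ne

/-- The polynomial `det [X_i ^ a_j] / ∏_{i<j} (X_i - X_j)`; the quotient is exact, and unique
because polynomials form a domain. -/
def alternantQuot {N : ℕ} (a : Fin N → ℕ) : MvPolynomial (Fin N) ℂ :=
  (vandermondePoly_dvd_alternant a).choose

lemma alternantQuot_spec {N : ℕ} (a : Fin N → ℕ) :
    (alternant a).det = vandermondePoly N * alternantQuot a :=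
  (vandermondePoly_dvd_alternant a).choose_spec

/-- A natural number `m` with `λ_j + m ≥ 0` for all `j`. -/
def Signature.shift {N : ℕ} (lam : Signature N) : ℕ := ∑ j, (lam.1 j).natAbs

/-- The rational Schur function
`s_λ(u_1, …, u_N) = det [u_i ^ (λ_j + N - j)] / ∏_{i<j} (u_i - u_j)`, a Laurent polynomial in `u`.
With `m` such that all `λ_j + m` are nonnegative it is
`(u_1 ⋯ u_N)^(-m) · det [u_i ^ (λ_j + m + N - j)] / ∏_{i<j} (u_i - u_j)`, the quotient of
the two polynomials being taken before it is evaluated at `u`, so that the value is also the right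
one when some of the `u_i` coincide. -/
def schur {N : ℕ} (lam : Signature N) (u : Fin N → ℂ) : ℂ :=
  ((∏ i, u i) ^ lam.shift)⁻¹ *
    MvPolynomial.eval u
      (alternantQuot fun j => (lam.1 j + lam.shift + (N - 1 - (j : ℕ) : ℤ)).toNat)

/-- The defining bialternant formula (the index `j` counts from `0`). -/
lemma schur_mul_vandermonde {N : ℕ} (lam : Signature N) (u : Fin N → ℂ) (hu : ∀ i, u i ≠ 0) :
    schur lam u * ∏ p : Fin N × Fin N with p.1 < p.2, (u p.1 - u p.2) =
      (Matrix.of fun i j : Fin N => u i ^ (lam.1 j + N - ((j : ℕ) + 1) : ℤ)).det := by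
  have hnn : ∀ j : Fin N, 0 ≤ lam.1 j + lam.shift + (N - 1 - (j : ℕ) : ℤ) := by
    intro j
    have h1 : (lam.1 j).natAbs ≤ lam.shift :=
      Finset.single_le_sum (f := fun j => (lam.1 j).natAbs) (fun _ _ => Nat.zero_le _)
        (Finset.mem_univ j)
    have := j.2
    omega
  have h0 : (∏ i, u i) ^ lam.shift ≠ 0 := pow_ne_zero _ (Finset.prod_ne_zero_iff.mpr fun i _ => hu i)
  set b : Fin N → ℕ := fun j => (lam.1 j + lam.shift + (N - 1 - (j : ℕ) : ℤ)).toNat with hb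
  have h1 := congrArg (MvPolynomial.eval u) (alternantQuot_spec b)
  rw [RingHom.map_det, map_mul, vandermondePoly, map_prod] at h1
  simp only [map_sub, MvPolynomial.eval_X] at h1
  have h2 : (MvPolynomial.eval u).mapMatrix (alternant b) =
      Matrix.of fun i j : Fin N => u i ^ lam.shift *
        (Matrix.of fun i j : Fin N => u i ^ (lam.1 j + N - ((j : ℕ) + 1) : ℤ)) i j := by
    ext i j
    simp only [alternant, RingHom.mapMatrix_apply, Matrix.map_apply, Matrix.of_apply, map_pow,
      MvPolynomial.eval_X]
    rw [← zpow_natCast, ← zpow_natCast, ← zpow_add₀ (hu i)]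
    congr 1
    simp only [hb]
    rw [Int.toNat_of_nonneg (hnn j)]
    ring
  rw [h2, Matrix.det_mul_column, Finset.prod_pow] at h1
  rw [schur, mul_assoc, inv_mul_eq_iff_eq_mul₀ h0, h1]
  ring

/-- The point `(x_1, …, x_k, 1, …, 1)` with `N` coordinates (used for `k ≤ N`). -/
def padOne {k : ℕ} (N : ℕ) (x : Fin k → ℂ) : Fin N → ℂ :=
  fun i => if h : (i : ℕ) < k then x ⟨i, h⟩ else 1

/-- The normalized Schur function
`S_λ(x_1, …, x_k; N, 1) = s_λ(x_1, …, x_k, 1, …, 1) / s_λ(1, …, 1)`. -/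
def normSchur {N k : ℕ} (lam : Signature N) (x : Fin k → ℂ) : ℂ :=
  schur lam (padOne N x) / schur lam (fun _ => 1)

/-! ### The Voiculescu–Edrei functions -/

/-- The domain `Ω` of sextuples `ω = (α⁺, α⁻, β⁺, β⁻; δ⁺, δ⁻)`; `ap, am, bp, bm, dp, dm` stand for
`α⁺, α⁻, β⁺, β⁻, δ⁺, δ⁻`, and sequences are indexed from `0`. -/
structure Omega where
  ap : ℕ → ℝ
  am : ℕ → ℝ
  bp : ℕ → ℝ
  bm : ℕ → ℝ
  dp : ℝ
  dm : ℝ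
  ap_anti : Antitone ap
  am_anti : Antitone am
  bp_anti : Antitone bp
  bm_anti : Antitone bm
  ap_nonneg : ∀ i, 0 ≤ ap i
  am_nonneg : ∀ i, 0 ≤ am i
  bp_nonneg : ∀ i, 0 ≤ bp i
  bm_nonneg : ∀ i, 0 ≤ bm i
  summable_p : Summable fun i => ap i + bp i
  summable_m : Summable fun i => am i + bm i
  tsum_p_le : ∑' i, (ap i + bp i) ≤ dp
  tsum_m_le : ∑' i, (am i + bm i) ≤ dm
  b_le_one : bp 0 + bm 0 ≤ 1

/-- `γ⁺ = δ⁺ - ∑ (α_i⁺ + β_i⁺)`. -/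
def Omega.gp (ω : Omega) : ℝ := ω.dp - ∑' i, (ω.ap i + ω.bp i)

/-- `γ⁻ = δ⁻ - ∑ (α_i⁻ + β_i⁻)`. -/
def Omega.gm (ω : Omega) : ℝ := ω.dm - ∑' i, (ω.am i + ω.bm i)

/-- The `i`-th factor of the infinite product in the Voiculescu–Edrei function. -/
def Omega.factor (ω : Omega) (i : ℕ) (x : ℂ) : ℂ :=
  (1 + ω.bp i * (x - 1)) / (1 - ω.ap i * (x - 1)) *
    ((1 + ω.bm i * (x⁻¹ - 1)) / (1 - ω.am i * (x⁻¹ - 1)))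

/-- The Voiculescu–Edrei function `Φ_∞`, as a function of `x`. -/
def Omega.Phi (ω : Omega) (x : ℂ) : ℂ :=
  Complex.exp (ω.gp * (x - 1) + ω.gm * (x⁻¹ - 1)) * ∏' i, ω.factor i x

/-- The set `1 - ε < |x_ℓ| < 1 + ε`, `ℓ = 1, …, k`. -/
def polyAnnulus (k : ℕ) (ε : ℝ) : Set (Fin k → ℂ) :=
  {x | ∀ l, 1 - ε < ‖x l‖ ∧ ‖x l‖ < 1 + ε}

end VershikKerov

end

namespace VershikKerov

/-! ### Determinants with confluent rows -/

lemma sum_pow_mul_sub_pow_mul_nodalWeight {N : ℕ} {v : Fin N → ℂ} (hv : Function.Injective v)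
    (c : ℂ) {a b : ℕ} (hab : a + b + 1 ≤ N) :
    ∑ j, v j ^ a * ((v j - c) ^ b * Lagrange.nodalWeight Finset.univ v j) =
      if a + b + 1 = N then 1 else 0 := by
  have hmon : (Polynomial.X ^ a * (Polynomial.X - Polynomial.C c) ^ b : Polynomial ℂ).Monic :=
    (Polynomial.monic_X_pow a).mul ((Polynomial.monic_X_sub_C c).pow b)
  have hdeg : (Polynomial.X ^ a * (Polynomial.X - Polynomial.C c) ^ b : Polynomial ℂ).natDegree =
      a + b := by
    rw [Polynomial.Monic.natDegree_mul (Polynomial.monic_X_pow a)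
      ((Polynomial.monic_X_sub_C c).pow b)]
    simp
  have h := Lagrange.coeff_eq_sum (s := Finset.univ) (v := v) hv.injOn
    (P := Polynomial.X ^ a * (Polynomial.X - Polynomial.C c) ^ b) (by
      rw [Polynomial.degree_eq_natDegree hmon.ne_zero, hdeg, Finset.card_univ, Fintype.card_fin]
      exact_mod_cast hab)
  rw [Finset.card_univ, Fintype.card_fin] at h
  have h2 : ∑ j, v j ^ a * ((v j - c) ^ b * Lagrange.nodalWeight Finset.univ v j) =
      (Polynomial.X ^ a * (Polynomial.X - Polynomial.C c) ^ b : Polynomial ℂ).coeff (N - 1) := by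
    rw [h]
    refine Finset.sum_congr rfl fun j _ => ?_
    simp only [Polynomial.eval_mul, Polynomial.eval_pow, Polynomial.eval_X, Polynomial.eval_sub,
      Polynomial.eval_C, Lagrange.nodalWeight, Finset.prod_inv_distrib]
    ring
  rw [h2]
  split_ifs with e
  · have : N - 1 = a + b := by omega
    rw [this, ← hdeg]
    exact hmon.coeff_natDegree
  · apply Polynomial.coeff_eq_zero_of_natDegree_lt
    rw [hdeg]
    omega

/-- The rows `f_a`, followed by the rows `v ^ (M-1), …, v, 1`. -/
lemma det_addCases_pow {k M : ℕ} {v : Fin (k + M) → ℂ} (hv : Function.Injective v) (c : ℂ)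
    (f : Fin k → Fin (k + M) → ℂ) :
    (Matrix.of fun i j : Fin (k + M) =>
      Fin.addCases (motive := fun _ => ℂ) (fun a => f a j) (fun m : Fin M => v j ^ (M - 1 - m : ℕ))
        i).det =
    (Matrix.of fun a r : Fin k =>
      ∑ j, f a j * ((v j - c) ^ (r : ℕ) * Lagrange.nodalWeight Finset.univ v j)).det *
    (Matrix.of fun i j : Fin (k + M) => v j ^ (k + M - 1 - i : ℕ)).det := by
  set A : Matrix (Fin (k + M)) (Fin (k + M)) ℂ := Matrix.of fun i j : Fin (k + M) =>
      Fin.addCases (motive := fun _ => ℂ) (fun a => f a j) (fun m : Fin M => v j ^ (M - 1 - m : ℕ)) i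
    with hA
  set A0 : Matrix (Fin (k + M)) (Fin (k + M)) ℂ :=
    Matrix.of fun i j : Fin (k + M) => v j ^ (k + M - 1 - i : ℕ) with hA0
  set W : Matrix (Fin (k + M)) (Fin (k + M)) ℂ := Matrix.of fun j r : Fin (k + M) =>
    (v j - c) ^ (r : ℕ) * Lagrange.nodalWeight Finset.univ v j with hW
  have h0 : A0.det * W.det = 1 := by
    rw [← Matrix.det_mul, Matrix.det_of_isUpperTriangular]
    · refine Finset.prod_eq_one fun i _ => ?_
      have := i.2
      simp only [Matrix.mul_apply, hA0, hW, Matrix.of_apply]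
      rw [sum_pow_mul_sub_pow_mul_nodalWeight hv c (by omega), if_pos (by omega)]
    · intro i r hir
      have hir : r < i := hir
      have := i.2
      simp only [Matrix.mul_apply, hA0, hW, Matrix.of_apply]
      rw [sum_pow_mul_sub_pow_mul_nodalWeight hv c (by omega), if_neg (by omega)]
  have h1 : A.det * W.det = (Matrix.of fun a r : Fin k =>
      ∑ j, f a j * ((v j - c) ^ (r : ℕ) * Lagrange.nodalWeight Finset.univ v j)).det := by
    rw [← Matrix.det_mul, ← Matrix.det_submatrix_equiv_self finSumFinEquiv (A * W)]
    have hblock : (A * W).submatrix finSumFinEquiv finSumFinEquiv = Matrix.fromBlocks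
        (Matrix.of fun a r : Fin k =>
          ∑ j, f a j * ((v j - c) ^ (r : ℕ) * Lagrange.nodalWeight Finset.univ v j))
        (Matrix.of fun (a : Fin k) (r : Fin M) => (A * W) (Fin.castAdd M a) (Fin.natAdd k r)) 0
        (Matrix.of fun m r : Fin M => (A * W) (Fin.natAdd k m) (Fin.natAdd k r)) := by
      ext (i | i) (j | j)
      · simp [Matrix.mul_apply, hA, hW]
      · simp
      · have := i.2
        have := j.2
        simp only [Matrix.submatrix_apply, finSumFinEquiv_apply_left, finSumFinEquiv_apply_right,
          Matrix.mul_apply, hA, hW, Matrix.of_apply, Fin.addCases_right, Fin.val_castAdd,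
          Matrix.fromBlocks_apply₂₁, Matrix.zero_apply]
        rw [sum_pow_mul_sub_pow_mul_nodalWeight hv c (by omega), if_neg (by omega)]
      · simp
    rw [hblock, Matrix.det_fromBlocks_zero₂₁]
    convert mul_one _
    rw [Matrix.det_of_isUpperTriangular]
    · refine Finset.prod_eq_one fun i _ => ?_
      have := i.2
      simp only [Matrix.mul_apply, hA, hW, Matrix.of_apply, Fin.addCases_right, Fin.val_natAdd]
      rw [sum_pow_mul_sub_pow_mul_nodalWeight hv c (by omega), if_pos (by omega)]
    · intro i r hir
      have hir : r < i := hir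
      have := i.2
      simp only [Matrix.mul_apply, hA, hW, Matrix.of_apply, Fin.addCases_right, Fin.val_natAdd]
      rw [sum_pow_mul_sub_pow_mul_nodalWeight hv c (by omega), if_neg (by omega)]
  rw [← h1, mul_assoc, mul_comm W.det, h0, mul_one]

/-! ### The principal specialization and its limit -/

/-- The strictly decreasing exponents `λ_j + N - j`. -/
def Signature.node {N : ℕ} (lam : Signature N) (j : Fin N) : ℤ := lam.1 j + N - ((j : ℕ) + 1)

lemma Signature.node_strictAnti {N : ℕ} (lam : Signature N) : StrictAnti lam.node := by
  intro i j h
  have h1 := lam.2 h.le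
  have h2 : (i : ℕ) < j := h
  simp only [node]
  omega

/-- The zero signature. -/
def Signature.zero (N : ℕ) : Signature N := ⟨fun _ => 0, fun _ _ _ => le_rfl⟩

/-- The determinant `det [u_i ^ l_j]`. -/
noncomputable def altDet {N : ℕ} (l : Fin N → ℤ) (u : Fin N → ℂ) : ℂ :=
  (Matrix.of fun i j : Fin N => u i ^ l j).det

lemma altDet_zero_node {N : ℕ} (u : Fin N → ℂ) :
    altDet (Signature.zero N).node u = ∏ i, ∏ j ∈ Finset.Ioi i, (u i - u j) := by
  have h := Matrix.det_projVandermonde (fun _ : Fin N => (1 : ℂ)) u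
  simp only [one_mul] at h
  rw [altDet, ← h]
  congr 1
  ext i j
  have := j.2
  simp only [Signature.node, Signature.zero, Matrix.of_apply, Matrix.projVandermonde,
    Matrix.rectVandermonde, one_pow, one_mul, Fin.val_rev]
  rw [← zpow_natCast]
  congr 1
  omega

lemma prod_lt_eq {N : ℕ} (g : Fin N → Fin N → ℂ) :
    ∏ p : Fin N × Fin N with p.1 < p.2, g p.1 p.2 = ∏ i, ∏ j ∈ Finset.Ioi i, g i j := by
  rw [Finset.prod_sigma']
  refine Finset.prod_bij' (fun p _ => ⟨p.1, p.2⟩) (fun p _ => (p.1, p.2)) ?_ ?_ ?_ ?_ ?_ <;> simp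

lemma schur_mul_altDet {N : ℕ} (lam : Signature N) (u : Fin N → ℂ) (hu : ∀ i, u i ≠ 0) :
    schur lam u * altDet (Signature.zero N).node u = altDet lam.node u := by
  rw [altDet_zero_node, ← prod_lt_eq (fun i j => u i - u j), schur_mul_vandermonde lam u hu]
  rfl

/-- The point `(x_1, …, x_k, q ^ (M-1), …, q, 1)`. -/
noncomputable def padGeom {k M : ℕ} (q : ℂ) (x : Fin k → ℂ) : Fin (k + M) → ℂ :=
  fun i => Fin.addCases (motive := fun _ => ℂ) x (fun m : Fin M => q ^ (M - 1 - m : ℕ)) i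

/-- The point `(q ^ (N-1), …, q, 1)`. -/
noncomputable def geom (N : ℕ) (q : ℂ) : Fin N → ℂ := fun i => q ^ (N - 1 - i : ℕ)

/-- The determinant `det [∑_j x_a ^ l_j v_j ^ r w_j]`, where `w_j` are the nodal weights at `v`. -/
noncomputable def momentDet {N k : ℕ} (l : Fin N → ℤ) (v : Fin N → ℂ) (x : Fin k → ℂ) : ℂ :=
  (Matrix.of fun a r : Fin k =>
    ∑ j, x a ^ l j * (v j ^ (r : ℕ) * Lagrange.nodalWeight Finset.univ v j)).det

lemma altDet_padGeom {k M : ℕ} {l : Fin (k + M) → ℤ} {q : ℂ}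
    (hq : Function.Injective fun j => q ^ l j) (x : Fin k → ℂ) :
    altDet l (padGeom q x) = (Matrix.of fun a r : Fin k => ∑ j, x a ^ l j *
      ((q ^ l j - 1) ^ (r : ℕ) * Lagrange.nodalWeight Finset.univ (fun j => q ^ l j) j)).det *
        altDet l (geom (k + M) q) := by
  have h := det_addCases_pow hq 1 (fun a j => x a ^ l j)
  convert h using 2
  · rw [altDet]
    congr 1
    ext i j
    refine Fin.addCases (fun a => ?_) (fun m => ?_) i
    · simp [padGeom]
    · simp only [padGeom, Matrix.of_apply, Fin.addCases_right]
      rw [← zpow_natCast, ← zpow_natCast, ← zpow_mul, ← zpow_mul, mul_comm]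
  · rw [altDet]
    congr 1
    ext i j
    simp only [geom, Matrix.of_apply]
    rw [← zpow_natCast, ← zpow_natCast, ← zpow_mul, ← zpow_mul, mul_comm]

lemma nodalWeight_affine {N : ℕ} (v : Fin N → ℂ) {s : ℂ} (hs : s ≠ 0) (c : ℂ) (j : Fin N) :
    Lagrange.nodalWeight Finset.univ v j =
      s⁻¹ ^ (N - 1) * Lagrange.nodalWeight Finset.univ (fun j => (v j - c) / s) j := by
  simp only [Lagrange.nodalWeight]
  have hc : N - 1 = (Finset.univ.erase j).card := by simp
  rw [hc, ← Finset.prod_const, ← Finset.prod_mul_distrib]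
  refine Finset.prod_congr rfl fun i _ => ?_
  rw [← mul_inv, ← sub_div, mul_div_cancel₀ _ hs]
  ring_nf

lemma altDet_padGeom_eq_momentDet {k M : ℕ} {l : Fin (k + M) → ℤ} {q : ℂ} (hq1 : q ≠ 1)
    (hq : Function.Injective fun j => q ^ l j) (x : Fin k → ℂ) :
    altDet l (padGeom q x) = (∏ r : Fin k, ((q - 1)⁻¹ ^ (k + M - 1) * (q - 1) ^ (r : ℕ))) *
      momentDet l (fun j => (q ^ l j - 1) / (q - 1)) x * altDet l (geom (k + M) q) := by
  rw [altDet_padGeom hq]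
  congr 1
  have hs : q - 1 ≠ 0 := sub_ne_zero.mpr hq1
  rw [momentDet, ← Matrix.det_mul_row]
  congr 1
  ext a r
  simp only [Matrix.of_apply, Finset.mul_sum]
  refine Finset.sum_congr rfl fun j _ => ?_
  rw [nodalWeight_affine _ hs 1, div_pow]
  field_simp

lemma tendsto_nodalWeight {N : ℕ} {ι : Type*} {F : Filter ι} {v : ι → Fin N → ℂ} {v₀ : Fin N → ℂ}
    (h : ∀ j, Tendsto (fun t => v t j) F (𝓝 (v₀ j))) (hinj : Function.Injective v₀) (j : Fin N) :
    Tendsto (fun t => Lagrange.nodalWeight Finset.univ (v t) j) F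
      (𝓝 (Lagrange.nodalWeight Finset.univ v₀ j)) := by
  simp only [Lagrange.nodalWeight]
  refine tendsto_finsetProd _ fun i hi => ((h j).sub (h i)).inv₀ ?_
  rw [sub_ne_zero]
  exact fun e => (Finset.ne_of_mem_erase hi) (hinj e).symm

lemma tendsto_momentDet {N k : ℕ} {ι : Type*} {F : Filter ι} (l : Fin N → ℤ)
    {v : ι → Fin N → ℂ} {v₀ : Fin N → ℂ}
    (h : ∀ j, Tendsto (fun t => v t j) F (𝓝 (v₀ j))) (hinj : Function.Injective v₀)
    (x : Fin k → ℂ) :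
    Tendsto (fun t => momentDet l (v t) x) F (𝓝 (momentDet l v₀ x)) := by
  unfold momentDet
  have hdet : Continuous fun A : Matrix (Fin k) (Fin k) ℂ => A.det :=
    Continuous.matrix_det continuous_id
  refine (hdet.tendsto _).comp ?_
  refine tendsto_pi_nhds.mpr fun a => tendsto_pi_nhds.mpr fun r => ?_
  simp only [Matrix.of_apply]
  exact tendsto_finsetSum _ fun j _ =>
    (((h j).pow _).mul (tendsto_nodalWeight h hinj j)).const_mul _

lemma tendsto_zpow_sub_one_div (l : ℤ) :
    Tendsto (fun t : ℝ => (((t : ℂ) ^ l - 1) / ((t : ℂ) - 1))) (𝓝[>] 1) (𝓝 (l : ℂ)) := by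
  have h := (hasDerivAt_zpow l (1 : ℂ) (Or.inl one_ne_zero)).tendsto_slope
  rw [one_zpow, mul_one] at h
  have h2 : Tendsto (fun t : ℝ => (t : ℂ)) (𝓝[>] 1) (𝓝[≠] 1) := by
    refine tendsto_nhdsWithin_iff.mpr ⟨?_, ?_⟩
    · have := Complex.continuous_ofReal.tendsto (1 : ℝ)
      rw [Complex.ofReal_one] at this
      exact this.mono_left nhdsWithin_le_nhds
    · filter_upwards [self_mem_nhdsWithin] with t ht
      have : (1 : ℝ) < t := ht
      simp only [Set.mem_compl_iff, Set.mem_singleton_iff]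
      exact_mod_cast this.ne'
  refine (h.comp h2).congr fun t => ?_
  simp [slope_def_field]

lemma injective_zpow_comp {N : ℕ} {l : Fin N → ℤ} (hl : Function.Injective l) {t : ℝ} (ht : 1 < t) :
    Function.Injective fun j => (t : ℂ) ^ l j := by
  intro i j h
  have h : (t : ℂ) ^ l i = (t : ℂ) ^ l j := h
  apply hl
  apply zpow_right_injective₀ (zero_lt_one.trans ht) ht.ne'
  exact_mod_cast h

lemma continuousAt_schur {N : ℕ} (lam : Signature N) {u : Fin N → ℂ} (hu : ∀ i, u i ≠ 0) :
    ContinuousAt (schur lam) u := by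
  unfold schur
  refine ContinuousAt.mul (ContinuousAt.inv₀ ?_ ?_) ?_
  · fun_prop
  · exact pow_ne_zero _ (Finset.prod_ne_zero_iff.mpr fun i _ => hu i)
  · exact (MvPolynomial.continuous_eval _).continuousAt

lemma altDet_geom_node {N : ℕ} (lam : Signature N) (q : ℂ) :
    altDet lam.node (geom N q) =
      ∏ i, ∏ j ∈ Finset.Ioi i, (q ^ lam.node i - q ^ lam.node j) := by
  have h := Matrix.det_projVandermonde (fun _ : Fin N => (1 : ℂ)) (fun j => q ^ lam.node j)
  simp only [one_mul] at h
  rw [altDet, ← h, ← Matrix.det_transpose]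
  congr 1
  ext i j
  have := j.2
  simp only [geom, Matrix.of_apply, Matrix.projVandermonde, Matrix.transpose_apply,
    Matrix.rectVandermonde, one_pow, one_mul, Fin.val_rev]
  rw [← zpow_natCast, ← zpow_natCast, ← zpow_mul, ← zpow_mul, mul_comm]
  congr 3
  omega

lemma schur_geom_mul {N : ℕ} (lam : Signature N) {t : ℝ} (ht : 1 < t) :
    schur lam (geom N t) * ∏ i, ∏ j ∈ Finset.Ioi i,
        (((t : ℂ) ^ (Signature.zero N).node i - 1) / (t - 1) -
          ((t : ℂ) ^ (Signature.zero N).node j - 1) / (t - 1)) =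
      ∏ i, ∏ j ∈ Finset.Ioi i,
        (((t : ℂ) ^ lam.node i - 1) / (t - 1) - ((t : ℂ) ^ lam.node j - 1) / (t - 1)) := by
  have ht0 : (t : ℂ) ≠ 0 := by exact_mod_cast (zero_lt_one.trans ht).ne'
  have h := schur_mul_altDet lam (geom N t) (fun i => pow_ne_zero _ ht0)
  rw [altDet_geom_node, altDet_geom_node] at h
  simp only [← sub_div, sub_sub_sub_cancel_right, Finset.prod_div_distrib]
  rw [← h, mul_div_assoc]

lemma tendsto_ofReal_one : Tendsto (fun t : ℝ => (t : ℂ)) (𝓝[>] 1) (𝓝 1) := by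
  have := Complex.continuous_ofReal.tendsto (1 : ℝ)
  rw [Complex.ofReal_one] at this
  exact this.mono_left nhdsWithin_le_nhds

lemma tendsto_schur_geom {N : ℕ} (lam : Signature N) :
    Tendsto (fun t : ℝ => schur lam (geom N t)) (𝓝[>] 1) (𝓝 (schur lam fun _ => 1)) := by
  refine (continuousAt_schur lam (u := fun _ => 1) fun _ => one_ne_zero).tendsto.comp ?_
  refine tendsto_pi_nhds.mpr fun i => ?_
  simpa [geom] using tendsto_ofReal_one.pow (N - 1 - (i : ℕ))

lemma schur_one_ne_zero {N : ℕ} (lam : Signature N) : schur lam (fun _ => 1) ≠ 0 := by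
  have key : schur lam (fun _ => 1) * ∏ i, ∏ j ∈ Finset.Ioi i,
        (((Signature.zero N).node i : ℂ) - (Signature.zero N).node j) =
      ∏ i, ∏ j ∈ Finset.Ioi i, ((lam.node i : ℂ) - lam.node j) := by
    refine tendsto_nhds_unique_of_eventuallyEq (l := 𝓝[>] (1 : ℝ))
      ((tendsto_schur_geom lam).mul (tendsto_finsetProd _ fun i _ => tendsto_finsetProd _ fun j _ =>
        (tendsto_zpow_sub_one_div _).sub (tendsto_zpow_sub_one_div _)))
      (tendsto_finsetProd _ fun i _ => tendsto_finsetProd _ fun j _ =>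
        (tendsto_zpow_sub_one_div _).sub (tendsto_zpow_sub_one_div _)) ?_
    filter_upwards [self_mem_nhdsWithin] with t ht using schur_geom_mul lam ht
  intro h0
  rw [h0, zero_mul] at key
  refine Finset.prod_ne_zero_iff.mpr (fun i _ => Finset.prod_ne_zero_iff.mpr fun j hj => ?_) key.symm
  rw [sub_ne_zero]
  have := lam.node_strictAnti (Finset.mem_Ioi.mp hj)
  exact_mod_cast this.ne'

lemma schur_padGeom_mul {k M : ℕ} (lam : Signature (k + M)) {x : Fin k → ℂ} (hx : ∀ a, x a ≠ 0)
    {t : ℝ} (ht : 1 < t) :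
    schur lam (padGeom (M := M) t x) * momentDet (Signature.zero (k + M)).node
        (fun j => ((t : ℂ) ^ (Signature.zero (k + M)).node j - 1) / (t - 1)) x =
      momentDet lam.node (fun j => ((t : ℂ) ^ lam.node j - 1) / (t - 1)) x *
        schur lam (geom (k + M) t) := by
  have ht0 : (t : ℂ) ≠ 0 := by exact_mod_cast (zero_lt_one.trans ht).ne'
  have ht1 : (t : ℂ) ≠ 1 := by exact_mod_cast ht.ne'
  have hinj (l : Signature (k + M)) := injective_zpow_comp l.node_strictAnti.injective ht
  have h1 := schur_mul_altDet lam (padGeom (M := M) t x) (fun i => by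
    refine Fin.addCases (fun a => ?_) (fun m => ?_) i
    · simpa [padGeom] using hx a
    · simp [padGeom, ht0])
  have h2 := schur_mul_altDet lam (geom (k + M) t) (fun i => pow_ne_zero _ ht0)
  rw [altDet_padGeom_eq_momentDet ht1 (hinj _), altDet_padGeom_eq_momentDet ht1 (hinj _), ← h2] at h1
  have h3 : altDet (Signature.zero (k + M)).node (geom (k + M) t) ≠ 0 := by
    rw [altDet_geom_node]
    refine Finset.prod_ne_zero_iff.mpr fun i _ => Finset.prod_ne_zero_iff.mpr fun j hj => ?_
    rw [sub_ne_zero]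
    exact fun e => (Finset.mem_Ioi.mp hj).ne (hinj _ e)
  have h4 : (∏ r : Fin k, (((t : ℂ) - 1)⁻¹ ^ (k + M - 1) * ((t : ℂ) - 1) ^ (r : ℕ))) ≠ 0 := by
    have := sub_ne_zero.mpr ht1
    exact Finset.prod_ne_zero_iff.mpr fun r _ =>
      mul_ne_zero (pow_ne_zero _ (inv_ne_zero this)) (pow_ne_zero _ this)
  apply mul_left_cancel₀ (mul_ne_zero h4 h3)
  linear_combination h1

lemma schur_padOne_mul {N k : ℕ} (hk : k ≤ N) (lam : Signature N) {x : Fin k → ℂ}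
    (hx : ∀ a, x a ≠ 0) :
    schur lam (padOne N x) *
        momentDet (Signature.zero N).node (fun j => ((Signature.zero N).node j : ℂ)) x =
      momentDet lam.node (fun j => (lam.node j : ℂ)) x * schur lam (fun _ => 1) := by
  obtain ⟨M, rfl⟩ := Nat.exists_eq_add_of_le hk
  have hinj (l : Signature (k + M)) : Function.Injective fun j => (l.node j : ℂ) :=
    Int.cast_injective.comp l.node_strictAnti.injective
  have hpad : Tendsto (fun t : ℝ => schur lam (padGeom (M := M) t x)) (𝓝[>] 1)
      (𝓝 (schur lam (padOne (k + M) x))) := by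
    refine (continuousAt_schur lam (u := padOne (k + M) x) fun i => ?_).tendsto.comp ?_
    · unfold padOne
      split_ifs with h
      · exact hx _
      · exact one_ne_zero
    · refine tendsto_pi_nhds.mpr fun i => ?_
      refine Fin.addCases (fun a => ?_) (fun m => ?_) i
      · simp [padGeom, padOne]
      · simpa [padGeom, padOne] using tendsto_ofReal_one.pow (M - 1 - (m : ℕ))
  refine tendsto_nhds_unique_of_eventuallyEq (l := 𝓝[>] (1 : ℝ))
    (hpad.mul (tendsto_momentDet _ (fun j => tendsto_zpow_sub_one_div _) (hinj _) x))
    ((tendsto_momentDet _ (fun j => tendsto_zpow_sub_one_div _) (hinj _) x).mul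
      (tendsto_schur_geom lam)) ?_
  filter_upwards [self_mem_nhdsWithin] with t ht using schur_padGeom_mul lam hx ht

lemma normSchur_mul_momentDet {N k : ℕ} (hk : k ≤ N) (lam : Signature N) {x : Fin k → ℂ}
    (hx : ∀ a, x a ≠ 0) :
    normSchur lam x *
        momentDet (Signature.zero N).node (fun j => ((Signature.zero N).node j : ℂ)) x =
      momentDet lam.node (fun j => (lam.node j : ℂ)) x := by
  rw [normSchur, div_mul_eq_mul_div, schur_padOne_mul hk lam hx,
    mul_div_cancel_right₀ _ (schur_one_ne_zero lam)]

/-! ### Divided differences at integer nodes -/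

/-- The divided difference of `f` at the nodes in `L`. -/
noncomputable def divDiff (L : Finset ℤ) (f : ℤ → ℂ) : ℂ :=
  ∑ l ∈ L, f l * ∏ m ∈ L.erase l, ((l : ℂ) - m)⁻¹

lemma divDiff_insert {T : Finset ℤ} {a : ℤ} (ha : a ∉ T) (f : ℤ → ℂ) :
    divDiff (insert a T) f = f a * ∏ m ∈ T, ((a : ℂ) - m)⁻¹ +
      ∑ l ∈ T, f l * (((l : ℂ) - a)⁻¹ * ∏ m ∈ T.erase l, ((l : ℂ) - m)⁻¹) := by
  rw [divDiff, Finset.sum_insert ha, Finset.erase_insert ha]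
  congr 1
  refine Finset.sum_congr rfl fun l hl => ?_
  have hal : a ≠ l := fun e => ha (e ▸ hl)
  rw [Finset.erase_insert_of_ne hal, Finset.prod_insert (fun h => ha (Finset.mem_of_mem_erase h))]

lemma divDiff_sub_divDiff {T : Finset ℤ} {a b : ℤ} (ha : a ∉ T) (hb : b ∉ T) (hab : a ≠ b)
    (f : ℤ → ℂ) :
    divDiff (insert a T) f - divDiff (insert b T) f =
      ((a : ℂ) - b) * divDiff (insert a (insert b T)) f := by
  have ha' : a ∉ insert b T := by simp [ha, hab]
  have h1 : ((a : ℂ) - b) ≠ 0 := sub_ne_zero.mpr (by exact_mod_cast hab)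
  have h2 : ((b : ℂ) - a) ≠ 0 := sub_ne_zero.mpr (by exact_mod_cast hab.symm)
  rw [divDiff_insert ha', divDiff_insert ha, divDiff_insert hb, Finset.prod_insert hb,
    Finset.sum_insert hb, Finset.erase_insert hb]
  have h3 : ∀ l ∈ T, f l * (((l : ℂ) - a)⁻¹ * ∏ m ∈ (insert b T).erase l, ((l : ℂ) - m)⁻¹) *
      ((a : ℂ) - b) =
      f l * (((l : ℂ) - a)⁻¹ * ∏ m ∈ T.erase l, ((l : ℂ) - m)⁻¹) -
        f l * (((l : ℂ) - b)⁻¹ * ∏ m ∈ T.erase l, ((l : ℂ) - m)⁻¹) := by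
    intro l hl
    have hbl : b ≠ l := fun e => hb (e ▸ hl)
    have hal : a ≠ l := fun e => ha (e ▸ hl)
    have h4 : ((l : ℂ) - a) ≠ 0 := sub_ne_zero.mpr (by exact_mod_cast hal.symm)
    have h5 : ((l : ℂ) - b) ≠ 0 := sub_ne_zero.mpr (by exact_mod_cast hbl.symm)
    rw [Finset.erase_insert_of_ne hbl, Finset.prod_insert (fun h => hb (Finset.mem_of_mem_erase h))]
    field_simp
    ring
  have h6 := Finset.sum_congr rfl h3
  rw [Finset.sum_sub_distrib, ← Finset.sum_mul] at h6
  have h7 : (a - b : ℂ) * (a - b : ℂ)⁻¹ = 1 := mul_inv_cancel₀ h1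
  have h8 : (a - b : ℂ) * (b - a : ℂ)⁻¹ = -1 := by
    rw [← neg_sub (b : ℂ) a, neg_mul, mul_inv_cancel₀ h2]
  linear_combination -h6 - f a * (∏ m ∈ T, ((a : ℂ) - m)⁻¹) * h7 -
    f b * (∏ m ∈ T, ((b : ℂ) - m)⁻¹) * h8

lemma factorial_mul_divDiff_Icc (n : ℕ) (a : ℤ) (f : ℤ → ℂ) :
    (n.factorial : ℂ) * divDiff (Finset.Icc a (a + n)) f = (fwdDiff (1 : ℤ))^[n] f a := by
  induction n generalizing a with
  | zero => simp [divDiff]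
  | succ n ih =>
    have ha : a ∉ Finset.Icc (a + 1) (a + n) := by simp
    have hb : a + n + 1 ∉ Finset.Icc (a + 1) (a + n) := by simp
    have e1 : insert a (Finset.Icc (a + 1) (a + n)) = Finset.Icc a (a + n) := by
      ext z; simp only [Finset.mem_insert, Finset.mem_Icc]; omega
    have e2 : insert (a + n + 1) (Finset.Icc (a + 1) (a + n)) =
        Finset.Icc (a + 1) (a + 1 + n) := by
      ext z; simp only [Finset.mem_insert, Finset.mem_Icc]; omega
    have e3 : insert a (Finset.Icc (a + 1) (a + 1 + n)) = Finset.Icc a (a + (n + 1 : ℕ)) := by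
      ext z; simp only [Finset.mem_insert, Finset.mem_Icc]; push_cast; omega
    have h := divDiff_sub_divDiff ha hb (by omega) f
    rw [e2, e1, e3] at h
    rw [Function.iterate_succ_apply', fwdDiff, ← ih, ← ih, Nat.factorial_succ]
    push_cast at h ⊢
    linear_combination (n.factorial : ℂ) * h

/-- A divided difference of order `n` is a nonnegative combination of the `n`-th forward
differences. -/
lemma exists_spline (n d : ℕ) (a : ℤ) (L : Finset ℤ) (hL : L ⊆ Finset.Icc a (a + d))
    (hcard : L.card = n + 1) :
    ∃ B : ℤ →₀ ℝ, (∀ k, 0 ≤ B k) ∧ ∀ f : ℤ → ℂ,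
      (n.factorial : ℂ) * divDiff L f = B.sum fun k b => (b : ℂ) * (fwdDiff (1 : ℤ))^[n] f k := by
  induction d generalizing a L with
  | zero =>
    have hLe : L = Finset.Icc a (a + (0 : ℕ)) :=
      Finset.eq_of_subset_of_card_le hL (by simp [hcard])
    have hn : n = 0 := by
      rw [hLe] at hcard; simpa using hcard.symm
    subst hn
    refine ⟨Finsupp.single a 1, fun k => Finsupp.single_nonneg.mpr zero_le_one k, fun f => ?_⟩
    rw [Finsupp.sum_single_index (by simp), hLe, factorial_mul_divDiff_Icc]
    simp
  | succ d ih =>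
    by_cases hLe : L = Finset.Icc a (a + (d + 1 : ℕ))
    · have hn : n = d + 1 := by
        rw [hLe, Int.card_Icc] at hcard; omega
      subst hn
      refine ⟨Finsupp.single a 1, fun k => Finsupp.single_nonneg.mpr zero_le_one k, fun f => ?_⟩
      rw [Finsupp.sum_single_index (by simp), hLe, factorial_mul_divDiff_Icc]
      simp
    by_cases ha : a ∈ L
    swap
    · refine ih (a + 1) L (fun z hz => ?_) hcard
      have h1 := Finset.mem_Icc.mp (hL hz)
      have h2 : z ≠ a := fun e => ha (e ▸ hz)
      rw [Finset.mem_Icc]; push_cast at h1; omega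
    by_cases hb : a + (d + 1 : ℕ) ∈ L
    swap
    · refine ih a L (fun z hz => ?_) hcard
      have h1 := Finset.mem_Icc.mp (hL hz)
      have h2 : z ≠ a + (d + 1 : ℕ) := fun e => hb (e ▸ hz)
      rw [Finset.mem_Icc]; push_cast at h1 h2; omega
    obtain ⟨m, hmI, hmL⟩ : ∃ m ∈ Finset.Icc a (a + (d + 1 : ℕ)), m ∉ L := by
      by_contra! hcon
      exact hLe (hL.antisymm hcon)
    set b := a + (d + 1 : ℕ) with hbdef
    rw [Finset.mem_Icc] at hmI
    have ham : a < m := lt_of_le_of_ne hmI.1 fun e => hmL (e ▸ ha)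
    have hmb : m < b := lt_of_le_of_ne hmI.2 fun e => hmL (e ▸ hb)
    obtain ⟨B1, hB1, h1⟩ := ih a (insert m (L.erase b)) (fun z hz => by
        rcases Finset.mem_insert.mp hz with rfl | hz
        · rw [Finset.mem_Icc]; push_cast at *; omega
        · have h1 := Finset.mem_Icc.mp (hL (Finset.mem_of_mem_erase hz))
          have h2 := Finset.ne_of_mem_erase hz
          rw [Finset.mem_Icc]; push_cast at *; omega) (by
        rw [Finset.card_insert_of_notMem (fun h => hmL (Finset.mem_of_mem_erase h)),
          Finset.card_erase_of_mem hb]; omega)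
    obtain ⟨B2, hB2, h2⟩ := ih (a + 1) (insert m (L.erase a)) (fun z hz => by
        rcases Finset.mem_insert.mp hz with rfl | hz
        · rw [Finset.mem_Icc]; push_cast at *; omega
        · have h1 := Finset.mem_Icc.mp (hL (Finset.mem_of_mem_erase hz))
          have h2 := Finset.ne_of_mem_erase hz
          rw [Finset.mem_Icc]; push_cast at *; omega) (by
        rw [Finset.card_insert_of_notMem (fun h => hmL (Finset.mem_of_mem_erase h)),
          Finset.card_erase_of_mem ha]; omega)
    have hba : (0 : ℝ) < b - a := by
      rw [sub_pos]; exact_mod_cast ham.trans hmb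
    have hbaC : (b : ℂ) - a ≠ 0 := sub_ne_zero.mpr (by exact_mod_cast (ham.trans hmb).ne')
    have hma : (0 : ℝ) ≤ m - a := by
      rw [sub_nonneg]; exact_mod_cast ham.le
    have hbm : (0 : ℝ) ≤ b - m := by
      rw [sub_nonneg]; exact_mod_cast hmb.le
    refine ⟨((m - a : ℝ) / (b - a)) • B1 + ((b - m : ℝ) / (b - a)) • B2, fun k => ?_, fun f => ?_⟩
    · simp only [Finsupp.coe_add, Finsupp.coe_smul, Pi.add_apply, Pi.smul_apply, smul_eq_mul]
      have := hB1 k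
      have := hB2 k
      positivity
    · rw [Finsupp.sum_add_index' (by simp) (by intros; push_cast; ring),
        Finsupp.sum_smul_index (by simp), Finsupp.sum_smul_index (by simp)]
      simp only [Complex.ofReal_mul, mul_assoc]
      rw [← Finsupp.mul_sum, ← Finsupp.mul_sum, ← h1, ← h2]
      have hmb' : m ∉ L.erase b := fun h => hmL (Finset.mem_of_mem_erase h)
      have hma' : m ∉ L.erase a := fun h => hmL (Finset.mem_of_mem_erase h)
      have r1 := divDiff_sub_divDiff hmb' (Finset.notMem_erase b L) hmb.ne f
      have r2 := divDiff_sub_divDiff (Finset.notMem_erase a L) hma' ham.ne f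
      rw [Finset.insert_erase hb] at r1
      rw [Finset.insert_comm, Finset.insert_erase ha] at r2
      push_cast
      field_simp
      linear_combination (n.factorial : ℂ) * ((b - m : ℂ) * r2 - (m - a : ℂ) * r1)

lemma Signature.sum_node_eq_divDiff {N : ℕ} (lam : Signature N) (f : ℤ → ℂ) :
    ∑ j, f (lam.node j) * Lagrange.nodalWeight Finset.univ (fun j => (lam.node j : ℂ)) j =
      divDiff (Finset.univ.image lam.node) f := by
  have hinj := lam.node_strictAnti.injective
  rw [divDiff, Finset.sum_image hinj.injOn]
  refine Finset.sum_congr rfl fun j _ => ?_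
  congr 1
  rw [Lagrange.nodalWeight, ← Finset.image_erase hinj, Finset.prod_image hinj.injOn]

lemma Signature.exists_spline {n : ℕ} (lam : Signature (n + 1)) :
    ∃ B : ℤ →₀ ℝ, (∀ k, 0 ≤ B k) ∧ ∀ f : ℤ → ℂ,
      (n.factorial : ℂ) * ∑ j, f (lam.node j) *
          Lagrange.nodalWeight Finset.univ (fun j => (lam.node j : ℂ)) j =
        B.sum fun k b => (b : ℂ) * (fwdDiff (1 : ℤ))^[n] f k := by
  obtain ⟨B, hB, h⟩ := VershikKerov.exists_spline n
    (lam.node 0 - lam.node (Fin.last n)).toNat (lam.node (Fin.last n))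
    (Finset.univ.image lam.node) (by
      intro z hz
      obtain ⟨j, -, rfl⟩ := Finset.mem_image.mp hz
      have h1 := lam.node_strictAnti.antitone (Fin.zero_le j)
      have h2 := lam.node_strictAnti.antitone (Fin.le_last j)
      rw [Finset.mem_Icc]
      omega) (by rw [Finset.card_image_of_injective _ lam.node_strictAnti.injective]; simp)
  exact ⟨B, hB, fun f => by rw [lam.sum_node_eq_divDiff, h f]⟩

/-- The Laurent polynomial with coefficients `B`. -/
noncomputable def laurentEval (B : ℤ →₀ ℝ) (x : ℂ) : ℂ := B.sum fun k b => (b : ℂ) * x ^ k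

lemma norm_laurentEval_le {B : ℤ →₀ ℝ} (hB : ∀ k, 0 ≤ B k) (x : ℂ) :
    ‖laurentEval B x‖ ≤ ‖laurentEval B (‖x‖ : ℂ)‖ := by
  have h : laurentEval B (‖x‖ : ℂ) = ((B.sum fun k b => b * ‖x‖ ^ k : ℝ) : ℂ) := by
    simp [laurentEval, Finsupp.sum]
  rw [h, Complex.norm_real, Real.norm_eq_abs]
  refine le_trans ?_ (le_abs_self _)
  refine (norm_sum_le _ _).trans (Finset.sum_le_sum fun k _ => ?_)
  rw [norm_mul, norm_zpow, Complex.norm_real, Real.norm_of_nonneg (hB k)]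

lemma differentiableAt_laurentEval (B : ℤ →₀ ℝ) {x : ℂ} (hx : x ≠ 0) :
    DifferentiableAt ℂ (laurentEval B) x := by
  unfold laurentEval Finsupp.sum
  exact DifferentiableAt.fun_sum fun k _ =>
    (differentiableAt_zpow.mpr (Or.inl hx)).const_mul _

lemma fwdDiff_iter_zpow (n : ℕ) {x : ℂ} (hx : x ≠ 0) (k : ℤ) :
    (fwdDiff (1 : ℤ))^[n] (fun k : ℤ => x ^ k) k = (x - 1) ^ n * x ^ k := by
  induction n generalizing k with
  | zero => simp
  | succ n ih =>
    rw [Function.iterate_succ_apply', fwdDiff, ih, ih, zpow_add_one₀ hx]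
    ring

/-- The falling factorial `z (z - 1) ⋯ (z - m + 1)`. -/
noncomputable def fallFact (m : ℕ) (z : ℂ) : ℂ := ∏ i ∈ Finset.range m, (z - i)

lemma fallFact_add_one_sub (m : ℕ) (z : ℂ) :
    fallFact (m + 1) (z + 1) - fallFact (m + 1) z = (m + 1) * fallFact m z := by
  have h1 : fallFact (m + 1) (z + 1) = (z + 1) * fallFact m z := by
    rw [fallFact, Finset.prod_range_succ', mul_comm, fallFact]
    congr 1
    · simp
    · refine Finset.prod_congr rfl fun i _ => ?_
      push_cast; ring
  have h2 : fallFact (m + 1) z = fallFact m z * (z - m) := Finset.prod_range_succ _ _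
  rw [h1, h2]
  ring

lemma fwdDiff_iter_fallFact (n m : ℕ) (k : ℤ) :
    (m.factorial : ℂ) * (fwdDiff (1 : ℤ))^[n] (fun k : ℤ => fallFact (n + m) k) k =
      ((n + m).factorial : ℂ) * fallFact m k := by
  induction n generalizing m k with
  | zero => simp
  | succ n ih =>
    rw [Function.iterate_succ_apply', fwdDiff]
    have e : n + 1 + m = n + (m + 1) := by ring
    simp only [e]
    have h1 := ih (m + 1) (k + 1)
    have h2 := ih (m + 1) k
    have h3 := fallFact_add_one_sub m k
    have h4 : ((m : ℂ) + 1) ≠ 0 := by exact_mod_cast m.succ_ne_zero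
    apply mul_left_cancel₀ h4
    rw [Nat.factorial_succ m] at h1 h2
    push_cast at h1 h2
    linear_combination h1 - h2 + ((n + (m + 1)).factorial : ℂ) * h3

lemma iteratedDeriv_laurentEval (B : ℤ →₀ ℝ) (n : ℕ) :
    iteratedDeriv n (laurentEval B) 1 = B.sum fun k b => (b : ℂ) * fallFact n k := by
  unfold laurentEval Finsupp.sum
  rw [iteratedDeriv_fun_sum]
  · refine Finset.sum_congr rfl fun k _ => ?_
    rw [iteratedDeriv_const_mul_field, iteratedDeriv_eq_iterate, iter_deriv_zpow]
    simp [fallFact]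
  · intro k _
    exact contDiffAt_const.mul (analyticAt_id.zpow one_ne_zero).contDiffAt

/-- The spline data of a signature: nonnegative coefficients of the Laurent polynomial
`S_λ(x; N, 1)`. -/
structure IsSpline {n : ℕ} (lam : Signature (n + 1)) (B : ℤ →₀ ℝ) : Prop where
  nonneg : ∀ k, 0 ≤ B k
  sum_eq : ∀ f : ℤ → ℂ,
      (n.factorial : ℂ) * ∑ j, f (lam.node j) *
          Lagrange.nodalWeight Finset.univ (fun j => (lam.node j : ℂ)) j =
        B.sum fun k b => (b : ℂ) * (fwdDiff (1 : ℤ))^[n] f k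

lemma Signature.factorial_mul_sum_zero_node (n : ℕ) {x : ℂ} (hx : x ≠ 0) :
    (n.factorial : ℂ) * ∑ j, x ^ (zero (n + 1)).node j *
      Lagrange.nodalWeight Finset.univ (fun j => ((zero (n + 1)).node j : ℂ)) j = (x - 1) ^ n := by
  have h := (zero (n + 1)).sum_node_eq_divDiff fun k => x ^ k
  have himg : Finset.univ.image (zero (n + 1)).node = Finset.Icc 0 (0 + (n : ℤ)) := by
    refine Finset.eq_of_subset_of_card_le ?_ ?_
    · intro z hz
      obtain ⟨j, -, rfl⟩ := Finset.mem_image.mp hz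
      have := j.2
      simp only [node, zero, Finset.mem_Icc]
      omega
    · rw [Finset.card_image_of_injective _ (zero (n + 1)).node_strictAnti.injective]
      simp
  rw [h, himg, factorial_mul_divDiff_Icc, fwdDiff_iter_zpow n hx, zpow_zero, mul_one]

section
variable {n : ℕ} {lam : Signature (n + 1)} {B : ℤ →₀ ℝ}

lemma IsSpline.sum_zpow (h : IsSpline lam B) {x : ℂ} (hx : x ≠ 0) :
    (n.factorial : ℂ) * ∑ j, x ^ lam.node j *
          Lagrange.nodalWeight Finset.univ (fun j => (lam.node j : ℂ)) j =
      (x - 1) ^ n * laurentEval B x := by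
  rw [h.sum_eq (fun k => x ^ k), laurentEval, Finsupp.mul_sum]
  refine Finsupp.sum_congr fun k _ => ?_
  rw [fwdDiff_iter_zpow n hx]
  ring

lemma IsSpline.iteratedDeriv_one (h : IsSpline lam B) (m : ℕ) :
    ((n + m).factorial : ℂ) * iteratedDeriv m (laurentEval B) 1 =
      m.factorial * (n.factorial * ∑ j, fallFact (n + m) (lam.node j) *
          Lagrange.nodalWeight Finset.univ (fun j => (lam.node j : ℂ)) j) := by
  rw [h.sum_eq (fun k : ℤ => fallFact (n + m) k), iteratedDeriv_laurentEval, Finsupp.mul_sum,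
    Finsupp.mul_sum]
  refine Finsupp.sum_congr fun k _ => ?_
  have := fwdDiff_iter_fallFact n m k
  linear_combination -((B k : ℝ) : ℂ) * this

lemma IsSpline.laurentEval_one (h : IsSpline lam B) : laurentEval B 1 = 1 := by
  have h1 := h.iteratedDeriv_one 0
  rw [iteratedDeriv_zero] at h1
  have hinj : Function.Injective fun j => (lam.node j : ℂ) :=
    Int.cast_injective.comp lam.node_strictAnti.injective
  set P : Polynomial ℂ := ∏ i ∈ Finset.range n, (Polynomial.X - Polynomial.C (i : ℂ)) with hP
  have hmon : P.Monic := Polynomial.monic_prod_of_monic _ _ fun i _ => Polynomial.monic_X_sub_C _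
  have hdeg : P.natDegree = n := by
    rw [hP, Polynomial.natDegree_prod_of_monic _ _ fun i _ => Polynomial.monic_X_sub_C _]
    simp only [Polynomial.natDegree_X_sub_C]
    simp
  have h2 := Lagrange.coeff_eq_sum (s := Finset.univ) hinj.injOn (P := P) (by
    rw [Polynomial.degree_eq_natDegree hmon.ne_zero, hdeg, Finset.card_univ, Fintype.card_fin]
    exact_mod_cast n.lt_succ_self)
  rw [Finset.card_univ, Fintype.card_fin, Nat.add_sub_cancel] at h2
  have h3 : P.coeff n = 1 := by
    have := hmon.coeff_natDegree
    rwa [hdeg] at this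
  have h4 : ∑ j, fallFact (n + 0) (lam.node j) *
      Lagrange.nodalWeight Finset.univ (fun j => (lam.node j : ℂ)) j = 1 := by
    rw [← h3, h2]
    refine Finset.sum_congr rfl fun j _ => ?_
    rw [Lagrange.nodalWeight, Finset.prod_inv_distrib, div_eq_mul_inv, hP,
      Polynomial.eval_prod]
    simp [fallFact]
  rw [h4] at h1
  have h5 : (n.factorial : ℂ) ≠ 0 := by exact_mod_cast n.factorial_ne_zero
  apply mul_left_cancel₀ h5
  simpa using h1

end

/-! ### Frobenius coordinates -/

@[to_additive]
lemma prod_cells_eq_prod_rows {M : Type*} [CommMonoid M] (μ : YoungDiagram) {N : ℕ}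
    (hN : ∀ i j, (i, j) ∈ μ → i < N) (h : ℕ × ℕ → M) :
    ∏ c ∈ μ.cells, h c = ∏ i ∈ Finset.range N, ∏ j ∈ Finset.range (μ.rowLen i), h (i, j) := by
  refine Finset.prod_finset_product _ _ _ ?_
  rintro ⟨i, j⟩
  simp only [YoungDiagram.mem_cells, Finset.mem_range, ← YoungDiagram.mem_iff_lt_rowLen]
  exact ⟨fun hc => ⟨hN i j hc, hc⟩, fun hc => hc.2⟩

@[to_additive]
lemma prod_cells_eq_prod_hooks {M : Type*} [CommMonoid M] (μ : YoungDiagram) {D : ℕ}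
    (hD : (D, D) ∉ μ) (h : ℕ × ℕ → M) :
    ∏ c ∈ μ.cells, h c = ∏ t ∈ Finset.range D, ((∏ j ∈ Finset.Ico t (μ.rowLen t), h (t, j)) *
      ∏ i ∈ Finset.Ico (t + 1) (μ.colLen t), h (i, t)) := by
  rw [← Finset.prod_filter_mul_prod_filter_not μ.cells (fun c => c.1 ≤ c.2), Finset.prod_mul_distrib]
  congr 1
  · refine Finset.prod_finset_product _ _ _ ?_
    rintro ⟨i, j⟩
    simp only [Finset.mem_filter, YoungDiagram.mem_cells, Finset.mem_range, Finset.mem_Ico,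
      ← YoungDiagram.mem_iff_lt_rowLen]
    refine ⟨fun hc => ⟨?_, hc.2, hc.1⟩, fun hc => ⟨hc.2.2, hc.2.1⟩⟩
    by_contra! hcon
    exact hD (μ.up_left_mem hcon (hcon.trans hc.2) hc.1)
  · refine Finset.prod_finset_product_right _ _ _ ?_
    rintro ⟨i, j⟩
    simp only [Finset.mem_filter, YoungDiagram.mem_cells, Finset.mem_range, Finset.mem_Ico,
      ← YoungDiagram.mem_iff_lt_colLen, not_le]
    refine ⟨fun hc => ⟨?_, hc.2, hc.1⟩, fun hc => ⟨hc.2.2, hc.2.1⟩⟩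
    by_contra! hcon
    exact hD (μ.up_left_mem (hcon.trans hc.2.le) hcon hc.1)

lemma frobP_nonneg (μ : YoungDiagram) (i : ℕ) : 0 ≤ frobP μ i := by
  unfold frobP
  split_ifs with h
  · have h1 : (i : ℝ) + 1 ≤ μ.rowLen i := by
      exact_mod_cast YoungDiagram.mem_iff_lt_rowLen.mp h
    linarith
  · exact le_rfl

lemma frobQ_nonneg (μ : YoungDiagram) (i : ℕ) : 0 ≤ frobQ μ i := by
  unfold frobQ
  split_ifs with h
  · have h1 : (i : ℝ) + 1 ≤ μ.colLen i := by
      exact_mod_cast YoungDiagram.mem_iff_lt_colLen.mp h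
    linarith
  · exact le_rfl

lemma frobP_antitone (μ : YoungDiagram) : Antitone (frobP μ) := by
  intro i j hij
  by_cases hj : (j, j) ∈ μ
  · have hi : (i, i) ∈ μ := μ.up_left_mem hij hij hj
    have h1 : (μ.rowLen j : ℝ) ≤ μ.rowLen i := by exact_mod_cast μ.rowLen_anti i j hij
    have h2 : (i : ℝ) ≤ j := by exact_mod_cast hij
    simp only [frobP, if_pos hi, if_pos hj]
    linarith
  · rw [frobP, if_neg hj]
    exact frobP_nonneg μ i

lemma frobQ_antitone (μ : YoungDiagram) : Antitone (frobQ μ) := by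
  intro i j hij
  by_cases hj : (j, j) ∈ μ
  · have hi : (i, i) ∈ μ := μ.up_left_mem hij hij hj
    have h1 : (μ.colLen j : ℝ) ≤ μ.colLen i := by exact_mod_cast μ.colLen_anti i j hij
    have h2 : (i : ℝ) ≤ j := by exact_mod_cast hij
    simp only [frobQ, if_pos hi, if_pos hj]
    linarith
  · rw [frobQ, if_neg hj]
    exact frobQ_nonneg μ i

lemma frob_eq_zero {μ : YoungDiagram} {D : ℕ} (hD : (D, D) ∉ μ) {i : ℕ} (hi : D ≤ i) :
    frobP μ i = 0 ∧ frobQ μ i = 0 := by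
  have h : (i, i) ∉ μ := fun h => hD (μ.up_left_mem hi hi h)
  simp [frobP, frobQ, h]

lemma sum_frob {μ : YoungDiagram} {D : ℕ} (hD : (D, D) ∉ μ) :
    ∑ i ∈ Finset.range D, (frobP μ i + frobQ μ i) = μ.card := by
  have h := sum_cells_eq_sum_hooks μ hD (fun _ => (1 : ℝ))
  simp only [Finset.sum_const, nsmul_eq_mul, mul_one, Nat.card_Ico] at h
  rw [YoungDiagram.card, h]
  refine Finset.sum_congr rfl fun t _ => ?_
  by_cases ht : (t, t) ∈ μ
  · have h1 : t + 1 ≤ μ.rowLen t := YoungDiagram.mem_iff_lt_rowLen.mp ht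
    have h2 : t + 1 ≤ μ.colLen t := YoungDiagram.mem_iff_lt_colLen.mp ht
    simp only [frobP, frobQ, if_pos ht]
    rw [Nat.cast_sub (by omega), Nat.cast_sub h2]
    push_cast
    ring
  · have h1 : μ.rowLen t ≤ t := by
      by_contra! hc; exact ht (YoungDiagram.mem_iff_lt_rowLen.mpr hc)
    have h2 : μ.colLen t ≤ t + 1 := by
      by_contra! hc; exact ht (YoungDiagram.mem_iff_lt_colLen.mpr (by omega))
    simp only [frobP, frobQ, if_neg ht]
    rw [Nat.sub_eq_zero_of_le h1, Nat.sub_eq_zero_of_le h2]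
    simp

/-- The factor attached to a box of content `c`. -/
noncomputable def boxFactor (w : ℂ) (c : ℤ) : ℂ := (w - c + 1 / 2) / (w - c - 1 / 2)

lemma prod_boxFactor_right (w : ℂ) (s : ℤ) (A : ℕ) (h0 : w + s + 1 / 2 ≠ 0)
    (h : ∀ a < A, w + s - a - 1 / 2 ≠ 0) :
    ∏ a ∈ Finset.range A, boxFactor w (a - s) = (w + s + 1 / 2) / (w + s + 1 / 2 - A) := by
  induction A with
  | zero => rw [Finset.prod_range_zero, Nat.cast_zero, sub_zero, div_self h0]
  | succ A ih =>
    rw [Finset.prod_range_succ, ih fun a ha => h a (by omega), boxFactor]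
    have h1 := h A (by omega)
    have h2 : w + s + 1 / 2 - A ≠ 0 := by
      rcases A with _ | A
      · simpa using h0
      · have := h A (by omega)
        push_cast
        convert this using 1
        ring
    have e1 : w - ((A - s : ℤ) : ℂ) + 1 / 2 = w + s + 1 / 2 - A := by push_cast; ring
    have e2 : w - ((A - s : ℤ) : ℂ) - 1 / 2 = w + s - A - 1 / 2 := by push_cast; ring
    have e3 : w + s + 1 / 2 - ((A + 1 : ℕ) : ℂ) = w + s - A - 1 / 2 := by push_cast; ring
    rw [e1, e2, e3, div_mul_div_cancel₀ h2]

lemma prod_boxFactor_left (w : ℂ) (C : ℕ) (h : ∀ b ≤ C, w + b + 1 / 2 ≠ 0) :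
    ∏ b ∈ Finset.range C, boxFactor w (-(b + 1 : ℕ)) = (w + C + 1 / 2) / (w + 1 / 2) := by
  induction C with
  | zero =>
    have := h 0 le_rfl
    simp only [Nat.cast_zero, add_zero] at this
    simp only [Finset.range_zero, Finset.prod_empty, Nat.cast_zero, add_zero]
    rw [div_self this]
  | succ C ih =>
    rw [Finset.prod_range_succ, ih fun b hb => h b (by omega), boxFactor]
    have h1 := h C (by omega)
    have e1 : w - ((-((C + 1 : ℕ) : ℤ) : ℤ) : ℂ) + 1 / 2 = w + (C + 1 : ℕ) + 1 / 2 := by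
      push_cast; ring
    have e2 : w - ((-((C + 1 : ℕ) : ℤ) : ℤ) : ℂ) - 1 / 2 = w + C + 1 / 2 := by push_cast; ring
    rw [e1, e2, mul_comm, div_mul_div_cancel₀ h1]

lemma sub_half_ne_zero {w : ℂ} {R : ℝ} (hw : R < ‖w‖) {r : ℝ} (hr : |r| ≤ R) : w - r ≠ 0 := by
  intro h
  rw [sub_eq_zero.mp h, Complex.norm_real, Real.norm_eq_abs] at hw
  linarith

/-- The Frobenius form of the generating function of a Young diagram. -/
lemma prod_rows_eq_prod_frob (μ : YoungDiagram) {N D : ℕ} (hN : ∀ i j, (i, j) ∈ μ → i < N)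
    (hD : (D, D) ∉ μ) {R : ℝ} (hNR : N ≤ R) (hR : 1 / 2 ≤ R) (hp : frobP μ 0 ≤ R)
    (hq : frobQ μ 0 ≤ R) {w : ℂ} (hw : R < ‖w‖) :
    ∏ i ∈ Finset.range N, ((w + i + 1 / 2) / (w + i + 1 / 2 - μ.rowLen i)) =
      ∏ t ∈ Finset.range D, ((w + frobQ μ t) / (w - frobP μ t)) := by
  have hrow : ∀ i, (μ.rowLen i : ℝ) - 1 / 2 ≤ R := by
    intro i
    have h1 : (μ.rowLen i : ℝ) ≤ μ.rowLen 0 := by exact_mod_cast μ.rowLen_anti 0 i (Nat.zero_le _)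
    by_cases h00 : (0, 0) ∈ μ
    · rw [frobP, if_pos h00] at hp
      push_cast at hp
      linarith
    · have : μ.rowLen 0 = 0 := by
        by_contra hc
        exact h00 (YoungDiagram.mem_iff_lt_rowLen.mpr (Nat.pos_of_ne_zero hc))
      rw [this] at h1
      push_cast at h1
      linarith
  have hcol : ∀ i, (μ.colLen i : ℝ) - 1 / 2 ≤ R := by
    intro i
    have h1 : (μ.colLen i : ℝ) ≤ μ.colLen 0 := by exact_mod_cast μ.colLen_anti 0 i (Nat.zero_le _)
    by_cases h00 : (0, 0) ∈ μ
    · rw [frobQ, if_pos h00] at hq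
      push_cast at hq
      linarith
    · have : μ.colLen 0 = 0 := by
        by_contra hc
        exact h00 (YoungDiagram.mem_iff_lt_colLen.mpr (Nat.pos_of_ne_zero hc))
      rw [this] at h1
      push_cast at h1
      linarith
  have hne : ∀ r : ℝ, -R ≤ r → r ≤ R → w - r ≠ 0 := fun r h1 h2 =>
    sub_half_ne_zero hw (abs_le.mpr ⟨h1, h2⟩)
  have h1 := prod_cells_eq_prod_rows μ hN (fun c => boxFactor w (c.2 - c.1))
  have h2 := prod_cells_eq_prod_hooks μ hD (fun c => boxFactor w (c.2 - c.1))
  have e1 : ∀ i ∈ Finset.range N, ∏ j ∈ Finset.range (μ.rowLen i), boxFactor w (j - i) =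
      (w + i + 1 / 2) / (w + i + 1 / 2 - μ.rowLen i) := by
    intro i hi
    have hiN : (i : ℝ) + 1 ≤ N := by exact_mod_cast Finset.mem_range.mp hi
    have := prod_boxFactor_right w i (μ.rowLen i) (by
      have := hne (-(i + 1 / 2)) (by linarith) (by
        have : (0 : ℝ) ≤ i := i.cast_nonneg
        linarith)
      push_cast at this ⊢
      convert this using 1
      ring) (fun a ha => by
      have ha' : (a : ℝ) + 1 ≤ μ.rowLen i := by exact_mod_cast ha
      have h3 := hrow i
      have : (0 : ℝ) ≤ i := i.cast_nonneg
      have : (0 : ℝ) ≤ a := a.cast_nonneg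
      have := hne (a + 1 / 2 - i) (by linarith) (by linarith)
      push_cast at this ⊢
      convert this using 1
      ring)
    push_cast at this
    exact this
  have e2 : ∀ t ∈ Finset.range D, ((∏ j ∈ Finset.Ico t (μ.rowLen t), boxFactor w (j - t)) *
      ∏ i ∈ Finset.Ico (t + 1) (μ.colLen t), boxFactor w (t - i)) =
      (w + frobQ μ t) / (w - frobP μ t) := by
    intro t _
    have hw0 : w ≠ 0 := by
      have := hne 0 (by linarith) (by linarith)
      simpa using this
    by_cases ht : (t, t) ∈ μ
    · have h1 : t + 1 ≤ μ.rowLen t := YoungDiagram.mem_iff_lt_rowLen.mp ht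
      have h2 : t + 1 ≤ μ.colLen t := YoungDiagram.mem_iff_lt_colLen.mp ht
      obtain ⟨A, hA⟩ := Nat.exists_eq_add_of_le h1
      obtain ⟨C, hC⟩ := Nat.exists_eq_add_of_le h2
      have hrt := hrow t
      have hct := hcol t
      have ht0 : (0 : ℝ) ≤ t := t.cast_nonneg
      simp only [frobP, frobQ, if_pos ht]
      rw [hA] at hrt ⊢
      rw [hC] at hct ⊢
      push_cast at hrt hct
      have hw2 : w + 1 / 2 ≠ 0 := by
        have := hne (-(1 / 2)) (by linarith) (by linarith)
        push_cast at this
        convert this using 1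
        ring
      have p1 : ∏ j ∈ Finset.Ico t (t + 1 + A), boxFactor w (j - t) =
          (w + 1 / 2) / (w + 1 / 2 - (A + 1 : ℕ)) := by
        rw [Finset.prod_Ico_eq_prod_range]
        have := prod_boxFactor_right w 0 (A + 1) (by simpa using hw2) (fun a ha => by
          have ha' : (a : ℝ) ≤ A := by exact_mod_cast Nat.lt_succ_iff.mp ha
          have : (0 : ℝ) ≤ a := a.cast_nonneg
          have := hne (a + 1 / 2) (by linarith) (by linarith)
          push_cast at this ⊢
          convert this using 1
          ring)
        simp only [Int.cast_zero, add_zero] at this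
        rw [← this]
        have e : t + 1 + A - t = A + 1 := by omega
        rw [e]
        refine Finset.prod_congr rfl fun a _ => ?_
        congr 1
        push_cast
        ring
      have p2 : ∏ i ∈ Finset.Ico (t + 1) (t + 1 + C), boxFactor w (t - i) =
          (w + C + 1 / 2) / (w + 1 / 2) := by
        rw [Finset.prod_Ico_eq_prod_range]
        have := prod_boxFactor_left w C (fun b hb => by
          have hb' : (b : ℝ) ≤ C := by exact_mod_cast hb
          have : (0 : ℝ) ≤ b := b.cast_nonneg
          have := hne (-(b + 1 / 2)) (by linarith) (by linarith)
          push_cast at this ⊢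
          convert this using 1
          ring)
        rw [← this]
        have e : t + 1 + C - (t + 1) = C := by omega
        rw [e]
        refine Finset.prod_congr rfl fun a _ => ?_
        congr 1
        push_cast
        ring
      rw [p1, p2, mul_comm, div_mul_div_cancel₀ hw2]
      push_cast
      congr 1 <;> ring
    · have h1 : μ.rowLen t ≤ t := by
        by_contra! hc; exact ht (YoungDiagram.mem_iff_lt_rowLen.mpr hc)
      have h2 : μ.colLen t ≤ t + 1 := by
        by_contra! hc; exact ht (YoungDiagram.mem_iff_lt_colLen.mpr (by omega))
      rw [Finset.Ico_eq_empty (by omega), Finset.Ico_eq_empty (by omega)]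
      simp [frobP, frobQ, if_neg ht, hw0]
  rw [← Finset.prod_congr rfl e1, ← Finset.prod_congr rfl e2]
  exact h1.symm.trans h2

lemma Signature.mem_posDiagram {N : ℕ} (lam : Signature N) {i j : ℕ} :
    (i, j) ∈ lam.posDiagram ↔ ∃ h : i < N, j < (lam.1 ⟨i, h⟩).toNat := by
  rw [Signature.posDiagram, YoungDiagram.mem_ofRowLens]
  simp

lemma Signature.rowLen_posDiagram {N : ℕ} (lam : Signature N) (i : Fin N) :
    lam.posDiagram.rowLen i = (lam.1 i).toNat := by
  refine eq_of_forall_lt_iff fun j => ?_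
  rw [← YoungDiagram.mem_iff_lt_rowLen, mem_posDiagram]
  simp

/-- The Frobenius product `∏ (w + q_t) / (w - p_t)`. -/
noncomputable def frobProd (μ : YoungDiagram) (w : ℂ) : ℂ :=
  ∏ t ∈ Finset.range (μ.rowLen 0), ((w + frobQ μ t) / (w - frobP μ t))

lemma diag_rowLen_notMem (μ : YoungDiagram) : (μ.rowLen 0, μ.rowLen 0) ∉ μ := fun h =>
  absurd (μ.rowLen_anti 0 _ (Nat.zero_le _)) (not_le.mpr (YoungDiagram.mem_iff_lt_rowLen.mp h))

lemma Signature.prod_div_eq_frobProd {N : ℕ} (lam : Signature N) {R : ℝ} (hNR : N ≤ R)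
    (hR : 1 / 2 ≤ R) (hp : frobP lam.posDiagram 0 ≤ R) (hq : frobQ lam.posDiagram 0 ≤ R) {w : ℂ}
    (hw : R < ‖w‖) :
    ∏ i : Fin N, ((w + (i : ℕ) + 1 / 2) / (w + (i : ℕ) + 1 / 2 - ((lam.1 i).toNat : ℕ))) =
      frobProd lam.posDiagram w := by
  have h := prod_rows_eq_prod_frob lam.posDiagram (N := N)
    (fun i j hij => (lam.mem_posDiagram.mp hij).1) (diag_rowLen_notMem _) hNR hR hp hq hw
  rw [frobProd, ← h, ← Fin.prod_univ_eq_prod_range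
    (fun i => (w + i + 1 / 2) / (w + i + 1 / 2 - (lam.posDiagram.rowLen i : ℂ))) N]
  simp only [lam.rowLen_posDiagram]

lemma Signature.fallFact_div_prod_node {N : ℕ} (lam : Signature N) {R : ℝ} (hNR : N ≤ R)
    (hR : 1 / 2 ≤ R)
    (hp : frobP lam.posDiagram 0 ≤ R) (hq : frobQ lam.posDiagram 0 ≤ R)
    (hp' : frobP lam.negDiagram 0 ≤ R) (hq' : frobQ lam.negDiagram 0 ≤ R) {z : ℂ}
    (hz : R < ‖z - N + 1 / 2‖) (hz' : R < ‖-(z + 1 / 2)‖) :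
    fallFact N z / ∏ i, (z - lam.node i) =
      frobProd lam.posDiagram (z - N + 1 / 2) * frobProd lam.negDiagram (-(z + 1 / 2)) := by
  rw [← lam.prod_div_eq_frobProd hNR hR hp hq hz, negDiagram,
    ← lam.dual.prod_div_eq_frobProd hNR hR hp' hq' hz', fallFact,
    ← Finset.prod_range_reflect, ← Fin.prod_univ_eq_prod_range (fun i => z - ((N - 1 - i : ℕ) : ℂ)),
    ← Finset.prod_div_distrib,
    ← (Equiv.prod_comp Fin.revPerm fun i : Fin N =>
      ((-(z + 1 / 2) + (i : ℕ) + 1 / 2) /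
        (-(z + 1 / 2) + (i : ℕ) + 1 / 2 - ((lam.dual.1 i).toNat : ℕ)))),
    ← Finset.prod_mul_distrib]
  refine Finset.prod_congr rfl fun i _ => ?_
  have hi : (i : ℕ) + 1 ≤ N := i.2
  have hiR : ((i : ℕ) : ℝ) + 1 ≤ N := by exact_mod_cast hi
  have hi0 : (0 : ℝ) ≤ (i : ℕ) := (i : ℕ).cast_nonneg
  have hne : z - N + 1 + (i : ℕ) ≠ 0 := by
    have := sub_half_ne_zero hz (r := -((i : ℕ) + 1 / 2)) (abs_le.mpr ⟨by linarith, by linarith⟩)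
    push_cast at this
    convert this using 1
    ring
  have e1 : z - ((N - 1 - i : ℕ) : ℂ) = z - N + 1 + (i : ℕ) := by
    rw [Nat.sub_sub, Nat.cast_sub (by omega)]; push_cast; ring
  have e2 : z - N + 1 / 2 + (i : ℕ) + 1 / 2 = z - N + 1 + (i : ℕ) := by ring
  have e3 : -(z + 1 / 2) + ((Fin.revPerm i : Fin N) : ℕ) + 1 / 2 = -(z - N + 1 + (i : ℕ)) := by
    rw [Fin.revPerm_apply, Fin.val_rev, Nat.cast_sub (by omega)]; push_cast; ring
  have e4 : z - lam.node i = z - N + 1 + (i : ℕ) - (lam.1 i : ℂ) := by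
    rw [node]; push_cast; ring
  have e5 : lam.dual.1 (Fin.revPerm i) = -lam.1 i := by
    simp [dual]
  rw [e1, e2, e3, e4, e5]
  have hne' : -(z - N + 1 + (i : ℕ)) ≠ 0 := neg_ne_zero.mpr hne
  rcases le_total 0 (lam.1 i) with h | h
  · have t1 : (((lam.1 i).toNat : ℕ) : ℂ) = lam.1 i := by
      exact_mod_cast congrArg (Int.cast : ℤ → ℂ) (Int.toNat_of_nonneg h)
    have t2 : (-lam.1 i).toNat = 0 := by omega
    rw [t1, t2, Nat.cast_zero, sub_zero, div_self hne', mul_one]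
  · have t1 : (((-lam.1 i).toNat : ℕ) : ℂ) = -lam.1 i := by
      exact_mod_cast congrArg (Int.cast : ℤ → ℂ) (Int.toNat_of_nonneg (neg_nonneg.mpr h))
    have t2 : (lam.1 i).toNat = 0 := by omega
    rw [t1, t2, Nat.cast_zero, sub_zero, div_self hne, one_mul, ← neg_div_neg_eq]
    congr 1
    ring

/-! ### One-sided Voiculescu–Edrei functions as limits -/

/-- The logarithm of `(1 + q v) / (1 - p v)`. -/
noncomputable def logFactor (p q : ℝ) (v : ℂ) : ℂ := Complex.log (1 + q * v) - Complex.log (1 - p * v)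

lemma norm_ofReal_mul_le_half {p M ρ : ℝ} {v : ℂ} (hp : 0 ≤ p) (hpM : p ≤ M) (hρ : M * ρ ≤ 1 / 2)
    (hv : ‖v‖ ≤ ρ) : ‖(p : ℂ) * v‖ ≤ 1 / 2 := by
  rw [norm_mul, Complex.norm_real, Real.norm_of_nonneg hp]
  exact (mul_le_mul hpM hv (norm_nonneg _) (hp.trans hpM)).trans hρ

lemma one_add_ne_zero_of_norm_le_half {z : ℂ} (hz : ‖z‖ ≤ 1 / 2) : 1 + z ≠ 0 := by
  intro h
  have : z = -1 := by linear_combination h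
  rw [this, norm_neg, norm_one] at hz
  norm_num at hz

lemma norm_log_one_add_sub_self_le_sq {z : ℂ} (hz : ‖z‖ ≤ 1 / 2) :
    ‖Complex.log (1 + z) - z‖ ≤ ‖z‖ ^ 2 := by
  refine (Complex.norm_log_one_add_sub_self_le (hz.trans_lt (by norm_num))).trans ?_
  have h1 : (1 - ‖z‖)⁻¹ ≤ 2 := by
    rw [inv_le_comm₀ (by linarith) (by norm_num)]
    linarith
  have h2 := mul_le_mul_of_nonneg_left h1 (sq_nonneg ‖z‖)
  linarith

section
variable {p q M ρ : ℝ} {v : ℂ}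

lemma norm_logFactor_le (hp : 0 ≤ p) (hq : 0 ≤ q) (hpM : p ≤ M) (hqM : q ≤ M)
    (hρ : M * ρ ≤ 1 / 2) (hv : ‖v‖ ≤ ρ) : ‖logFactor p q v‖ ≤ 2 * ρ * (p + q) := by
  have h1 := Complex.norm_log_one_add_half_le_self (norm_ofReal_mul_le_half hq hqM hρ hv)
  have h2 := Complex.norm_log_one_add_half_le_self (z := -((p : ℂ) * v))
    (by rw [norm_neg]; exact norm_ofReal_mul_le_half hp hpM hρ hv)
  rw [← sub_eq_add_neg] at h2
  refine (norm_sub_le _ _).trans ((add_le_add h1 h2).trans ?_)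
  rw [norm_neg, norm_mul, norm_mul, Complex.norm_real, Complex.norm_real, Real.norm_of_nonneg hp,
    Real.norm_of_nonneg hq]
  have h3 := mul_le_mul_of_nonneg_left hv hp
  have h4 := mul_le_mul_of_nonneg_left hv hq
  have h5 := mul_nonneg hp (norm_nonneg v)
  have h6 := mul_nonneg hq (norm_nonneg v)
  linarith

lemma norm_logFactor_sub_le (hp : 0 ≤ p) (hq : 0 ≤ q) (hpM : p ≤ M) (hqM : q ≤ M)
    (hρ : M * ρ ≤ 1 / 2) (hv : ‖v‖ ≤ ρ) :
    ‖logFactor p q v - ((p + q : ℝ) : ℂ) * v‖ ≤ ρ ^ 2 * (p ^ 2 + q ^ 2) := by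
  have h1 := norm_log_one_add_sub_self_le_sq (norm_ofReal_mul_le_half hq hqM hρ hv)
  have h2 := norm_log_one_add_sub_self_le_sq (z := -((p : ℂ) * v))
    (by rw [norm_neg]; exact norm_ofReal_mul_le_half hp hpM hρ hv)
  rw [← sub_eq_add_neg] at h2
  have e : logFactor p q v - ((p + q : ℝ) : ℂ) * v =
      (Complex.log (1 + q * v) - q * v) - (Complex.log (1 - p * v) - -(p * v)) := by
    rw [logFactor]; push_cast; ring
  rw [e]
  refine (norm_sub_le _ _).trans ((add_le_add h1 h2).trans ?_)
  rw [norm_neg, norm_mul, norm_mul, Complex.norm_real, Complex.norm_real, Real.norm_of_nonneg hp,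
    Real.norm_of_nonneg hq, mul_pow, mul_pow]
  have h3 : ‖v‖ ^ 2 ≤ ρ ^ 2 := pow_le_pow_left₀ (norm_nonneg _) hv 2
  have h4 := mul_le_mul_of_nonneg_left h3 (sq_nonneg p)
  have h5 := mul_le_mul_of_nonneg_left h3 (sq_nonneg q)
  linarith

lemma exp_logFactor (hp : 0 ≤ p) (hq : 0 ≤ q) (hpM : p ≤ M) (hqM : q ≤ M)
    (hρ : M * ρ ≤ 1 / 2) (hv : ‖v‖ ≤ ρ) :
    Complex.exp (logFactor p q v) = (1 + q * v) / (1 - p * v) := by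
  have h1 := one_add_ne_zero_of_norm_le_half (norm_ofReal_mul_le_half hq hqM hρ hv)
  have h2 := one_add_ne_zero_of_norm_le_half (z := -((p : ℂ) * v))
    (by rw [norm_neg]; exact norm_ofReal_mul_le_half hp hpM hρ hv)
  rw [← sub_eq_add_neg] at h2
  rw [logFactor, Complex.exp_sub, Complex.exp_log h1, Complex.exp_log h2]

lemma tendsto_logFactor {ι : Type*} {F : Filter ι} {P Q : ι → ℝ} (hP : Tendsto P F (𝓝 p))
    (hQ : Tendsto Q F (𝓝 q)) (hp : 0 ≤ p) (hq : 0 ≤ q) (hpM : p ≤ M) (hqM : q ≤ M)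
    (hρ : M * ρ ≤ 1 / 2) (hv : ‖v‖ ≤ ρ) :
    Tendsto (fun i => logFactor (P i) (Q i) v) F (𝓝 (logFactor p q v)) := by
  have h1 : 1 + (q : ℂ) * v ∈ Complex.slitPlane := Complex.mem_slitPlane_of_norm_lt_one
    ((norm_ofReal_mul_le_half hq hqM hρ hv).trans_lt (by norm_num))
  have h2 : 1 + -((p : ℂ) * v) ∈ Complex.slitPlane := Complex.mem_slitPlane_of_norm_lt_one
    (by rw [norm_neg]; exact (norm_ofReal_mul_le_half hp hpM hρ hv).trans_lt (by norm_num))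
  rw [← sub_eq_add_neg] at h2
  have c1 : Tendsto (fun i => ((P i : ℝ) : ℂ)) F (𝓝 p) := (Complex.continuous_ofReal.tendsto p).comp hP
  have c2 : Tendsto (fun i => ((Q i : ℝ) : ℂ)) F (𝓝 q) := (Complex.continuous_ofReal.tendsto q).comp hQ
  exact (((c2.mul_const v).const_add 1).clog h1).sub (((c1.mul_const v).const_sub 1).clog h2)

end

/-- The function `∏ (1 + q_t v / N) / (1 - p_t v / N)`. -/
noncomputable def scaledFrob (μ : YoungDiagram) (N : ℕ) (v : ℂ) : ℂ :=
  ∏ t ∈ Finset.range (μ.rowLen 0),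
    ((1 + ((frobQ μ t / N : ℝ) : ℂ) * v) / (1 - ((frobP μ t / N : ℝ) : ℂ) * v))

section
variable {μ : YoungDiagram} {N : ℕ} {M : ℝ}

lemma frob_div_le (hM : (μ.card : ℝ) / N ≤ M) (i : ℕ) :
    frobP μ i / N ≤ M / (i + 1) ∧ frobQ μ i / N ≤ M / (i + 1) := by
  have hD : (μ.rowLen 0 + i + 1, μ.rowLen 0 + i + 1) ∉ μ := fun h =>
    diag_rowLen_notMem μ (μ.up_left_mem (by omega) (by omega) h)
  have h1 := sum_frob hD
  have h2 : ((i : ℝ) + 1) * (frobP μ i + frobQ μ i) ≤ μ.card := by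
    rw [← h1]
    calc ((i : ℝ) + 1) * (frobP μ i + frobQ μ i)
        = ∑ j ∈ Finset.range (i + 1), (frobP μ i + frobQ μ i) := by
          rw [Finset.sum_const, Finset.card_range, nsmul_eq_mul]; push_cast; ring
      _ ≤ ∑ j ∈ Finset.range (i + 1), (frobP μ j + frobQ μ j) :=
          Finset.sum_le_sum fun j hj => by
            have hji : j ≤ i := Nat.lt_succ_iff.mp (Finset.mem_range.mp hj)
            exact add_le_add (frobP_antitone μ hji) (frobQ_antitone μ hji)
      _ ≤ _ := Finset.sum_le_sum_of_subset_of_nonneg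
          (Finset.range_subset_range.mpr (by omega))
          fun j _ _ => add_nonneg (frobP_nonneg μ j) (frobQ_nonneg μ j)
  have h3 : (0 : ℝ) < (i : ℝ) + 1 := by positivity
  have hp := frobP_nonneg μ i
  have hq := frobQ_nonneg μ i
  have h4 : (frobP μ i + frobQ μ i) / N ≤ M / (i + 1) := by
    rw [le_div_iff₀ h3]
    refine le_trans ?_ hM
    rw [div_mul_eq_mul_div, mul_comm]
    gcongr
  rw [add_div] at h4
  have : 0 ≤ frobP μ i / N := by positivity
  have : 0 ≤ frobQ μ i / N := by positivity
  constructor <;> linarith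

lemma frob_div_le' (hM : (μ.card : ℝ) / N ≤ M) (i : ℕ) :
    frobP μ i / N ≤ M ∧ frobQ μ i / N ≤ M := by
  have hM0 : 0 ≤ M := le_trans (by positivity) hM
  have h := frob_div_le hM i
  have h2 : M / ((i : ℝ) + 1) ≤ M := div_le_self hM0 (by
    have : (0 : ℝ) ≤ i := i.cast_nonneg
    linarith)
  exact ⟨h.1.trans h2, h.2.trans h2⟩

variable {ρ : ℝ}

lemma scaledFrob_eq_exp (hM : (μ.card : ℝ) / N ≤ M) (hρ : M * ρ ≤ 1 / 2) {v : ℂ} (hv : ‖v‖ ≤ ρ) :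
    scaledFrob μ N v = Complex.exp (∑ t ∈ Finset.range (μ.rowLen 0),
      logFactor (frobP μ t / N) (frobQ μ t / N) v) := by
  rw [Complex.exp_sum, scaledFrob]
  refine Finset.prod_congr rfl fun t _ => ?_
  have h := frob_div_le' hM t
  have hp := frobP_nonneg μ t
  have hq := frobQ_nonneg μ t
  rw [exp_logFactor (by positivity) (by positivity) h.1 h.2 hρ hv]

lemma sum_frob_div (μ : YoungDiagram) (N : ℕ) : ∑ t ∈ Finset.range (μ.rowLen 0),
    (frobP μ t / N + frobQ μ t / N) = (μ.card : ℝ) / N := by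
  rw [← sum_frob (diag_rowLen_notMem μ), Finset.sum_div]
  exact Finset.sum_congr rfl fun t _ => (add_div _ _ _).symm

lemma norm_scaledFrob_le (hM : (μ.card : ℝ) / N ≤ M) (hρ : M * ρ ≤ 1 / 2) {v : ℂ}
    (hv : ‖v‖ ≤ ρ) : ‖scaledFrob μ N v‖ ≤ Real.exp 1 := by
  rw [scaledFrob_eq_exp hM hρ hv, Complex.norm_exp]
  refine Real.exp_le_exp.mpr ((Complex.re_le_norm _).trans ((norm_sum_le _ _).trans ?_))
  have hρ0 : 0 ≤ ρ := (norm_nonneg v).trans hv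
  calc ∑ t ∈ Finset.range (μ.rowLen 0), ‖logFactor (frobP μ t / N) (frobQ μ t / N) v‖
      ≤ ∑ t ∈ Finset.range (μ.rowLen 0), 2 * ρ * (frobP μ t / N + frobQ μ t / N) := by
        refine Finset.sum_le_sum fun t _ => ?_
        have h := frob_div_le' hM t
        have hp := frobP_nonneg μ t
        have hq := frobQ_nonneg μ t
        exact norm_logFactor_le (by positivity) (by positivity) h.1 h.2 hρ hv
    _ = 2 * ρ * ((μ.card : ℝ) / N) := by rw [← Finset.mul_sum, sum_frob_div]
    _ ≤ 2 * ρ * M := by gcongr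
    _ ≤ 1 := by linarith

lemma differentiableOn_scaledFrob (hM : (μ.card : ℝ) / N ≤ M) (hρ : M * ρ ≤ 1 / 2) {v : ℂ}
    (hv : ‖v‖ ≤ ρ) : DifferentiableAt ℂ (scaledFrob μ N) v := by
  unfold scaledFrob
  refine DifferentiableAt.fun_finsetProd fun t _ => ?_
  have h := frob_div_le' hM t
  have hp := frobP_nonneg μ t
  have h2 := one_add_ne_zero_of_norm_le_half (z := -(((frobP μ t / N : ℝ) : ℂ) * v))
    (by rw [norm_neg]; exact norm_ofReal_mul_le_half (by positivity) h.1 hρ hv)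
  rw [← sub_eq_add_neg] at h2
  exact DifferentiableAt.div (by fun_prop) (by fun_prop) h2

lemma frobProd_eq_scaledFrob (μ : YoungDiagram) {N : ℕ} (hN : N ≠ 0) {v : ℂ} (hv : v ≠ 0) :
    frobProd μ (N / v) = scaledFrob μ N v := by
  rw [frobProd, scaledFrob]
  refine Finset.prod_congr rfl fun t _ => ?_
  have hN' : (N : ℂ) ≠ 0 := by exact_mod_cast hN
  have h1 : (N : ℂ) / v + frobQ μ t = (N / v) * (1 + ((frobQ μ t / N : ℝ) : ℂ) * v) := by
    push_cast; field_simp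
  have h2 : (N : ℂ) / v - frobP μ t = (N / v) * (1 - ((frobP μ t / N : ℝ) : ℂ) * v) := by
    push_cast; field_simp
  rw [h1, h2, mul_div_mul_left _ _ (div_ne_zero hN' hv)]

end

section
variable {μ : ℕ → YoungDiagram} {a b : ℕ → ℝ} {δ M ρ : ℝ} {v : ℂ}

lemma hasProd_factor (ha : ∀ i, 0 ≤ a i) (hb : ∀ i, 0 ≤ b i) (haM : ∀ i, a i ≤ M)
    (hbM : ∀ i, b i ≤ M) (hs : Summable fun i => a i + b i) (hρ : M * ρ ≤ 1 / 2) (hv : ‖v‖ ≤ ρ) :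
    HasProd (fun i => (1 + (b i : ℂ) * v) / (1 - (a i : ℂ) * v))
      (Complex.exp (∑' i, logFactor (a i) (b i) v)) := by
  have h : Summable fun i => logFactor (a i) (b i) v :=
    Summable.of_norm_bounded (hs.mul_left (2 * ρ))
      fun i => norm_logFactor_le (ha i) (hb i) (haM i) (hbM i) hρ hv
  have := h.hasSum.cexp
  refine this.congr_fun ?_
  intro i
  exact (exp_logFactor (ha i) (hb i) (haM i) (hbM i) hρ hv).symm

lemma tendsto_scaledFrob
    (hp : ∀ i, Tendsto (fun N : ℕ => frobP (μ N) i / N) atTop (𝓝 (a i)))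
    (hq : ∀ i, Tendsto (fun N : ℕ => frobQ (μ N) i / N) atTop (𝓝 (b i)))
    (hc : Tendsto (fun N : ℕ => ((μ N).card : ℝ) / N) atTop (𝓝 δ))
    (hs : Summable fun i => a i + b i) (hM : δ < M) (hρ : M * ρ ≤ 1 / 2) (hv : ‖v‖ ≤ ρ) :
    Tendsto (fun N => scaledFrob (μ N) N v) atTop
      (𝓝 (Complex.exp (((δ - ∑' i, (a i + b i) : ℝ) : ℂ) * v) *
        ∏' i, ((1 + (b i : ℂ) * v) / (1 - (a i : ℂ) * v)))) := by
  have hev : ∀ᶠ N : ℕ in atTop, ((μ N).card : ℝ) / N ≤ M :=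
    (hc.eventually (gt_mem_nhds hM)).mono fun N h => le_of_lt h
  have ha : ∀ i, 0 ≤ a i := fun i => ge_of_tendsto' (hp i) fun N =>
    div_nonneg (frobP_nonneg _ _) (Nat.cast_nonneg _)
  have hb : ∀ i, 0 ≤ b i := fun i => ge_of_tendsto' (hq i) fun N =>
    div_nonneg (frobQ_nonneg _ _) (Nat.cast_nonneg _)
  have haM : ∀ i, a i ≤ M := fun i => le_of_tendsto (hp i) (hev.mono fun N h => (frob_div_le' h i).1)
  have hbM : ∀ i, b i ≤ M := fun i => le_of_tendsto (hq i) (hev.mono fun N h => (frob_div_le' h i).2)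
  have hlim : Tendsto (fun N : ℕ => ((((μ N).card : ℝ) / N : ℝ) : ℂ) * v +
      ∑' i, (logFactor (frobP (μ N) i / N) (frobQ (μ N) i / N) v -
        ((frobP (μ N) i / N + frobQ (μ N) i / N : ℝ) : ℂ) * v)) atTop
      (𝓝 ((δ : ℂ) * v + ∑' i, (logFactor (a i) (b i) v - ((a i + b i : ℝ) : ℂ) * v))) := by
    refine (((Complex.continuous_ofReal.tendsto δ).comp hc).mul_const v).add ?_
    have hsum : Summable fun i : ℕ => ρ ^ 2 * (2 * M ^ 2) * (1 / ((i : ℝ) + 1) ^ 2) := by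
      refine Summable.mul_left _ ?_
      have := (summable_nat_add_iff 1).mpr (Real.summable_one_div_nat_pow.mpr one_lt_two)
      simpa using this
    refine tendsto_tsum_of_dominated_convergence hsum (fun i => ?_) ?_
    · refine (tendsto_logFactor (hp i) (hq i) (ha i) (hb i) (haM i) (hbM i) hρ hv).sub ?_
      exact ((Complex.continuous_ofReal.tendsto _).comp ((hp i).add (hq i))).mul_const v
    · filter_upwards [hev] with N hN i
      have h := frob_div_le hN i
      have h' := frob_div_le' hN i
      have hp0 : 0 ≤ frobP (μ N) i / N := div_nonneg (frobP_nonneg _ _) (Nat.cast_nonneg _)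
      have hq0 : 0 ≤ frobQ (μ N) i / N := div_nonneg (frobQ_nonneg _ _) (Nat.cast_nonneg _)
      refine (norm_logFactor_sub_le hp0 hq0 h'.1 h'.2 hρ hv).trans ?_
      have h3 := pow_le_pow_left₀ hp0 h.1 2
      have h4 := pow_le_pow_left₀ hq0 h.2 2
      calc _ ≤ ρ ^ 2 * ((M / (i + 1)) ^ 2 + (M / (i + 1)) ^ 2) := by gcongr
        _ = _ := by rw [div_pow]; ring
  have hexp := (Complex.continuous_exp.tendsto _).comp hlim
  have hs1 : Summable fun i => logFactor (a i) (b i) v :=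
    Summable.of_norm_bounded (hs.mul_left (2 * ρ))
      fun i => norm_logFactor_le (ha i) (hb i) (haM i) (hbM i) hρ hv
  have hs2 : Summable fun i => ((a i + b i : ℝ) : ℂ) * v :=
    (Complex.ofRealCLM.summable hs).mul_right v
  have hval : Complex.exp ((δ : ℂ) * v + ∑' i, (logFactor (a i) (b i) v - ((a i + b i : ℝ) : ℂ) * v)) =
      Complex.exp (((δ - ∑' i, (a i + b i) : ℝ) : ℂ) * v) *
        ∏' i, ((1 + (b i : ℂ) * v) / (1 - (a i : ℂ) * v)) := by
    rw [(hasProd_factor ha hb haM hbM hs hρ hv).tprod_eq, ← Complex.exp_add, hs1.tsum_sub hs2,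
      tsum_mul_right, ← Complex.ofReal_tsum]
    congr 1
    push_cast
    ring
  rw [← hval]
  refine hexp.congr' ?_
  filter_upwards [hev] with N hN
  rw [Function.comp_apply, scaledFrob_eq_exp hN hρ hv]
  congr 1
  rw [tsum_eq_sum (s := Finset.range ((μ N).rowLen 0)), Finset.sum_sub_distrib, ← Finset.sum_mul,
    ← Complex.ofReal_sum, sum_frob_div]
  · ring
  · intro i hi
    have h := frob_eq_zero (diag_rowLen_notMem (μ N)) (not_lt.mp fun h => hi (Finset.mem_range.mpr h))
    simp [h.1, h.2, logFactor]

end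

/-! ### The Voiculescu–Edrei function on an annulus -/

/-- The annulus `1 - ε < |x| < 1 + ε`. -/
def annulus (ε : ℝ) : Set ℂ := {x | 1 - ε < ‖x‖ ∧ ‖x‖ < 1 + ε}

lemma isOpen_annulus (ε : ℝ) : IsOpen (annulus ε) :=
  (isOpen_lt continuous_const continuous_norm).inter (isOpen_lt continuous_norm continuous_const)

lemma annulus_mono {ε ε' : ℝ} (h : ε ≤ ε') : annulus ε ⊆ annulus ε' := fun x hx =>
  ⟨by have := hx.1; linarith, by have := hx.2; linarith⟩

lemma ne_zero_of_mem_annulus {ε : ℝ} (hε : ε ≤ 1) {x : ℂ} (hx : x ∈ annulus ε) : x ≠ 0 := by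
  rintro rfl
  have := hx.1
  rw [norm_zero] at this
  linarith

lemma one_sub_mul_ne_zero {ε a : ℝ} (ha : 0 ≤ a) (hε : ε * (1 + a) ≤ 1) (hε0 : 0 < ε)
    {x : ℂ} (hx : x ∈ annulus ε) : 1 - (a : ℂ) * (x - 1) ≠ 0 := by
  intro h
  have h1 : (a : ℂ) * x = ((1 + a : ℝ) : ℂ) := by push_cast; linear_combination -h
  have h2 := congrArg norm h1
  rw [norm_mul, Complex.norm_real, Complex.norm_real, Real.norm_of_nonneg ha,
    Real.norm_of_nonneg (by linarith)] at h2
  have h3 := mul_le_mul_of_nonneg_left hx.2.le ha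
  linarith

lemma one_sub_mul_inv_ne_zero {ε a : ℝ} (ha : 0 ≤ a) (hε : ε * (1 + a) ≤ 1)
    {x : ℂ} (hx : x ∈ annulus ε) (hx0 : x ≠ 0) : 1 - (a : ℂ) * (x⁻¹ - 1) ≠ 0 := by
  intro h
  have h1 : (a : ℂ) = ((1 + a : ℝ) : ℂ) * x := by
    push_cast
    field_simp at h
    linear_combination -h
  have h2 := congrArg norm h1
  rw [norm_mul, Complex.norm_real, Complex.norm_real, Real.norm_of_nonneg ha,
    Real.norm_of_nonneg (by linarith)] at h2
  have h3 := mul_lt_mul_of_pos_left hx.1 (show 0 < 1 + a by linarith)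
  linarith

section
variable {a b : ℕ → ℝ} {U : Set ℂ} {R : ℝ}

lemma factor_eq_one_add {a b : ℝ} {v : ℂ} (h : 1 - (a : ℂ) * v ≠ 0) :
    (1 + (b : ℂ) * v) / (1 - (a : ℂ) * v) =
      1 + ((a + b : ℝ) : ℂ) * v / (1 - (a : ℂ) * v) := by
  rw [div_eq_iff h, add_mul, div_mul_cancel₀ _ h]
  push_cast
  ring

lemma eventually_norm_factor_le (ha : ∀ i, 0 ≤ a i) (hb : ∀ i, 0 ≤ b i)
    (hs : Summable fun i => a i + b i) (hU : ∀ v ∈ U, ‖v‖ ≤ R) :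
    ∀ᶠ i in atTop, ∀ v ∈ U, ‖((a i + b i : ℝ) : ℂ) * v / (1 - (a i : ℂ) * v)‖ ≤
      2 * R * (a i + b i) := by
  have h1 : Tendsto (fun i => (a i + b i) * R) atTop (𝓝 0) := by
    simpa using hs.tendsto_atTop_zero.mul_const R
  filter_upwards [h1.eventually (gt_mem_nhds (show (0 : ℝ) < 1 / 2 by norm_num))] with i hi v hv
  have hvR := hU v hv
  have hR : 0 ≤ R := (norm_nonneg v).trans hvR
  have h2 : ‖(a i : ℂ) * v‖ ≤ 1 / 2 := by
    refine norm_ofReal_mul_le_half (ha i) (M := a i + b i) (ρ := R) ?_ hi.le hvR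
    linarith [hb i]
  have h3 : 1 / 2 ≤ ‖1 - (a i : ℂ) * v‖ := by
    have := norm_sub_norm_le (1 : ℂ) ((a i : ℂ) * v)
    rw [norm_one] at this
    linarith
  have hab : 0 ≤ a i + b i := add_nonneg (ha i) (hb i)
  rw [norm_div, norm_mul, Complex.norm_real, Real.norm_of_nonneg hab, div_le_iff₀ (by linarith)]
  calc (a i + b i) * ‖v‖ ≤ (a i + b i) * R := by gcongr
    _ = 2 * R * (a i + b i) * (1 / 2) := by ring
    _ ≤ _ := by gcongr

lemma multipliable_factor (ha : ∀ i, 0 ≤ a i) (hb : ∀ i, 0 ≤ b i)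
    (hs : Summable fun i => a i + b i) {v : ℂ} (hv : ∀ i, 1 - (a i : ℂ) * v ≠ 0) :
    Multipliable fun i => (1 + (b i : ℂ) * v) / (1 - (a i : ℂ) * v) := by
  simp_rw [fun i => factor_eq_one_add (b := b i) (hv i)]
  refine multipliable_one_add_of_summable ?_
  refine Summable.of_norm_bounded_eventually_nat (hs.mul_left (2 * ‖v‖)) ?_
  filter_upwards [eventually_norm_factor_le (U := {v}) (R := ‖v‖) ha hb hs (by simp)] with i hi
  rw [norm_norm]
  exact hi v rfl

lemma differentiableOn_tprod_factor (ha : ∀ i, 0 ≤ a i) (hb : ∀ i, 0 ≤ b i)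
    (hs : Summable fun i => a i + b i) (hUo : IsOpen U) (hU : ∀ v ∈ U, ‖v‖ ≤ R)
    (hU' : ∀ v ∈ U, ∀ i, 1 - (a i : ℂ) * v ≠ 0) :
    DifferentiableOn ℂ (fun v => ∏' i, ((1 + (b i : ℂ) * v) / (1 - (a i : ℂ) * v))) U := by
  have h1 : ∀ i, DifferentiableOn ℂ (fun v => ((a i + b i : ℝ) : ℂ) * v / (1 - (a i : ℂ) * v)) U :=
    fun i => DifferentiableOn.fun_div (by fun_prop) (by fun_prop) fun v hv => hU' v hv i
  have h := Summable.hasProdLocallyUniformlyOn_nat_one_add hUo (hs.mul_left (2 * R))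
    (eventually_norm_factor_le ha hb hs hU) (fun i => (h1 i).continuousOn)
  rw [hasProdLocallyUniformlyOn_iff_tendstoLocallyUniformlyOn] at h
  have h2 := h.differentiableOn (Eventually.of_forall fun s => by
    exact DifferentiableOn.fun_finsetProd fun i _ => (h1 i).const_add 1) hUo
  refine h2.congr fun v hv => ?_
  exact tprod_congr fun i => factor_eq_one_add (hU' v hv i)

end

/-- A radius on which `Φ_∞` has no poles. -/
structure Omega.GoodRadius (ω : Omega) (ε : ℝ) : Prop where
  pos : 0 < ε
  le_half : ε ≤ 1 / 2
  ap_le : ε * (1 + ω.ap 0) ≤ 1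
  am_le : ε * (1 + ω.am 0) ≤ 1

namespace Omega.GoodRadius
variable {ω : Omega} {ε : ℝ}

lemma ne_zero (h : ω.GoodRadius ε) {x : ℂ} (hx : x ∈ annulus ε) : x ≠ 0 :=
  ne_zero_of_mem_annulus (by linarith [h.le_half]) hx

lemma den_p (h : ω.GoodRadius ε) {x : ℂ} (hx : x ∈ annulus ε) (i : ℕ) :
    1 - (ω.ap i : ℂ) * (x - 1) ≠ 0 := by
  refine one_sub_mul_ne_zero (ω.ap_nonneg i) (le_trans ?_ h.ap_le) h.pos hx
  have := ω.ap_anti (Nat.zero_le i)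
  have := h.pos
  gcongr

lemma den_m (h : ω.GoodRadius ε) {x : ℂ} (hx : x ∈ annulus ε) (i : ℕ) :
    1 - (ω.am i : ℂ) * (x⁻¹ - 1) ≠ 0 := by
  refine one_sub_mul_inv_ne_zero (ω.am_nonneg i) (le_trans ?_ h.am_le) hx (h.ne_zero hx)
  have := ω.am_anti (Nat.zero_le i)
  have := h.pos
  gcongr

lemma multipliable (h : ω.GoodRadius ε) {x : ℂ} (hx : x ∈ annulus ε) :
    Multipliable fun i => ω.factor i x :=
  (multipliable_factor ω.ap_nonneg ω.bp_nonneg ω.summable_p (h.den_p hx)).mul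
    (multipliable_factor ω.am_nonneg ω.bm_nonneg ω.summable_m (h.den_m hx))

lemma Phi_eq (h : ω.GoodRadius ε) {x : ℂ} (hx : x ∈ annulus ε) :
    ω.Phi x = (Complex.exp (ω.gp * (x - 1)) *
        ∏' i, ((1 + (ω.bp i : ℂ) * (x - 1)) / (1 - (ω.ap i : ℂ) * (x - 1)))) *
      (Complex.exp (ω.gm * (x⁻¹ - 1)) *
        ∏' i, ((1 + (ω.bm i : ℂ) * (x⁻¹ - 1)) / (1 - (ω.am i : ℂ) * (x⁻¹ - 1)))) := by
  have h1 := (multipliable_factor ω.ap_nonneg ω.bp_nonneg ω.summable_p (h.den_p hx)).tprod_mul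
    (multipliable_factor ω.am_nonneg ω.bm_nonneg ω.summable_m (h.den_m hx))
  rw [Omega.Phi, Complex.exp_add]
  unfold Omega.factor
  rw [h1]
  ring

lemma differentiableOn_Phi (h : ω.GoodRadius ε) : DifferentiableOn ℂ ω.Phi (annulus ε) := by
  have e1 : DifferentiableOn ℂ (fun x : ℂ => x - 1) (annulus ε) := by fun_prop
  have e2 : DifferentiableOn ℂ (fun x : ℂ => x⁻¹ - 1) (annulus ε) :=
    (differentiableOn_id.fun_inv fun x hx => h.ne_zero hx).sub_const 1
  have hε := h.le_half
  have o1 : IsOpen ((fun v : ℂ => v + 1) ⁻¹' annulus ε) :=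
    (isOpen_annulus ε).preimage (by fun_prop)
  have g1 := differentiableOn_tprod_factor (R := 3) ω.ap_nonneg ω.bp_nonneg ω.summable_p o1
    (fun v hv => by
      have h3 := hv.2
      have h4 := norm_sub_le (v + 1) 1
      rw [add_sub_cancel_right, norm_one] at h4
      linarith) (fun v hv i => by simpa using h.den_p hv i)
  have o2 : IsOpen {v : ℂ | v + 1 ≠ 0 ∧ (v + 1)⁻¹ ∈ annulus ε} := by
    have := ContinuousOn.isOpen_inter_preimage (s := {v : ℂ | v + 1 ≠ 0})
      (f := fun v : ℂ => (v + 1)⁻¹)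
      (ContinuousOn.inv₀ (by fun_prop) fun v hv => hv) (isOpen_ne_fun (by fun_prop) (by fun_prop))
      (isOpen_annulus ε)
    exact this
  have g2 := differentiableOn_tprod_factor (R := 3) ω.am_nonneg ω.bm_nonneg ω.summable_m o2
    (fun v hv => by
      have h3 := hv.2.1
      rw [norm_inv] at h3
      have h4 := norm_sub_le (v + 1) 1
      rw [add_sub_cancel_right, norm_one] at h4
      have h5 : (0 : ℝ) < ‖v + 1‖ := norm_pos_iff.mpr hv.1
      have h6 : ‖v + 1‖ ≤ 2 := by
        have : (2 : ℝ)⁻¹ ≤ ‖v + 1‖⁻¹ := by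
          refine le_trans ?_ h3.le
          linarith
        exact (inv_le_inv₀ (by norm_num) h5).mp this
      linarith) (fun v hv i => by simpa using h.den_m hv.2 i)
  have k1 := g1.comp e1 (fun x hx => by simpa using hx)
  have k2 := g2.comp e2 (fun x hx => by
    have := h.ne_zero hx
    simpa [this] using hx)
  refine (((e1.const_mul (ω.gp : ℂ)).cexp.mul k1).mul ((e2.const_mul (ω.gm : ℂ)).cexp.mul k2)).congr
    fun x hx => ?_
  rw [h.Phi_eq hx]
  rfl

end Omega.GoodRadius

/-! ### Taylor coefficients at one -/

lemma tendsto_circleIntegral_of_dominated {F : ℕ → ℂ → ℂ} {f : ℂ → ℂ} {c : ℂ} {R C : ℝ}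
    (hR : 0 ≤ R) (hc : ∀ᶠ n in atTop, ContinuousOn (F n) (Metric.sphere c R))
    (hb : ∀ᶠ n in atTop, ∀ z ∈ Metric.sphere c R, ‖F n z‖ ≤ C)
    (hl : ∀ z ∈ Metric.sphere c R, Tendsto (fun n => F n z) atTop (𝓝 (f z))) :
    Tendsto (fun n => ∮ z in C(c, R), F n z) atTop (𝓝 (∮ z in C(c, R), f z)) := by
  have hmem : ∀ θ, circleMap c R θ ∈ Metric.sphere c R := fun θ => circleMap_mem_sphere c hR θ
  refine intervalIntegral.tendsto_integral_filter_of_dominated_convergence (fun _ => R * C) ?_ ?_ ?_ ?_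
  · filter_upwards [hc] with n hn
    refine Continuous.aestronglyMeasurable ?_
    simp only [deriv_circleMap, smul_eq_mul]
    have h1 : Continuous fun θ : ℝ => F n (circleMap c R θ) :=
      hn.comp_continuous (continuous_circleMap c R) hmem
    exact ((continuous_circleMap 0 R).mul continuous_const).mul h1
  · filter_upwards [hb] with n hn
    refine Eventually.of_forall fun θ _ => ?_
    simp only [deriv_circleMap, norm_smul, norm_mul, norm_circleMap_zero, abs_of_nonneg hR,
      Complex.norm_I, mul_one]
    exact mul_le_mul_of_nonneg_left (hn _ (hmem θ)) hR
  · exact intervalIntegrable_const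
  · exact Eventually.of_forall fun θ _ => (hl _ (hmem θ)).const_smul _

lemma tendsto_iteratedDeriv_of_tendsto_sphere {F : ℕ → ℂ → ℂ} {f : ℂ → ℂ} {c : ℂ} {R C : ℝ}
    (hR : 0 < R) (hF : ∀ᶠ n in atTop, DiffContOnCl ℂ (F n) (Metric.ball c R))
    (hf : DiffContOnCl ℂ f (Metric.ball c R))
    (hb : ∀ᶠ n in atTop, ∀ z ∈ Metric.sphere c R, ‖F n z‖ ≤ C)
    (hl : ∀ z ∈ Metric.sphere c R, Tendsto (fun n => F n z) atTop (𝓝 (f z))) (m : ℕ) :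
    Tendsto (fun n => iteratedDeriv m (F n) c) atTop (𝓝 (iteratedDeriv m f c)) := by
  have hne : (2 * Real.pi * Complex.I / m.factorial : ℂ) ≠ 0 := by
    have := Nat.factorial_ne_zero m
    simp [this, Real.pi_ne_zero]
  have key : ∀ g : ℂ → ℂ, DiffContOnCl ℂ g (Metric.ball c R) → iteratedDeriv m g c =
      (2 * Real.pi * Complex.I / m.factorial : ℂ)⁻¹ *
        ∮ z in C(c, R), (1 / (z - c) ^ (m + 1)) • g z := by
    intro g hg
    rw [hg.circleIntegral_one_div_sub_center_pow_smul hR m, smul_eq_mul, inv_mul_cancel_left₀ hne]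
  rw [key f hf]
  refine Tendsto.congr' (hF.mono fun n hn => (key _ hn).symm) (Tendsto.const_mul _ ?_)
  have hpow : ∀ z ∈ Metric.sphere c R, ‖1 / (z - c) ^ (m + 1)‖ = 1 / R ^ (m + 1) := by
    intro z hz
    rw [norm_div, norm_one, norm_pow, mem_sphere_iff_norm.mp hz]
  refine tendsto_circleIntegral_of_dominated (C := 1 / R ^ (m + 1) * C) hR.le ?_ ?_ ?_
  · filter_upwards [hF] with n hn
    have hcont : ContinuousOn (fun z : ℂ => 1 / (z - c) ^ (m + 1)) (Metric.sphere c R) := by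
      refine ContinuousOn.div continuousOn_const (by fun_prop) fun z hz => ?_
      have := mem_sphere_iff_norm.mp hz
      refine pow_ne_zero _ (norm_ne_zero_iff.mp ?_)
      rw [this]
      exact hR.ne'
    exact hcont.smul (hn.continuousOn_ball.mono Metric.sphere_subset_closedBall)
  · filter_upwards [hb] with n hn z hz
    rw [norm_smul, hpow z hz]
    exact mul_le_mul_of_nonneg_left (hn z hz) (by positivity)
  · exact fun z hz => (hl z hz).const_smul _

lemma circleIntegral_inversion (g : ℂ → ℂ) (c a : ℂ) (K : ℝ) {ρ : ℝ} (hρ : ρ ≠ 0) :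
    (∮ z in C(c, K / ρ), g z) =
      ∮ x in C(a, ρ), (K : ℂ) * ((x - a) ^ 2)⁻¹ * g (c + K / (x - a)) := by
  have hρ' : (ρ : ℂ) ≠ 0 := by exact_mod_cast hρ
  unfold circleIntegral
  have h := intervalIntegral.integral_comp_sub_left (a := 0) (b := 2 * Real.pi)
    (fun θ => deriv (circleMap a ρ) θ • ((K : ℂ) * ((circleMap a ρ θ - a) ^ 2)⁻¹ *
      g (c + K / (circleMap a ρ θ - a)))) (2 * Real.pi)
  rw [sub_self, sub_zero] at h
  rw [← h]
  refine intervalIntegral.integral_congr fun θ _ => ?_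
  have he : Complex.exp (((2 * Real.pi - θ : ℝ) : ℂ) * Complex.I) =
      (Complex.exp (θ * Complex.I))⁻¹ := by
    have : ((2 * Real.pi - θ : ℝ) : ℂ) * Complex.I =
        2 * Real.pi * Complex.I - θ * Complex.I := by push_cast; ring
    rw [this, Complex.exp_sub, Complex.exp_two_pi_mul_I, one_div]
  have hE : Complex.exp (θ * Complex.I) ≠ 0 := Complex.exp_ne_zero _
  simp only [deriv_circleMap, circleMap, add_sub_cancel_left, zero_add, smul_eq_mul, he]
  have e1 : c + ((K / ρ : ℝ) : ℂ) * Complex.exp (θ * Complex.I) =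
      c + K / (ρ * (Complex.exp (θ * Complex.I))⁻¹) := by
    push_cast; field_simp
  rw [e1]
  push_cast
  field_simp

lemma circleIntegral_div_prod {N : ℕ} (hN : 0 < N) {v : Fin N → ℂ} (hv : Function.Injective v)
    {P : ℂ → ℂ} (hP : Differentiable ℂ P) {c : ℂ} {R : ℝ} (hR : ∀ j, v j ∈ Metric.ball c R) :
    (∮ z in C(c, R), P z / ∏ j, (z - v j)) =
      2 * Real.pi * Complex.I * ∑ j, P (v j) * Lagrange.nodalWeight Finset.univ v j := by
  have : Nonempty (Fin N) := ⟨⟨0, hN⟩⟩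
  have hR0 : 0 < R := (dist_nonneg).trans_lt (Metric.mem_ball.mp (hR ⟨0, hN⟩))
  have hne : ∀ z ∈ Metric.sphere c R, ∀ j, z ≠ v j := by
    rintro z hz j rfl
    exact (Metric.mem_ball.mp (hR j)).ne (Metric.mem_sphere.mp hz)
  have hpf : ∀ z ∈ Metric.sphere c R, P z / ∏ j, (z - v j) =
      ∑ j, Lagrange.nodalWeight Finset.univ v j * ((z - v j)⁻¹ * P z) := by
    intro z hz
    have h := Lagrange.eval_interpolate_not_at_node (s := Finset.univ) (v := v) 1
      (x := z) fun j _ => hne z hz j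
    rw [Lagrange.interpolate_one hv.injOn Finset.univ_nonempty, Polynomial.eval_one,
      Lagrange.eval_nodal] at h
    simp only [Pi.one_apply, mul_one] at h
    have h0 : ∏ j, (z - v j) ≠ 0 := Finset.prod_ne_zero_iff.mpr fun j _ =>
      sub_ne_zero.mpr (hne z hz j)
    rw [div_eq_iff h0]
    simp only [← mul_assoc]
    rw [← Finset.sum_mul]
    linear_combination P z * h
  rw [circleIntegral.integral_congr hR0.le hpf, circleIntegral.integral_fun_sum, Finset.mul_sum]
  · refine Finset.sum_congr rfl fun j _ => ?_
    rw [circleIntegral.integral_const_mul]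
    have := hP.differentiableOn.circleIntegral_sub_inv_smul (hR j)
    simp only [smul_eq_mul] at this
    rw [this]
    ring
  · intro j _
    refine ContinuousOn.circleIntegrable hR0.le ?_
    refine continuousOn_const.mul (ContinuousOn.mul (ContinuousOn.inv₀ (by fun_prop) fun z hz =>
      sub_ne_zero.mpr (hne z hz j)) hP.continuous.continuousOn)

lemma rowLen_le_frobP (μ : YoungDiagram) (i : ℕ) : (μ.rowLen i : ℝ) ≤ frobP μ 0 + 1 / 2 := by
  have h1 : (μ.rowLen i : ℝ) ≤ μ.rowLen 0 := by exact_mod_cast μ.rowLen_anti 0 i (Nat.zero_le _)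
  by_cases h00 : (0, 0) ∈ μ
  · rw [frobP, if_pos h00]
    push_cast
    linarith
  · have : μ.rowLen 0 = 0 := by
      by_contra hc
      exact h00 (YoungDiagram.mem_iff_lt_rowLen.mpr (Nat.pos_of_ne_zero hc))
    rw [this] at h1
    have := frobP_nonneg μ 0
    push_cast at h1
    linarith

lemma Signature.abs_le_frobP {N : ℕ} (lam : Signature N) {R : ℝ}
    (hp : frobP lam.posDiagram 0 ≤ R) (hp' : frobP lam.negDiagram 0 ≤ R) (i : Fin N) :
    |(lam.1 i : ℝ)| ≤ R + 1 / 2 := by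
  have h1 := rowLen_le_frobP lam.posDiagram i
  have h2 := rowLen_le_frobP lam.negDiagram (Fin.rev i)
  rw [lam.rowLen_posDiagram] at h1
  rw [negDiagram, lam.dual.rowLen_posDiagram] at h2
  have e : lam.dual.1 i.rev = -lam.1 i := by simp [dual]
  rw [e] at h2
  have h3 : (lam.1 i : ℝ) ≤ ((lam.1 i).toNat : ℝ) := by exact_mod_cast Int.self_le_toNat _
  have h4 : -(lam.1 i : ℝ) ≤ ((-lam.1 i).toNat : ℝ) := by exact_mod_cast Int.self_le_toNat _
  rw [negDiagram] at hp'
  exact abs_le.mpr ⟨by linarith, by linarith⟩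

/-- The Frobenius generating function of a signature, as a function of `x`. -/
noncomputable def Signature.genFun {N : ℕ} (lam : Signature N) (x : ℂ) : ℂ :=
  scaledFrob lam.posDiagram N (x - 1) * scaledFrob lam.negDiagram N (x⁻¹ - 1)

/-- The ratio between the Taylor coefficients of `genFun` and of the normalized Schur function. -/
noncomputable def corrFactor (N m : ℕ) (x : ℂ) : ℂ :=
  ∏ j ∈ Finset.range m, ((N - (1 / 2 + j) * (x - 1)) / (N + j + 1))

lemma norm_corrFactor_le (N m : ℕ) {x : ℂ} (hx : ‖x - 1‖ ≤ 1) : ‖corrFactor N m x‖ ≤ 1 := by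
  rw [corrFactor, norm_prod]
  refine Finset.prod_le_one (fun _ _ => norm_nonneg _) fun j _ => ?_
  have e : ((N : ℂ) + j + 1) = ((N + j + 1 : ℝ) : ℂ) := by push_cast; rfl
  have hpos : (0 : ℝ) < N + j + 1 := by positivity
  rw [norm_div, e, Complex.norm_real, Real.norm_of_nonneg hpos.le, div_le_one hpos]
  have e2 : ((1 : ℂ) / 2 + j) = ((1 / 2 + j : ℝ) : ℂ) := by push_cast; rfl
  have h1 := norm_sub_le (N : ℂ) ((1 / 2 + j) * (x - 1))
  have hpos2 : (0 : ℝ) ≤ 1 / 2 + j := by positivity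
  rw [norm_mul, e2, Complex.norm_real, Real.norm_of_nonneg hpos2, Complex.norm_natCast] at h1
  have h2 := mul_le_of_le_one_right hpos2 hx
  rw [e2]
  linarith

lemma tendsto_corrFactor (m : ℕ) (x : ℂ) :
    Tendsto (fun n => corrFactor (n + 1) m x) atTop (𝓝 1) := by
  have : (1 : ℂ) = ∏ j ∈ Finset.range m, 1 := by simp
  rw [this]
  refine tendsto_finsetProd _ fun j _ => ?_
  have hinv : Tendsto (fun n : ℕ => (1 : ℂ) / ((n : ℂ) + 1)) atTop (𝓝 0) :=
    tendsto_one_div_add_atTop_nhds_zero_nat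
  have hlim : Tendsto (fun n : ℕ => (1 - (1 / 2 + (j : ℂ)) * (x - 1) * (1 / ((n : ℂ) + 1))) /
      (1 + ((j : ℂ) + 1) * (1 / ((n : ℂ) + 1)))) atTop
      (𝓝 ((1 - (1 / 2 + (j : ℂ)) * (x - 1) * 0) / (1 + ((j : ℂ) + 1) * 0))) :=
    ((hinv.const_mul _).const_sub 1).div ((hinv.const_mul _).const_add 1) (by simp)
  simp only [mul_zero, sub_zero, add_zero, div_one] at hlim
  refine hlim.congr fun n => ?_
  have h1 : ((n : ℂ) + 1) ≠ 0 := by exact_mod_cast n.succ_ne_zero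
  push_cast
  rw [← mul_div_mul_right _ _ h1]
  congr 1 <;> field_simp
  ring

section
variable {M : ℝ} {x : ℂ}

lemma inv_sub_one_bound (hM : 1 ≤ M) (hx : ‖x - 1‖ ≤ 1 / (4 * M)) :
    x ≠ 0 ∧ ‖x - 1‖ ≤ 1 / (2 * M) ∧ ‖x⁻¹ - 1‖ ≤ 1 / (2 * M) := by
  have h4 : 1 / (4 * M) ≤ 1 / 4 := by
    rw [div_le_div_iff₀ (by positivity) (by norm_num)]; linarith
  have h42 : 1 / (2 * M) = 2 * (1 / (4 * M)) := by field_simp; norm_num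
  have hpos : 0 < 1 / (4 * M) := by positivity
  have h1 : 3 / 4 ≤ ‖x‖ := by
    have := norm_sub_norm_le (1 : ℂ) (1 - x)
    rw [sub_sub_cancel, norm_one, norm_sub_rev] at this
    linarith
  have hx0 : x ≠ 0 := norm_pos_iff.mp (by linarith)
  refine ⟨hx0, by linarith, ?_⟩
  have e : x⁻¹ - 1 = (1 - x) / x := by field_simp
  rw [e, norm_div, div_le_iff₀ (by linarith), norm_sub_rev, h42]
  nlinarith

variable {N : ℕ} {lam : Signature N}

lemma Signature.norm_genFun_le (hM : 1 ≤ M) (hp : (lam.posDiagram.card : ℝ) / N ≤ M)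
    (hn : (lam.negDiagram.card : ℝ) / N ≤ M) (hx : ‖x - 1‖ ≤ 1 / (4 * M)) :
    ‖lam.genFun x‖ ≤ Real.exp 1 * Real.exp 1 := by
  obtain ⟨-, h1, h2⟩ := inv_sub_one_bound hM hx
  have hρ : M * (1 / (2 * M)) ≤ 1 / 2 := by
    have : M ≠ 0 := by positivity
    exact le_of_eq (by field_simp)
  rw [genFun, norm_mul]
  exact mul_le_mul (norm_scaledFrob_le hp hρ h1) (norm_scaledFrob_le hn hρ h2) (norm_nonneg _)
    (Real.exp_pos _).le

lemma Signature.differentiableOn_genFun (hM : 1 ≤ M) (hp : (lam.posDiagram.card : ℝ) / N ≤ M)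
    (hn : (lam.negDiagram.card : ℝ) / N ≤ M) :
    DifferentiableOn ℂ lam.genFun (Metric.closedBall 1 (1 / (4 * M))) := by
  intro x hx
  rw [Metric.mem_closedBall, dist_eq_norm] at hx
  obtain ⟨hx0, h1, h2⟩ := inv_sub_one_bound hM hx
  have hρ : M * (1 / (2 * M)) ≤ 1 / 2 := by
    have : M ≠ 0 := by positivity
    exact le_of_eq (by field_simp)
  refine DifferentiableAt.differentiableWithinAt ?_
  refine DifferentiableAt.fun_mul ?_ ?_
  · exact DifferentiableAt.fun_comp' (f := fun x : ℂ => x - 1) x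
      (differentiableOn_scaledFrob hp hρ h1) (by fun_prop)
  · exact DifferentiableAt.fun_comp' (f := fun x : ℂ => x⁻¹ - 1) x
      (differentiableOn_scaledFrob hn hρ h2) ((differentiableAt_inv hx0).sub_const 1)

end

lemma differentiable_fallFact (m : ℕ) : Differentiable ℂ (fallFact m) := by
  unfold fallFact
  fun_prop

lemma differentiable_corrFactor (N m : ℕ) : Differentiable ℂ (corrFactor N m) := by
  unfold corrFactor
  fun_prop

lemma fallFact_add (N m : ℕ) (z : ℂ) :
    fallFact (N + m) z = fallFact N z * ∏ j ∈ Finset.range m, (z - N - j) := by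
  rw [fallFact, Finset.prod_range_add, fallFact]
  congr 1
  refine Finset.prod_congr rfl fun j _ => ?_
  push_cast
  ring

lemma factorial_eq_mul_prod (n m : ℕ) :
    ((n + (m + 1)).factorial : ℂ) = n.factorial * ((n + 1 : ℕ) *
      ∏ j ∈ Finset.range m, (((n + 1 : ℕ) : ℂ) + j + 1)) := by
  induction m with
  | zero => simp [Nat.factorial_succ]; ring
  | succ m ih =>
    rw [Finset.prod_range_succ, ← add_assoc n (m + 1) 1, Nat.factorial_succ, Nat.cast_mul, ih]
    push_cast
    ring

lemma sum_fallFact_mul_nodalWeight {N : ℕ} (hN : N ≠ 0) (lam : Signature N) {M : ℝ} (hM : 1 ≤ M)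
    (hp : (lam.posDiagram.card : ℝ) / N ≤ M)
    (hn : (lam.negDiagram.card : ℝ) / N ≤ M) (m : ℕ) :
    2 * Real.pi * Complex.I * ∑ j, fallFact (N + m) (lam.node j) *
        Lagrange.nodalWeight Finset.univ (fun j => (lam.node j : ℂ)) j =
      (N * ∏ j ∈ Finset.range m, ((N : ℂ) + j + 1)) *
      ∮ x in C(1, 1 / (4 * M)), (1 / (x - 1) ^ (m + 1 + 1)) •
        (corrFactor N m x * lam.genFun x) := by
  have hN1 : (1 : ℝ) ≤ N := by exact_mod_cast Nat.one_le_iff_ne_zero.mpr hN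
  have hNpos : (0 : ℝ) < N := by linarith
  have hM0 : 0 < M := by linarith
  set ρ := 1 / (4 * M) with hρ
  have hρ0 : 0 < ρ := by positivity
  have hNM : (N : ℝ) ≤ M * N := le_mul_of_one_le_left hNpos.le hM
  have hNρ : (N : ℝ) / ρ = 4 * (M * N) := by rw [hρ]; field_simp
  have hfrob : ∀ μ : YoungDiagram, (μ.card : ℝ) / N ≤ M → frobP μ 0 ≤ M * N ∧ frobQ μ 0 ≤ M * N := by
    intro μ hμ
    have := frob_div_le' hμ 0
    exact ⟨(div_le_iff₀ hNpos).mp this.1, (div_le_iff₀ hNpos).mp this.2⟩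
  obtain ⟨hp1, hq1⟩ := hfrob _ hp
  obtain ⟨hp2, hq2⟩ := hfrob _ hn
  have hinj : Function.Injective fun j => (lam.node j : ℂ) :=
    Int.cast_injective.comp lam.node_strictAnti.injective
  have hball : ∀ j, (lam.node j : ℂ) ∈ Metric.ball ((N : ℂ) - 1 / 2) (N / ρ) := by
    intro j
    have h1 := abs_le.mp (lam.abs_le_frobP hp1 hp2 j)
    have hj : ((j : ℕ) : ℝ) + 1 ≤ N := by exact_mod_cast j.2
    have hj0 : (0 : ℝ) ≤ (j : ℕ) := (j : ℕ).cast_nonneg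
    have e : (lam.node j : ℂ) - ((N : ℂ) - 1 / 2) =
        (((lam.1 j : ℝ) - (j : ℕ) - 1 / 2 : ℝ) : ℂ) := by
      rw [Signature.node]; push_cast; ring
    rw [Metric.mem_ball, dist_eq_norm, e, Complex.norm_real, Real.norm_eq_abs, hNρ, abs_lt]
    constructor <;> linarith [h1.1, h1.2]
  rw [← circleIntegral_div_prod (by omega) hinj (differentiable_fallFact _) hball]
  have hinv := circleIntegral_inversion
    (fun z => fallFact (N + m) z / ∏ j, (z - (lam.node j : ℂ))) ((N : ℂ) - 1 / 2) 1 N hρ0.ne'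
  rw [hinv, ← circleIntegral.integral_const_mul]
  refine circleIntegral.integral_congr hρ0.le fun x hx => ?_
  have hx1 : ‖x - 1‖ = ρ := mem_sphere_iff_norm.mp hx
  obtain ⟨hx0, -, -⟩ := inv_sub_one_bound hM hx1.le
  have hv0 : x - 1 ≠ 0 := norm_ne_zero_iff.mp (by rw [hx1]; exact hρ0.ne')
  have hNC : (N : ℂ) ≠ 0 := by exact_mod_cast hN
  have hprod : (∏ j ∈ Finset.range m, ((N : ℂ) + j + 1)) ≠ 0 :=
    Finset.prod_ne_zero_iff.mpr fun j _ => by exact_mod_cast (N + j).succ_ne_zero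
  have hv0' : x⁻¹ - 1 ≠ 0 := by
    intro h
    apply hv0
    field_simp at h
    linear_combination -h
  set z : ℂ := (N : ℂ) - 1 / 2 + ((N : ℝ) : ℂ) / (x - 1) with hz
  have z1 : z - N + 1 / 2 = N / (x - 1) := by rw [hz]; push_cast; ring
  have z2 : -(z + 1 / 2) = N / (x⁻¹ - 1) := by
    rw [hz]
    have e : x⁻¹ - 1 = -(x - 1) / x := by field_simp; ring
    rw [e]
    push_cast
    field_simp
    ring
  have hn1 : ‖(N : ℂ) / (x - 1)‖ = 4 * (M * N) := by
    rw [norm_div, hx1, Complex.norm_natCast, hNρ]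
  have hMN : 0 < M * N := by positivity
  have hgen : fallFact N z / ∏ j, (z - (lam.node j : ℂ)) = lam.genFun x := by
    rw [lam.fallFact_div_prod_node (R := M * N) hNM (by linarith) hp1 hq1 hp2 hq2, z1, z2,
      frobProd_eq_scaledFrob _ hN hv0, frobProd_eq_scaledFrob _ hN hv0', Signature.genFun]
    · rw [z1, hn1]; linarith
    · have e : -(z + 1 / 2) = -(N / (x - 1) + N) := by linear_combination -z1
      rw [e, norm_neg]
      have := norm_sub_le ((N : ℂ) / (x - 1) + N) N
      rw [add_sub_cancel_right, hn1, Complex.norm_natCast] at this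
      linarith
  have hpr : ∏ j ∈ Finset.range m, (z - N - j) =
      (∏ j ∈ Finset.range m, ((N : ℂ) + j + 1)) * corrFactor N m x / (x - 1) ^ m := by
    have hpw : (x - 1) ^ m = ∏ _j ∈ Finset.range m, (x - 1) := by simp
    rw [corrFactor, hpw, ← Finset.prod_mul_distrib, ← Finset.prod_div_distrib]
    refine Finset.prod_congr rfl fun j _ => ?_
    have : (N : ℂ) + j + 1 ≠ 0 := by exact_mod_cast (N + j).succ_ne_zero
    rw [mul_div_cancel₀ _ this]
    have e : z - N - j = N / (x - 1) - 1 / 2 - j := by linear_combination z1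
    rw [e]
    field_simp
    ring
  rw [fallFact_add, mul_comm (fallFact N z), mul_div_assoc, hgen, hpr, smul_eq_mul]
  push_cast
  field_simp
  ring

lemma IsSpline.iteratedDeriv_succ {n : ℕ} {lam : Signature (n + 1)} {B : ℤ →₀ ℝ}
    (h : IsSpline lam B) {M : ℝ} (hM : 1 ≤ M)
    (hp : (lam.posDiagram.card : ℝ) / (n + 1 : ℕ) ≤ M)
    (hn : (lam.negDiagram.card : ℝ) / (n + 1 : ℕ) ≤ M) (m : ℕ) :
    iteratedDeriv (m + 1) (laurentEval B) 1 =
      iteratedDeriv (m + 1) (fun x => corrFactor (n + 1) m x * lam.genFun x) 1 := by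
  have hM0 : 0 < M := by linarith
  have hρ0 : 0 < 1 / (4 * M) := by positivity
  have h1 := h.iteratedDeriv_one (m + 1)
  have hdiff : DifferentiableOn ℂ (fun x => corrFactor (n + 1) m x * lam.genFun x)
      (Metric.closedBall 1 (1 / (4 * M))) :=
    (differentiable_corrFactor _ _).differentiableOn.mul
      (Signature.differentiableOn_genFun hM hp hn)
  have h2 := (hdiff.mono Metric.closure_ball_subset_closedBall).diffContOnCl
    |>.circleIntegral_one_div_sub_center_pow_smul hρ0 (m + 1)
  have h3 := sum_fallFact_mul_nodalWeight n.succ_ne_zero lam hM hp hn m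
  rw [h2, smul_eq_mul] at h3
  have e : n + (m + 1) = n + 1 + m := by ring
  have hf1 : (n.factorial : ℂ) ≠ 0 := by exact_mod_cast n.factorial_ne_zero
  have hf2 : ((m + 1).factorial : ℂ) ≠ 0 := by exact_mod_cast (m + 1).factorial_ne_zero
  have hf3 : ((n + (m + 1)).factorial : ℂ) ≠ 0 := by
    exact_mod_cast (n + (m + 1)).factorial_ne_zero
  have hpi : (2 * Real.pi * Complex.I : ℂ) ≠ 0 := by simp [Real.pi_ne_zero]
  have h4 := factorial_eq_mul_prod n m
  apply mul_left_cancel₀ (mul_ne_zero hpi hf3)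
  rw [mul_assoc, h1]
  rw [e]
  rw [e] at h4
  calc 2 * Real.pi * Complex.I * (((m + 1).factorial : ℂ) * (n.factorial * ∑ j, fallFact (n + 1 + m)
        (lam.node j) * Lagrange.nodalWeight Finset.univ (fun j => (lam.node j : ℂ)) j))
      = (m + 1).factorial * n.factorial * (2 * Real.pi * Complex.I * ∑ j, fallFact (n + 1 + m)
        (lam.node j) * Lagrange.nodalWeight Finset.univ (fun j => (lam.node j : ℂ)) j) := by ring
    _ = _ := by
      rw [h3, h4]
      field_simp

/-! ### From Taylor coefficients to uniform convergence on an annulus -/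

section
variable {F : ℕ → ℂ → ℂ} {f : ℂ → ℂ} {a : ℂ} {r s t K : ℝ}

lemma norm_le_two_mul_of_taylor (hf : DifferentiableOn ℂ f (Metric.ball a r))
    (hb : ∀ m, ‖iteratedDeriv m f a‖ ≤ m.factorial * K / s ^ m) (hs : 0 < s) {x : ℂ}
    (hx : x ∈ Metric.ball a r) (hxs : ‖x - a‖ ≤ s / 2) : ‖f x‖ ≤ 2 * K := by
  have h1 := Complex.hasSum_taylorSeries_on_ball hf hx
  have h2 : HasSum (fun m : ℕ => K * (1 / 2 : ℝ) ^ m) (2 * K) := by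
    have := (hasSum_geometric_of_lt_one (r := (1 / 2 : ℝ)) (by norm_num) (by norm_num)).mul_left K
    have e : K * (1 - 1 / 2 : ℝ)⁻¹ = 2 * K := by
      rw [show (1 - 1 / 2 : ℝ)⁻¹ = 2 by norm_num, mul_comm]
    rwa [e] at this
  refine h1.norm_le_of_bounded h2 fun m => ?_
  have hm : (0 : ℝ) < m.factorial := by exact_mod_cast m.factorial_pos
  have hK : 0 ≤ K := by
    have := (norm_nonneg _).trans (hb 0)
    simpa using this
  rw [norm_smul, norm_smul, norm_inv, norm_pow, Complex.norm_natCast]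
  calc (m.factorial : ℝ)⁻¹ * (‖x - a‖ ^ m * ‖iteratedDeriv m f a‖)
      ≤ (m.factorial : ℝ)⁻¹ * ((s / 2) ^ m * (m.factorial * K / s ^ m)) := by
        gcongr
        exact hb m
    _ = K * (1 / 2) ^ m := by
        rw [div_pow, div_pow, one_pow]; field_simp

lemma tendstoUniformlyOn_of_taylor (hF : ∀ᶠ n in atTop, DifferentiableOn ℂ (F n) (Metric.ball a r))
    (hf : DifferentiableOn ℂ f (Metric.ball a r))
    (hb : ∀ᶠ n in atTop, ∀ m, ‖iteratedDeriv m (F n) a‖ ≤ m.factorial * K / s ^ m)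
    (hl : ∀ m, Tendsto (fun n => iteratedDeriv m (F n) a) atTop (𝓝 (iteratedDeriv m f a)))
    (ht : 0 ≤ t) (hts : t < s) (htr : t ≤ r) :
    TendstoUniformlyOn F f atTop (Metric.ball a t) := by
  have hs : 0 < s := ht.trans_lt hts
  have hbf : ∀ m, ‖iteratedDeriv m f a‖ ≤ m.factorial * K / s ^ m := fun m =>
    le_of_tendsto (hl m).norm (hb.mono fun n hn => hn m)
  have hlim : Tendsto (fun n => ∑' m : ℕ, (m.factorial : ℝ)⁻¹ * t ^ m *
      ‖iteratedDeriv m (F n) a - iteratedDeriv m f a‖) atTop (𝓝 (∑' m : ℕ, (0 : ℝ))) := by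
    have hsum : Summable fun m : ℕ => 2 * K * (t / s) ^ m :=
      (summable_geometric_of_lt_one (by positivity) ((div_lt_one hs).mpr hts)).mul_left _
    refine tendsto_tsum_of_dominated_convergence hsum (fun m => ?_) ?_
    · have := ((hl m).sub_const (iteratedDeriv m f a)).norm
      rw [sub_self, norm_zero] at this
      simpa using this.const_mul ((m.factorial : ℝ)⁻¹ * t ^ m)
    · filter_upwards [hb] with n hn m
      have hm : (0 : ℝ) < m.factorial := by exact_mod_cast m.factorial_pos
      rw [Real.norm_of_nonneg (by positivity)]
      calc (m.factorial : ℝ)⁻¹ * t ^ m * ‖iteratedDeriv m (F n) a - iteratedDeriv m f a‖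
          ≤ (m.factorial : ℝ)⁻¹ * t ^ m *
            (m.factorial * K / s ^ m + m.factorial * K / s ^ m) := by
            gcongr
            exact (norm_sub_le _ _).trans (add_le_add (hn m) (hbf m))
        _ = 2 * K * (t / s) ^ m := by rw [div_pow]; field_simp; ring
  rw [tsum_zero] at hlim
  rw [Metric.tendstoUniformlyOn_iff]
  intro ε hε
  filter_upwards [hF, hb, hlim.eventually (gt_mem_nhds hε)] with n hn hbn hlt x hx
  have hxr : x ∈ Metric.ball a r := Metric.ball_subset_ball htr hx
  have h1 := (Complex.hasSum_taylorSeries_on_ball hn hxr).sub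
    (Complex.hasSum_taylorSeries_on_ball hf hxr)
  rw [dist_comm, dist_eq_norm]
  refine lt_of_le_of_lt ?_ hlt
  have hsum : Summable fun m : ℕ => (m.factorial : ℝ)⁻¹ * t ^ m *
      ‖iteratedDeriv m (F n) a - iteratedDeriv m f a‖ := by
    refine Summable.of_nonneg_of_le (fun m => by positivity) (fun m => ?_)
      ((summable_geometric_of_lt_one (r := t / s) (by positivity)
        ((div_lt_one hs).mpr hts)).mul_left (2 * K))
    have hm : (0 : ℝ) < m.factorial := by exact_mod_cast m.factorial_pos
    calc (m.factorial : ℝ)⁻¹ * t ^ m * ‖iteratedDeriv m (F n) a - iteratedDeriv m f a‖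
        ≤ (m.factorial : ℝ)⁻¹ * t ^ m *
          (m.factorial * K / s ^ m + m.factorial * K / s ^ m) := by
          gcongr
          exact (norm_sub_le _ _).trans (add_le_add (hbn m) (hbf m))
      _ = 2 * K * (t / s) ^ m := by rw [div_pow]; field_simp; ring
  refine h1.norm_le_of_bounded hsum.hasSum fun m => ?_
  rw [← smul_sub, ← smul_sub, norm_smul, norm_smul, norm_inv, norm_pow, Complex.norm_natCast,
    ← mul_assoc]
  have : ‖x - a‖ ≤ t := (mem_ball_iff_norm.mp hx).le
  gcongr

lemma tendstoUniformlyOn_half_ball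
    (hF : ∀ᶠ n in atTop, DifferentiableOn ℂ (F n) (Metric.ball a r))
    (hf : DifferentiableOn ℂ f (Metric.ball a r))
    (hb : ∀ᶠ n in atTop, ∀ z ∈ Metric.ball a r, ‖F n z‖ ≤ K) (ht : 0 < t) (htr : t ≤ r)
    (hu : TendstoUniformlyOn F f atTop (Metric.ball a t)) :
    TendstoUniformlyOn F f atTop (Metric.ball a (r / 2)) := by
  have hr : 0 < r := ht.trans_le htr
  have hdc : ∀ {g : ℂ → ℂ} {u : ℝ}, u < r → DifferentiableOn ℂ g (Metric.ball a r) →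
      DiffContOnCl ℂ g (Metric.ball a u) := fun {g u} hu hg =>
    (hg.mono (Metric.closure_ball_subset_closedBall.trans
      (Metric.closedBall_subset_ball hu))).diffContOnCl
  refine tendstoUniformlyOn_of_taylor (K := K) (s := 3 * r / 4) hF hf ?_ ?_ (by linarith)
    (by linarith) (by linarith)
  · filter_upwards [hF, hb] with n hn hbn m
    exact Complex.norm_iteratedDeriv_le_of_forall_mem_sphere_norm_le m (by linarith)
      (hdc (by linarith) hn) fun z hz =>
        hbn z (Metric.closedBall_subset_ball (by linarith) (Metric.sphere_subset_closedBall hz))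
  · refine tendsto_iteratedDeriv_of_tendsto_sphere (R := t / 2) (C := K) (by linarith)
      (hF.mono fun n hn => hdc (by linarith) hn) (hdc (by linarith) hf) ?_ ?_
    · filter_upwards [hb] with n hbn z hz
      exact hbn z (Metric.closedBall_subset_ball (by linarith) (Metric.sphere_subset_closedBall hz))
    · exact fun z hz => hu.tendsto_at
        (Metric.closedBall_subset_ball (by linarith) (Metric.sphere_subset_closedBall hz))

end

lemma ball_subset_annulus {a : ℂ} (ha : ‖a‖ = 1) (r : ℝ) : Metric.ball a r ⊆ annulus r := by
  intro x hx
  have hx := mem_ball_iff_norm.mp hx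
  have h1 := norm_sub_norm_le x a
  have h2 := norm_sub_norm_le a x
  rw [norm_sub_rev] at h2
  exact ⟨by linarith, by linarith⟩

lemma norm_exp_sub_exp_le (θ φ : ℝ) :
    ‖Complex.exp (θ * Complex.I) - Complex.exp (φ * Complex.I)‖ ≤ |θ - φ| := by
  have e : Complex.exp (θ * Complex.I) - Complex.exp (φ * Complex.I) =
      Complex.exp (φ * Complex.I) * (Complex.exp (Complex.I * ((θ - φ : ℝ) : ℂ)) - 1) := by
    rw [mul_sub, ← Complex.exp_add]
    push_cast
    ring_nf
  rw [e, norm_mul, Complex.norm_exp_ofReal_mul_I, one_mul]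
  exact Real.norm_exp_I_mul_ofReal_sub_one_le

/-- Bounded analytic functions which converge near `1` converge on an annulus. -/
lemma tendstoUniformlyOn_annulus {F : ℕ → ℂ → ℂ} {f : ℂ → ℂ} {r t K : ℝ}
    (hF : ∀ᶠ n in atTop, DifferentiableOn ℂ (F n) (annulus r))
    (hf : DifferentiableOn ℂ f (annulus r))
    (hb : ∀ᶠ n in atTop, ∀ z ∈ annulus r, ‖F n z‖ ≤ K) (ht : 0 < t) (htr : t ≤ r)
    (hu : TendstoUniformlyOn F f atTop (Metric.ball 1 t)) :
    TendstoUniformlyOn F f atTop (annulus (r / 4)) := by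
  have hr : 0 < r := ht.trans_le htr
  set c : ℕ → ℂ := fun j => Complex.exp (((j * (r / 4) : ℝ) : ℂ) * Complex.I) with hc
  have hc1 : ∀ j, ‖c j‖ = 1 := fun j => Complex.norm_exp_ofReal_mul_I _
  have step : ∀ j u, 0 < u → u ≤ r → TendstoUniformlyOn F f atTop (Metric.ball (c j) u) →
      TendstoUniformlyOn F f atTop (Metric.ball (c j) (r / 2)) := by
    intro j u hu0 hur hcu
    have hsub := ball_subset_annulus (hc1 j) r
    exact tendstoUniformlyOn_half_ball (hF.mono fun n hn => hn.mono hsub) (hf.mono hsub)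
      (hb.mono fun n hn z hz => hn z (hsub hz)) hu0 hur hcu
  have hall : ∀ j, TendstoUniformlyOn F f atTop (Metric.ball (c j) (r / 2)) := by
    intro j
    induction j with
    | zero =>
      refine step 0 t ht htr ?_
      simpa [hc] using hu
    | succ j ih =>
      refine step (j + 1) (r / 4) (by linarith) (by linarith) (ih.mono ?_)
      refine Metric.ball_subset_ball' ?_
      rw [dist_eq_norm]
      have h := norm_exp_sub_exp_le (((j + 1 : ℕ) : ℝ) * (r / 4)) ((j : ℝ) * (r / 4))
      have e : ((j + 1 : ℕ) : ℝ) * (r / 4) - (j : ℝ) * (r / 4) = r / 4 := by push_cast; ring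
      rw [e, abs_of_pos (by linarith)] at h
      have : ‖c (j + 1) - c j‖ ≤ r / 4 := h
      linarith
  rw [Metric.tendstoUniformlyOn_iff]
  intro ε hε
  have hfin := (eventually_all_finset (Finset.range (⌊3 * Real.pi / (r / 4)⌋₊ + 1))).mpr
    fun j _ => Metric.tendstoUniformlyOn_iff.mp (hall j) ε hε
  filter_upwards [hfin] with n hn x hx
  have hpi := Real.pi_pos
  set θ : ℝ := x.arg + 2 * Real.pi with hθ
  have hθ0 : 0 ≤ θ := by have := Complex.neg_pi_lt_arg x; linarith
  have hθ3 : θ ≤ 3 * Real.pi := by have := Complex.arg_le_pi x; linarith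
  have hr4 : 0 < r / 4 := by linarith
  set j := ⌊θ / (r / 4)⌋₊ with hj
  refine hn j (Finset.mem_range.mpr (Nat.lt_succ_of_le (Nat.floor_mono ?_))) x ?_
  · gcongr
  · have hxe : x = ‖x‖ * Complex.exp (θ * Complex.I) := by
      have h1 := Complex.norm_mul_exp_arg_mul_I x
      have h2 : Complex.exp (θ * Complex.I) = Complex.exp (x.arg * Complex.I) := by
        rw [hθ]
        push_cast
        rw [add_mul, Complex.exp_add, Complex.exp_two_pi_mul_I, mul_one]
      rw [h2, h1]
    have hj1 : j * (r / 4) ≤ θ := (le_div_iff₀ hr4).mp (Nat.floor_le (by positivity))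
    have hj2 : θ ≤ (j + 1) * (r / 4) := ((div_lt_iff₀ hr4).mp (Nat.lt_floor_add_one _)).le
    have h3 := norm_exp_sub_exp_le θ (j * (r / 4))
    have h4 : |θ - j * (r / 4)| ≤ r / 4 := abs_le.mpr ⟨by linarith, by linarith⟩
    have h5 : ‖x - Complex.exp (θ * Complex.I)‖ < r / 4 := by
      have e : x - Complex.exp (θ * Complex.I) =
          ((‖x‖ - 1 : ℝ) : ℂ) * Complex.exp (θ * Complex.I) := by
        nth_rewrite 1 [hxe]
        push_cast
        ring
      rw [e, norm_mul, Complex.norm_exp_ofReal_mul_I, mul_one, Complex.norm_real,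
        Real.norm_eq_abs, abs_lt]
      exact ⟨by linarith [hx.1], by linarith [hx.2]⟩
    rw [mem_ball_iff_norm]
    have h6 := norm_sub_le_norm_sub_add_norm_sub x (Complex.exp (θ * Complex.I)) (c j)
    have h7 : ‖Complex.exp (θ * Complex.I) - c j‖ ≤ r / 4 := h3.trans h4
    linarith

/-! ### Convergence of the one-variable functions -/

lemma Omega.Phi_one (ω : Omega) : ω.Phi 1 = 1 := by
  simp [Phi, factor]

lemma Omega.exists_bound (ω : Omega) :
    ∃ M : ℝ, 1 ≤ M ∧ ω.dp < M ∧ ω.dm < M ∧ ω.GoodRadius (1 / (2 * M)) := by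
  have hp : ω.ap 0 ≤ ω.dp :=
    le_trans (le_add_of_nonneg_right (ω.bp_nonneg 0)) ((ω.summable_p.le_tsum 0 fun i _ =>
      add_nonneg (ω.ap_nonneg i) (ω.bp_nonneg i)).trans ω.tsum_p_le)
  have hm : ω.am 0 ≤ ω.dm :=
    le_trans (le_add_of_nonneg_right (ω.bm_nonneg 0)) ((ω.summable_m.le_tsum 0 fun i _ =>
      add_nonneg (ω.am_nonneg i) (ω.bm_nonneg i)).trans ω.tsum_m_le)
  have hp0 := ω.ap_nonneg 0
  have hm0 := ω.am_nonneg 0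
  refine ⟨ω.dp + ω.dm + 1, by linarith, by linarith, by linarith, ?_, ?_, ?_, ?_⟩
  · have : 0 < ω.dp + ω.dm + 1 := by linarith
    positivity
  · rw [div_le_div_iff₀ (by linarith) (by norm_num)]
    linarith
  · rw [div_mul_eq_mul_div, div_le_one (by linarith)]
    linarith
  · rw [div_mul_eq_mul_div, div_le_one (by linarith)]
    linarith

section
variable {ω : Omega} {lam : (N : ℕ) → Signature N} {M : ℝ}

lemma tendsto_genFun
    (hap : ∀ i, Tendsto (fun N : ℕ => frobP (lam N).posDiagram i / N) atTop (𝓝 (ω.ap i)))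
    (hbp : ∀ i, Tendsto (fun N : ℕ => frobQ (lam N).posDiagram i / N) atTop (𝓝 (ω.bp i)))
    (ham : ∀ i, Tendsto (fun N : ℕ => frobP (lam N).negDiagram i / N) atTop (𝓝 (ω.am i)))
    (hbm : ∀ i, Tendsto (fun N : ℕ => frobQ (lam N).negDiagram i / N) atTop (𝓝 (ω.bm i)))
    (hdp : Tendsto (fun N : ℕ => ((lam N).posDiagram.card : ℝ) / N) atTop (𝓝 ω.dp))
    (hdm : Tendsto (fun N : ℕ => ((lam N).negDiagram.card : ℝ) / N) atTop (𝓝 ω.dm))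
    (hM : 1 ≤ M) (hp : ω.dp < M) (hm : ω.dm < M) (hω : ω.GoodRadius (1 / (2 * M))) {x : ℂ}
    (hx : ‖x - 1‖ ≤ 1 / (4 * M)) :
    Tendsto (fun N => (lam N).genFun x) atTop (𝓝 (ω.Phi x)) := by
  obtain ⟨-, h1, h2⟩ := inv_sub_one_bound hM hx
  have hρ : M * (1 / (2 * M)) ≤ 1 / 2 := by
    have : M ≠ 0 := by positivity
    exact le_of_eq (by field_simp)
  have hlt : 1 / (4 * M) < 1 / (2 * M) := by
    rw [div_lt_div_iff₀ (by positivity) (by positivity)]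
    linarith
  rw [hω.Phi_eq (ball_subset_annulus norm_one _ (mem_ball_iff_norm.mpr (hx.trans_lt hlt)))]
  exact (tendsto_scaledFrob hap hbp hdp ω.summable_p hp hρ h1).mul
    (tendsto_scaledFrob ham hbm hdm ω.summable_m hm hρ h2)

lemma tendstoUniformlyOn_laurentEval
    (hap : ∀ i, Tendsto (fun N : ℕ => frobP (lam N).posDiagram i / N) atTop (𝓝 (ω.ap i)))
    (hbp : ∀ i, Tendsto (fun N : ℕ => frobQ (lam N).posDiagram i / N) atTop (𝓝 (ω.bp i)))
    (ham : ∀ i, Tendsto (fun N : ℕ => frobP (lam N).negDiagram i / N) atTop (𝓝 (ω.am i)))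
    (hbm : ∀ i, Tendsto (fun N : ℕ => frobQ (lam N).negDiagram i / N) atTop (𝓝 (ω.bm i)))
    (hdp : Tendsto (fun N : ℕ => ((lam N).posDiagram.card : ℝ) / N) atTop (𝓝 ω.dp))
    (hdm : Tendsto (fun N : ℕ => ((lam N).negDiagram.card : ℝ) / N) atTop (𝓝 ω.dm))
    (hM : 1 ≤ M) (hp : ω.dp < M) (hm : ω.dm < M) (hω : ω.GoodRadius (1 / (2 * M)))
    {B : ℕ → ℤ →₀ ℝ} (hB : ∀ n, IsSpline (lam (n + 1)) (B n)) :
    TendstoUniformlyOn (fun n => laurentEval (B n)) ω.Phi atTop (annulus (1 / (32 * M))) := by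
  have hM0 : 0 < M := by linarith
  set ρ := 1 / (4 * M) with hρ
  have hρ0 : 0 < ρ := by positivity
  have hρ2 : 1 / (2 * M) = 2 * ρ := by rw [hρ]; field_simp; norm_num
  have hρ32 : 1 / (32 * M) = ρ / 2 / 4 := by rw [hρ]; field_simp; norm_num
  have hρ4 : ρ ≤ 1 / 4 := by
    rw [hρ, div_le_div_iff₀ (by positivity) (by norm_num)]; linarith
  have hdiffS : ∀ n, DifferentiableOn ℂ (laurentEval (B n)) (annulus 1) := fun n x hx =>
    (differentiableAt_laurentEval _ (ne_zero_of_mem_annulus le_rfl hx)).differentiableWithinAt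
  have hdiffPhi : DifferentiableOn ℂ ω.Phi (annulus (2 * ρ)) := by
    rw [← hρ2]; exact hω.differentiableOn_Phi
  have hshift := tendsto_add_atTop_nat 1
  have hevp : ∀ᶠ n : ℕ in atTop, ((lam (n + 1)).posDiagram.card : ℝ) / (n + 1 : ℕ) ≤ M :=
    hshift.eventually ((hdp.eventually (gt_mem_nhds hp)).mono fun N h => le_of_lt h)
  have hevm : ∀ᶠ n : ℕ in atTop, ((lam (n + 1)).negDiagram.card : ℝ) / (n + 1 : ℕ) ≤ M :=
    hshift.eventually ((hdm.eventually (gt_mem_nhds hm)).mono fun N h => le_of_lt h)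
  have hclosed : Metric.closedBall (1 : ℂ) ρ ⊆ annulus (2 * ρ) :=
    (Metric.closedBall_subset_ball (by linarith)).trans (ball_subset_annulus norm_one _)
  have hbound : ∀ n m (x : ℂ), ((lam (n + 1)).posDiagram.card : ℝ) / (n + 1 : ℕ) ≤ M →
      ((lam (n + 1)).negDiagram.card : ℝ) / (n + 1 : ℕ) ≤ M → x ∈ Metric.sphere (1 : ℂ) ρ →
      ‖corrFactor (n + 1) m x * (lam (n + 1)).genFun x‖ ≤ Real.exp 1 * Real.exp 1 := by
    intro n m x h1 h2 hx
    have hx := mem_sphere_iff_norm.mp hx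
    rw [norm_mul]
    have h3 := norm_corrFactor_le (n + 1) m (x := x) (by linarith)
    have h4 := Signature.norm_genFun_le hM h1 h2 hx.le
    exact (mul_le_of_le_one_left (norm_nonneg _) h3).trans h4
  have hdc : ∀ n m, ((lam (n + 1)).posDiagram.card : ℝ) / (n + 1 : ℕ) ≤ M →
      ((lam (n + 1)).negDiagram.card : ℝ) / (n + 1 : ℕ) ≤ M →
      DiffContOnCl ℂ (fun x => corrFactor (n + 1) m x * (lam (n + 1)).genFun x)
        (Metric.ball 1 ρ) := by
    intro n m h1 h2
    refine DifferentiableOn.diffContOnCl (DifferentiableOn.mono ?_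
      Metric.closure_ball_subset_closedBall)
    exact (differentiable_corrFactor _ _).differentiableOn.mul
      (Signature.differentiableOn_genFun hM h1 h2)
  have hcoeff_bound : ∀ᶠ n in atTop, ∀ m, ‖iteratedDeriv m (laurentEval (B n)) 1‖ ≤
      m.factorial * (Real.exp 1 * Real.exp 1) / ρ ^ m := by
    filter_upwards [hevp, hevm] with n h1 h2 m
    rcases m with _ | m
    · rw [iteratedDeriv_zero, (hB n).laurentEval_one, norm_one]
      have : (1 : ℝ) ≤ Real.exp 1 := Real.one_le_exp zero_le_one
      simp only [Nat.factorial_zero, Nat.cast_one, one_mul, pow_zero, div_one]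
      nlinarith
    · rw [(hB n).iteratedDeriv_succ hM h1 h2]
      exact Complex.norm_iteratedDeriv_le_of_forall_mem_sphere_norm_le _ hρ0 (hdc n m h1 h2)
        fun z hz => hbound n m z h1 h2 hz
  have hcoeff_lim : ∀ m, Tendsto (fun n => iteratedDeriv m (laurentEval (B n)) 1) atTop
      (𝓝 (iteratedDeriv m ω.Phi 1)) := by
    intro m
    rcases m with _ | m
    · simp only [iteratedDeriv_zero, (hB _).laurentEval_one, ω.Phi_one]
      exact tendsto_const_nhds
    · have h := tendsto_iteratedDeriv_of_tendsto_sphere (f := ω.Phi) hρ0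
        (F := fun n x => corrFactor (n + 1) m x * (lam (n + 1)).genFun x)
        (by filter_upwards [hevp, hevm] with n h1 h2 using hdc n m h1 h2)
        ((hdiffPhi.mono (Metric.closure_ball_subset_closedBall.trans hclosed)).diffContOnCl)
        (by filter_upwards [hevp, hevm] with n h1 h2 z hz using hbound n m z h1 h2 hz)
        (fun z hz => by
          have h1 := (tendsto_genFun hap hbp ham hbm hdp hdm hM hp hm hω
            (mem_sphere_iff_norm.mp hz).le).comp hshift
          have h2 := (tendsto_corrFactor m z).mul h1
          rwa [one_mul] at h2) (m + 1)
      refine h.congr' ?_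
      filter_upwards [hevp, hevm] with n h1 h2
      exact ((hB n).iteratedDeriv_succ hM h1 h2 m).symm
  have hball1 : Metric.ball (1 : ℂ) ρ ⊆ annulus 1 :=
    (ball_subset_annulus norm_one ρ).trans (annulus_mono (by linarith))
  rw [hρ32]
  refine tendstoUniformlyOn_annulus (t := ρ / 2) (K := 2 * (Real.exp 1 * Real.exp 1))
    (Eventually.of_forall fun n => (hdiffS n).mono (annulus_mono (by linarith)))
    (hdiffPhi.mono (annulus_mono (by linarith))) ?_ (by linarith) le_rfl ?_
  · filter_upwards [hcoeff_bound] with n hn z hz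
    refine (norm_laurentEval_le (hB n).nonneg z).trans ?_
    have hz' : ‖((‖z‖ : ℝ) : ℂ) - 1‖ ≤ ρ / 2 := by
      rw [← Complex.ofReal_one, ← Complex.ofReal_sub, Complex.norm_real, Real.norm_eq_abs, abs_le]
      exact ⟨by linarith [hz.1], by linarith [hz.2]⟩
    exact norm_le_two_mul_of_taylor ((hdiffS n).mono hball1) hn hρ0
      (mem_ball_iff_norm.mpr (by linarith)) hz'
  · exact tendstoUniformlyOn_of_taylor (r := ρ) (s := ρ)
      (Eventually.of_forall fun n => (hdiffS n).mono hball1)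
      (hdiffPhi.mono (Metric.ball_subset_closedBall.trans hclosed)) hcoeff_bound hcoeff_lim
      (by linarith) (by linarith) (by linarith)

end

/-! ### The determinantal formula in terms of the one-variable function -/

/-- The operator `g ↦ x g + x (x - 1) g' / c`. -/
noncomputable def eulerOp (c : ℂ) (g : ℂ → ℂ) (x : ℂ) : ℂ := x * g x + (x - 1) * x * deriv g x / c

/-- The composition of the operators `eulerOp n, eulerOp (n - 1), …`, `r` factors. -/
noncomputable def eulerIter (n : ℕ) : ℕ → (ℂ → ℂ) → ℂ → ℂ
  | 0, g => g
  | r + 1, g => eulerOp ((n - r : ℕ) : ℂ) (eulerIter n r g)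

lemma differentiableOn_eulerIter {U : Set ℂ} (hU : IsOpen U) {g : ℂ → ℂ}
    (hg : DifferentiableOn ℂ g U) (n r : ℕ) : DifferentiableOn ℂ (eulerIter n r g) U := by
  induction r with
  | zero => exact hg
  | succ r ih =>
    have h1 := ih.deriv hU
    exact (differentiableOn_id.mul ih).add
      ((((differentiableOn_id.sub_const 1).mul differentiableOn_id).mul h1).div_const _)

lemma factorial_mul_sum_pow {N : ℕ} {l : Fin N → ℤ} {w : Fin N → ℂ} {n : ℕ} {g : ℂ → ℂ}
    (hg : DifferentiableOn ℂ g {x | x ≠ 0})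
    (h : ∀ x : ℂ, x ≠ 0 → (n.factorial : ℂ) * ∑ j, x ^ l j * w j = (x - 1) ^ n * g x)
    {r : ℕ} (hr : r ≤ n) {x : ℂ} (hx : x ≠ 0) :
    (n.factorial : ℂ) * ∑ j, x ^ l j * ((l j : ℂ) ^ r * w j) =
      n.descFactorial r * ((x - 1) ^ (n - r) * eulerIter n r g x) := by
  have hopen : IsOpen {x : ℂ | x ≠ 0} := isOpen_ne
  induction r generalizing x with
  | zero => simpa [eulerIter] using h x hx
  | succ r ih =>
    have ih := fun {x : ℂ} (hx : x ≠ 0) => ih (by omega) hx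
    obtain ⟨m, hm⟩ : ∃ m, n = r + 1 + m := Nat.exists_eq_add_of_le hr
    have hA := ((differentiableOn_eulerIter hopen hg n r) x hx).differentiableAt (hopen.mem_nhds hx)
    have d1 : HasDerivAt (fun x : ℂ => (n.factorial : ℂ) * ∑ j, x ^ l j * ((l j : ℂ) ^ r * w j))
        ((n.factorial : ℂ) * ∑ j, ((l j : ℂ) * x ^ (l j - 1)) * ((l j : ℂ) ^ r * w j)) x :=
      HasDerivAt.const_mul _ (HasDerivAt.fun_sum fun j _ =>
        (hasDerivAt_zpow (l j) x (Or.inl hx)).mul_const _)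
    have d2 : HasDerivAt (fun x : ℂ => (n.descFactorial r : ℂ) *
        ((x - 1) ^ (n - r) * eulerIter n r g x))
        ((n.descFactorial r : ℂ) * (((n - r : ℕ) * (x - 1) ^ (n - r - 1) * 1) * eulerIter n r g x +
          (x - 1) ^ (n - r) * deriv (eulerIter n r g) x)) x :=
      HasDerivAt.const_mul _ ((((hasDerivAt_id x).sub_const 1).fun_pow (n - r)).mul hA.hasDerivAt)
    have d3 := d1.unique (d2.congr_of_eventuallyEq
      (by filter_upwards [hopen.mem_nhds hx] with y hy using ih hy))
    have e : ∀ j, x * (((l j : ℂ) * x ^ (l j - 1)) * ((l j : ℂ) ^ r * w j)) =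
        x ^ l j * ((l j : ℂ) ^ (r + 1) * w j) := by
      intro j
      rw [zpow_sub_one₀ hx]
      field_simp
      ring
    have e2 : n - r = m + 1 := by omega
    have e3 : n - (r + 1) = m := by omega
    have hc : ((m : ℂ) + 1) ≠ 0 := by exact_mod_cast m.succ_ne_zero
    rw [← Finset.sum_congr rfl fun j _ => e j, ← Finset.mul_sum, mul_left_comm, d3,
      Nat.descFactorial_succ, eulerIter, eulerOp, e2, e3]
    push_cast
    field_simp
    ring

/-- The determinant `det [(x_a - 1) ^ (k - 1 - r) A_r(x_a)]`. -/
noncomputable def eulerDet (n : ℕ) {k : ℕ} (g : ℂ → ℂ) (x : Fin k → ℂ) : ℂ :=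
  (Matrix.of fun a r : Fin k => (x a - 1) ^ ((Fin.rev r : Fin k) : ℕ) * eulerIter n r g (x a)).det

lemma momentDet_eq_eulerDet {k n : ℕ} (hk : k ≤ n + 1) {l : Fin (n + 1) → ℤ} {g : ℂ → ℂ}
    (hg : DifferentiableOn ℂ g {x | x ≠ 0})
    (h : ∀ x : ℂ, x ≠ 0 → (n.factorial : ℂ) * ∑ j, x ^ l j *
      Lagrange.nodalWeight Finset.univ (fun j => (l j : ℂ)) j = (x - 1) ^ n * g x)
    {x : Fin k → ℂ} (hx : ∀ a, x a ≠ 0) :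
    (n.factorial : ℂ) ^ k * momentDet l (fun j => (l j : ℂ)) x =
      (∏ r : Fin k, (n.descFactorial r : ℂ)) * ((∏ a, (x a - 1) ^ (n + 1 - k)) * eulerDet n g x) := by
  rw [momentDet, eulerDet, ← Matrix.det_mul_column, ← Matrix.det_mul_row]
  have hcard : (n.factorial : ℂ) ^ k = (n.factorial : ℂ) ^ Fintype.card (Fin k) := by simp
  rw [hcard, ← Matrix.det_smul]
  congr 1
  ext a r
  have hr := r.2
  simp only [Matrix.smul_apply, Matrix.of_apply, smul_eq_mul]
  rw [factorial_mul_sum_pow hg h (by omega) (hx a)]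
  have e : n - (r : ℕ) = (n + 1 - k) + ((Fin.rev r : Fin k) : ℕ) := by
    rw [Fin.val_rev]; omega
  rw [e, pow_add]
  ring

lemma normSchur_mul_eulerDet {k n : ℕ} (hk : k ≤ n + 1) {lam : Signature (n + 1)} {B : ℤ →₀ ℝ}
    (hB : IsSpline lam B) {x : Fin k → ℂ} (hx : ∀ a, x a ≠ 0) (hx1 : ∀ a, x a ≠ 1) :
    normSchur lam x * eulerDet n (fun _ => 1) x = eulerDet n (laurentEval B) x := by
  have h1 := normSchur_mul_momentDet hk lam hx
  have h2 := momentDet_eq_eulerDet hk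
    (fun x hx => (differentiableAt_laurentEval B hx).differentiableWithinAt)
    (fun x hx => hB.sum_zpow hx) hx
  have h3 := momentDet_eq_eulerDet hk (l := (Signature.zero (n + 1)).node) (g := fun _ => 1)
    (differentiableOn_const _)
    (fun x hx => by rw [Signature.factorial_mul_sum_zero_node n hx, mul_one]) hx
  have hf : ((n.factorial : ℂ) ^ k) ≠ 0 := pow_ne_zero _ (by exact_mod_cast n.factorial_ne_zero)
  have hd : (∏ r : Fin k, (n.descFactorial r : ℂ)) ≠ 0 :=
    Finset.prod_ne_zero_iff.mpr fun r _ => by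
      have hr := r.2
      have : n.descFactorial r ≠ 0 := (Nat.descFactorial_pos.mpr (by omega)).ne'
      exact_mod_cast this
  have hp : (∏ a, (x a - 1) ^ (n + 1 - k)) ≠ 0 :=
    Finset.prod_ne_zero_iff.mpr fun a _ => pow_ne_zero _ (sub_ne_zero.mpr (hx1 a))
  apply mul_left_cancel₀ (mul_ne_zero hd hp)
  linear_combination (n.factorial : ℂ) ^ k * h1 + h2 - normSchur lam x * h3

/-! ### Continuous convergence -/

lemma tendstoLocallyUniformlyOn_iff_tendsto_prod {α : Type*} [TopologicalSpace α] {F : ℕ → α → ℂ}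
    {f : α → ℂ} {s : Set α} (hf : ContinuousOn f s) :
    TendstoLocallyUniformlyOn F f atTop s ↔
      ∀ x ∈ s, Tendsto (fun y : ℕ × α => F y.1 y.2) (atTop ×ˢ 𝓝[s] x) (𝓝 (f x)) := by
  rw [tendstoLocallyUniformlyOn_iff_forall_tendsto]
  refine forall₂_congr fun x hx => ?_
  have hfx : Tendsto (fun y : ℕ × α => f y.2) (atTop ×ˢ 𝓝[s] x) (𝓝 (f x)) :=
    (hf x hx).tendsto.comp tendsto_snd
  rw [tendsto_uniformity_iff_dist_tendsto_zero]
  constructor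
  · intro h
    have h1 : Tendsto (fun y : ℕ × α => F y.1 y.2 - f y.2) (atTop ×ˢ 𝓝[s] x) (𝓝 0) := by
      rw [tendsto_zero_iff_norm_tendsto_zero]
      refine h.congr fun y => ?_
      rw [dist_comm, dist_eq_norm]
    have h2 := h1.add hfx
    simpa using h2
  · intro h
    have h1 := hfx.dist h
    rwa [dist_self] at h1

lemma tendstoLocallyUniformlyOn_eulerIter {U : Set ℂ} (hU : IsOpen U) {F : ℕ → ℂ → ℂ} {f : ℂ → ℂ}
    (hF : ∀ n, DifferentiableOn ℂ (F n) U) (h : TendstoLocallyUniformlyOn F f atTop U) (r : ℕ) :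
    TendstoLocallyUniformlyOn (fun n => eulerIter n r (F n)) (fun x => x ^ r * f x) atTop U := by
  have hf : DifferentiableOn ℂ f U := h.differentiableOn (Eventually.of_forall hF) hU
  induction r with
  | zero => simpa [eulerIter] using h
  | succ r ih =>
    have hdiff : DifferentiableOn ℂ (fun x => x ^ r * f x) U := by fun_prop
    have hdiff' : DifferentiableOn ℂ (fun x => x ^ (r + 1) * f x) U := by fun_prop
    have hder := ih.deriv (Eventually.of_forall fun n => differentiableOn_eulerIter hU (hF n) n r) hU
    rw [tendstoLocallyUniformlyOn_iff_tendsto_prod hdiff.continuousOn] at ih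
    have hder := (tendstoLocallyUniformlyOn_iff_tendsto_prod (hdiff.deriv hU).continuousOn).mp hder
    rw [tendstoLocallyUniformlyOn_iff_tendsto_prod hdiff'.continuousOn]
    intro x hx
    have hy : Tendsto (fun y : ℕ × ℂ => y.2) (atTop ×ˢ 𝓝[U] x) (𝓝 x) :=
      (tendsto_id.mono_left nhdsWithin_le_nhds).comp tendsto_snd
    have hc : Tendsto (fun y : ℕ × ℂ => (((y.1 - r : ℕ) : ℂ))⁻¹) (atTop ×ˢ 𝓝[U] x) (𝓝 0) :=
      ((tendsto_inv_atTop_nhds_zero_nat (𝕜 := ℂ)).comp (tendsto_sub_atTop_nat r)).comp tendsto_fst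
    have h1 := (hy.mul (ih x hx)).add
      ((((hy.sub_const 1).mul hy).mul (hder x hx)).mul hc)
    rw [mul_zero, add_zero] at h1
    have e : x ^ (r + 1) * f x = x * (x ^ r * f x) := by ring
    rw [e]
    refine h1.congr fun y => ?_
    simp only [eulerIter, eulerOp, Function.comp_apply, div_eq_mul_inv]

lemma det_rev_pow_mul_pow {k : ℕ} (x c : Fin k → ℂ) :
    (Matrix.of fun a r : Fin k => (x a - 1) ^ ((Fin.rev r : Fin k) : ℕ) *
      (x a ^ (r : ℕ) * c a)).det = (∏ a, c a) * ∏ i, ∏ j ∈ Finset.Ioi i, (x i - x j) := by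
  have h := Matrix.det_projVandermonde x (fun a => x a - 1)
  have e : ∀ i j : Fin k, x j * (x i - 1) - x i * (x j - 1) = x i - x j := fun i j => by ring
  simp only [e] at h
  rw [← h, ← Matrix.det_mul_column]
  congr 1
  ext a r
  simp only [Matrix.of_apply, Matrix.projVandermonde, Matrix.rectVandermonde]
  ring

lemma tendsto_eulerDet {U : Set ℂ} (hU : IsOpen U) {F : ℕ → ℂ → ℂ} {f : ℂ → ℂ}
    (hF : ∀ n, DifferentiableOn ℂ (F n) U) (h : TendstoLocallyUniformlyOn F f atTop U) {k : ℕ}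
    {T : Set (Fin k → ℂ)} (hT : ∀ x ∈ T, ∀ a, x a ∈ U) {x : Fin k → ℂ} (hx : x ∈ T) :
    Tendsto (fun y : ℕ × (Fin k → ℂ) => eulerDet y.1 (F y.1) y.2) (atTop ×ˢ 𝓝[T] x)
      (𝓝 ((∏ a, f (x a)) * ∏ i, ∏ j ∈ Finset.Ioi i, (x i - x j))) := by
  have hf : DifferentiableOn ℂ f U := h.differentiableOn (Eventually.of_forall hF) hU
  rw [← det_rev_pow_mul_pow x (fun a => f (x a))]
  have hdet : Continuous fun A : Matrix (Fin k) (Fin k) ℂ => A.det :=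
    Continuous.matrix_det continuous_id
  refine (hdet.tendsto _).comp ?_
  refine tendsto_pi_nhds.mpr fun a => tendsto_pi_nhds.mpr fun r => ?_
  have hcoord : Tendsto (fun y : Fin k → ℂ => y a) (𝓝[T] x) (𝓝[U] (x a)) :=
    tendsto_nhdsWithin_iff.mpr ⟨((continuous_apply a).tendsto x).mono_left nhdsWithin_le_nhds,
      by filter_upwards [self_mem_nhdsWithin] with y hy using hT y hy a⟩
  have h1 := (tendstoLocallyUniformlyOn_iff_tendsto_prod (f := fun x => x ^ (r : ℕ) * f x)
    ((continuousOn_id.pow _).mul hf.continuousOn)).mp (tendstoLocallyUniformlyOn_eulerIter hU hF h r) (x a) (hT x hx a)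
  have h2 : Tendsto (fun y : ℕ × (Fin k → ℂ) => (y.1, y.2 a)) (atTop ×ˢ 𝓝[T] x)
      (atTop ×ˢ 𝓝[U] (x a)) := tendsto_id.prodMap hcoord
  have h3 : Tendsto (fun y : ℕ × (Fin k → ℂ) => y.2 a) (atTop ×ˢ 𝓝[T] x) (𝓝 (x a)) :=
    (hcoord.mono_right nhdsWithin_le_nhds).comp tendsto_snd
  simp only [Matrix.of_apply]
  exact ((h3.sub_const 1).pow _).mul (h1.comp h2)

/-! ### The maximum principle on polyannuli -/

lemma norm_le_of_norm_le_torus {k : ℕ} {h : (Fin k → ℂ) → ℂ} {ε C : ℝ} {ρ : Fin k → ℝ}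
    (hρε : ∀ l, ρ l < ε)
    (hd : ∀ x : Fin k → ℂ, (∀ l, x l ∈ annulus ε) → ∀ l,
      DifferentiableOn ℂ (fun z => h (Function.update x l z)) (annulus ε))
    (hT : ∀ x : Fin k → ℂ, (∀ l, ‖x l‖ = 1 - ρ l ∨ ‖x l‖ = 1 + ρ l) → ‖h x‖ ≤ C)
    {x : Fin k → ℂ} (hx : ∀ l, 1 - ρ l ≤ ‖x l‖ ∧ ‖x l‖ ≤ 1 + ρ l) : ‖h x‖ ≤ C := by
  have key : ∀ s : Finset (Fin k), ∀ x : Fin k → ℂ,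
      (∀ l, 1 - ρ l ≤ ‖x l‖ ∧ ‖x l‖ ≤ 1 + ρ l) →
      (∀ l, l ∉ s → ‖x l‖ = 1 - ρ l ∨ ‖x l‖ = 1 + ρ l) → ‖h x‖ ≤ C := by
    intro s
    induction s using Finset.induction_on with
    | empty => exact fun x _ hb => hT x fun l => hb l (Finset.notMem_empty l)
    | insert l s hl ih =>
      intro x hx hb
      by_cases hxl : ‖x l‖ = 1 - ρ l ∨ ‖x l‖ = 1 + ρ l
      · refine ih x hx fun l' hl' => ?_
        by_cases e : l' = l
        · rw [e]; exact hxl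
        · exact hb l' (by simp [e, hl'])
      have hxU : x l ∈ annulus (ρ l) := by
        rw [not_or] at hxl
        exact ⟨lt_of_le_of_ne (hx l).1 (Ne.symm hxl.1), lt_of_le_of_ne (hx l).2 hxl.2⟩
      have hclos : closure (annulus (ρ l)) ⊆ {z : ℂ | 1 - ρ l ≤ ‖z‖ ∧ ‖z‖ ≤ 1 + ρ l} := by
        refine closure_minimal (fun z hz => ⟨hz.1.le, hz.2.le⟩) ?_
        exact (isClosed_le continuous_const continuous_norm).inter
          (isClosed_le continuous_norm continuous_const)
      have hbdd : Bornology.IsBounded (annulus (ρ l)) := by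
        refine (Metric.isBounded_ball (x := (0 : ℂ)) (r := 1 + ρ l)).subset fun z hz => ?_
        rw [mem_ball_zero_iff]
        exact hz.2
      have hxε : ∀ l, x l ∈ annulus ε := fun l =>
        ⟨by linarith [(hx l).1, hρε l], by linarith [(hx l).2, hρε l]⟩
      have hdc : DiffContOnCl ℂ (fun z => h (Function.update x l z)) (annulus (ρ l)) := by
        refine DifferentiableOn.diffContOnCl ((hd x hxε l).mono fun z hz => ?_)
        have := hclos hz
        exact ⟨by linarith [this.1, hρε l], by linarith [this.2, hρε l]⟩
      have hmax := Complex.norm_le_of_forall_mem_frontier_norm_le hbdd hdc (C := C) (fun z hz => ?_)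
        (subset_closure hxU)
      · simpa using hmax
      · have hz1 := hclos hz.1
        have hz2 : z ∉ annulus (ρ l) := by
          have := hz.2
          rwa [(isOpen_annulus _).interior_eq] at this
        refine ih _ (fun l' => ?_) (fun l' hl' => ?_)
        · by_cases e : l' = l
          · subst e; simpa using hz1
          · rw [Function.update_of_ne e]; exact hx l'
        · by_cases e : l' = l
          · subst e
            rw [Function.update_self]
            by_contra! hcon
            exact hz2 ⟨lt_of_le_of_ne hz1.1 hcon.1.symm, lt_of_le_of_ne hz1.2 hcon.2⟩
          · rw [Function.update_of_ne e]
            exact hb l' (by simp [e, hl'])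
  exact key Finset.univ x hx fun l hl => absurd (Finset.mem_univ l) hl

lemma differentiableOn_normSchur_update {N k : ℕ} (lam : Signature N) {ε : ℝ} (hε : ε ≤ 1)
    {x : Fin k → ℂ} (hx : ∀ l, x l ∈ annulus ε) (l : Fin k) :
    DifferentiableOn ℂ (fun z => normSchur lam (Function.update x l z)) (annulus ε) := by
  have hcoord : ∀ i : Fin N, DifferentiableOn ℂ (fun z => padOne N (Function.update x l z) i)
      (annulus ε) := by
    intro i
    unfold padOne
    split_ifs with h
    · by_cases e : (⟨i, h⟩ : Fin k) = l
      · subst e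
        simp only [Function.update_self]
        exact differentiableOn_id
      · simp only [Function.update_of_ne e]
        exact differentiableOn_const _
    · exact differentiableOn_const _
  have hne : ∀ z ∈ annulus ε, ∀ i : Fin N, padOne N (Function.update x l z) i ≠ 0 := by
    intro z hz i
    unfold padOne
    split_ifs with h
    · by_cases e : (⟨i, h⟩ : Fin k) = l
      · subst e
        simpa using ne_zero_of_mem_annulus hε hz
      · rw [Function.update_of_ne e]
        exact ne_zero_of_mem_annulus hε (hx _)
    · exact one_ne_zero
  unfold normSchur schur
  simp only [MvPolynomial.eval_eq']
  refine DifferentiableOn.div_const (DifferentiableOn.fun_mul (DifferentiableOn.fun_inv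
    (DifferentiableOn.fun_pow (DifferentiableOn.fun_finsetProd fun i _ => hcoord i) _)
    fun z hz => pow_ne_zero _ (Finset.prod_ne_zero_iff.mpr fun i _ => hne z hz i))
    (DifferentiableOn.fun_sum fun d _ => DifferentiableOn.const_mul
      (DifferentiableOn.fun_finsetProd fun i _ => (hcoord i).fun_pow _) _)) _

lemma differentiableOn_prod_update {k : ℕ} {f : ℂ → ℂ} {U : Set ℂ} (hf : DifferentiableOn ℂ f U)
    (x : Fin k → ℂ) (l : Fin k) :
    DifferentiableOn ℂ (fun z => ∏ a, f (Function.update x l z a)) U := by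
  refine DifferentiableOn.fun_finsetProd fun a _ => ?_
  by_cases e : a = l
  · subst e
    simpa using hf
  · simp only [Function.update_of_ne e]
    exact differentiableOn_const _

/-! ### Convergence of normalized Schur functions -/

lemma tendstoUniformlyOn_normSchur_torus {lam : (n : ℕ) → Signature (n + 1)} {B : ℕ → ℤ →₀ ℝ}
    (hB : ∀ n, IsSpline (lam n) (B n)) {ε : ℝ} (hε : ε ≤ 1) {f : ℂ → ℂ}
    (h : TendstoLocallyUniformlyOn (fun n => laurentEval (B n)) f atTop (annulus ε)) {k : ℕ}
    {T : Set (Fin k → ℂ)} (hTc : IsCompact T) (hT : ∀ x ∈ T, ∀ a, x a ∈ annulus ε)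
    (hT1 : ∀ x ∈ T, ∀ a, x a ≠ 1) (hTinj : ∀ x ∈ T, Function.Injective x) :
    TendstoUniformlyOn (fun n x => normSchur (lam n) x) (fun x => ∏ a, f (x a)) atTop T := by
  have hdiff : ∀ n, DifferentiableOn ℂ (laurentEval (B n)) (annulus ε) := fun n x hx =>
    (differentiableAt_laurentEval _ (ne_zero_of_mem_annulus hε hx)).differentiableWithinAt
  have hf : DifferentiableOn ℂ f (annulus ε) :=
    h.differentiableOn (Eventually.of_forall hdiff) (isOpen_annulus ε)
  have hcont : ContinuousOn (fun x : Fin k → ℂ => ∏ a, f (x a)) T :=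
    continuousOn_finsetProd _ fun a _ =>
      hf.continuousOn.comp (continuous_apply a).continuousOn fun x hx => hT x hx a
  rw [← tendstoLocallyUniformlyOn_iff_tendstoUniformlyOn_of_compact hTc,
    tendstoLocallyUniformlyOn_iff_tendsto_prod hcont]
  intro x hx
  have hone : TendstoLocallyUniformlyOn (fun (_ : ℕ) (_ : ℂ) => (1 : ℂ)) (fun _ => 1) atTop
      (annulus ε) := by
    rw [tendstoLocallyUniformlyOn_iff_tendsto_prod continuousOn_const]
    exact fun _ _ => tendsto_const_nhds
  have h1 := tendsto_eulerDet (isOpen_annulus ε) hdiff h hT hx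
  have h2 := tendsto_eulerDet (isOpen_annulus ε) (fun _ => differentiableOn_const _) hone hT hx
  simp only [Finset.prod_const_one, one_mul] at h2
  have hV : ∏ i, ∏ j ∈ Finset.Ioi i, (x i - x j) ≠ 0 :=
    Finset.prod_ne_zero_iff.mpr fun i _ => Finset.prod_ne_zero_iff.mpr fun j hj =>
      sub_ne_zero.mpr fun e => (Finset.mem_Ioi.mp hj).ne (hTinj x hx e)
  have h3 := h1.div h2 hV
  rw [mul_div_cancel_right₀ _ hV] at h3
  refine h3.congr' ?_
  have hmem : ∀ᶠ y : ℕ × (Fin k → ℂ) in atTop ×ˢ 𝓝[T] x, k ≤ y.1 ∧ y.2 ∈ T :=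
    (eventually_ge_atTop k).prod_mk self_mem_nhdsWithin
  filter_upwards [hmem, h2.eventually_ne hV] with y hy hy0
  rw [Pi.div_apply, div_eq_iff hy0, normSchur_mul_eulerDet (by omega) (hB y.1)
    (fun a => ne_zero_of_mem_annulus hε (hT _ hy.2 a)) (hT1 _ hy.2)]

lemma tendstoUniformlyOn_normSchur {lam : (n : ℕ) → Signature (n + 1)} {B : ℕ → ℤ →₀ ℝ}
    (hB : ∀ n, IsSpline (lam n) (B n)) {ε : ℝ} (hε0 : 0 < ε) (hε : ε ≤ 1) {f : ℂ → ℂ}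
    (h : TendstoLocallyUniformlyOn (fun n => laurentEval (B n)) f atTop (annulus ε)) (k : ℕ) :
    TendstoUniformlyOn (fun n (x : Fin k → ℂ) => normSchur (lam n) x) (fun x => ∏ a, f (x a)) atTop
      (polyAnnulus k (ε / 2)) := by
  have hf : DifferentiableOn ℂ f (annulus ε) :=
    h.differentiableOn (Eventually.of_forall fun n x hx =>
      (differentiableAt_laurentEval _ (ne_zero_of_mem_annulus hε hx)).differentiableWithinAt)
      (isOpen_annulus ε)
  set ρ : Fin k → ℝ := fun l => ε / 2 + ε / 2 * (((l : ℕ) + 1 : ℝ) / (k + 1)) with hρ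
  have hρl : ∀ l, ε / 2 ≤ ρ l := fun l => by simp only [hρ]; linarith [show
    0 ≤ ε / 2 * (((l : ℕ) + 1 : ℝ) / (k + 1)) by positivity]
  have hρε : ∀ l, ρ l < ε := fun l => by
    have h1 : (((l : ℕ) + 1 : ℝ) / (k + 1)) < 1 := by
      rw [div_lt_one (by positivity)]
      have : ((l : ℕ) : ℝ) < k := by exact_mod_cast l.2
      linarith
    simp only [hρ]
    nlinarith
  have hρinj : ∀ l l', ρ l = ρ l' → l = l' := fun l l' e => by
    have hk : (0 : ℝ) < k + 1 := by positivity
    simp only [hρ, add_right_inj] at e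
    have e := mul_left_cancel₀ (by positivity) e
    rw [div_left_inj' hk.ne', add_left_inj] at e
    exact Fin.ext (by exact_mod_cast e)
  set T : Set (Fin k → ℂ) := {x | ∀ l, ‖x l‖ = 1 - ρ l ∨ ‖x l‖ = 1 + ρ l} with hTdef
  have hTc : IsCompact T := by
    have : T = Set.univ.pi fun l => Metric.sphere (0 : ℂ) (1 - ρ l) ∪ Metric.sphere 0 (1 + ρ l) := by
      ext x
      simp [hTdef]
    rw [this]
    exact isCompact_univ_pi fun l => (isCompact_sphere _ _).union (isCompact_sphere _ _)
  have hT : ∀ x ∈ T, ∀ a, x a ∈ annulus ε := fun x hx a => by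
    have := hρε a
    have := hρl a
    rcases hx a with e | e <;> exact ⟨by linarith, by linarith⟩
  have hT1 : ∀ x ∈ T, ∀ a, x a ≠ 1 := fun x hx a e => by
    have := hρl a
    have := hx a
    rw [e, norm_one] at this
    rcases this with e | e <;> linarith
  have hTinj : ∀ x ∈ T, Function.Injective x := fun x hx a b e => by
    have h1 := hx a
    have h2 := hx b
    have := hρl a
    have := hρl b
    rw [e] at h1
    rcases h1 with h1 | h1 <;> rcases h2 with h2 | h2 <;>
      exact hρinj a b (by linarith)
  have hunif := tendstoUniformlyOn_normSchur_torus hB hε h hTc hT hT1 hTinj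
  rw [Metric.tendstoUniformlyOn_iff] at hunif ⊢
  intro η hη
  filter_upwards [hunif (η / 2) (by positivity)] with n hn x hx
  have hmax := norm_le_of_norm_le_torus (h := fun x => ∏ a, f (x a) - normSchur (lam n) x)
    (C := η / 2) hρε
    (fun x hx l => (differentiableOn_prod_update hf x l).sub
      (differentiableOn_normSchur_update (lam n) hε hx l))
    (fun x hx => by
      have := hn x hx
      rw [dist_eq_norm] at this
      exact this.le) (x := x)
    (fun l => ⟨by linarith [(hx l).1, hρl l], by linarith [(hx l).2, hρl l]⟩)
  rw [dist_eq_norm]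
  exact lt_of_le_of_lt hmax (by linarith)

end VershikKerov

open VershikKerov in
theorem theorem6p2 (ω : Omega) (lam : (N : ℕ) → Signature N)
    (hap : ∀ i, Tendsto (fun N : ℕ => frobP (lam N).posDiagram i / N) atTop (𝓝 (ω.ap i)))
    (hbp : ∀ i, Tendsto (fun N : ℕ => frobQ (lam N).posDiagram i / N) atTop (𝓝 (ω.bp i)))
    (ham : ∀ i, Tendsto (fun N : ℕ => frobP (lam N).negDiagram i / N) atTop (𝓝 (ω.am i)))
    (hbm : ∀ i, Tendsto (fun N : ℕ => frobQ (lam N).negDiagram i / N) atTop (𝓝 (ω.bm i)))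
    (hdp : Tendsto (fun N : ℕ => ((lam N).posDiagram.card : ℝ) / N) atTop (𝓝 ω.dp))
    (hdm : Tendsto (fun N : ℕ => ((lam N).negDiagram.card : ℝ) / N) atTop (𝓝 ω.dm)) :
    ∃ ε : ℝ, 0 < ε ∧ ε < 1 ∧
      (∀ x : ℂ, 1 - ε < ‖x‖ → ‖x‖ < 1 + ε →
        (∀ i, 1 - (ω.ap i : ℂ) * (x - 1) ≠ 0 ∧ 1 - (ω.am i : ℂ) * (x⁻¹ - 1) ≠ 0) ∧
          Multipliable fun i => ω.factor i x) ∧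
      ∀ k : ℕ, TendstoUniformlyOn (fun (N : ℕ) (x : Fin k → ℂ) => normSchur (lam N) x)
        (fun x => ∏ l, ω.Phi (x l)) atTop (polyAnnulus k ε) := by
  obtain ⟨M, hM, hp, hm, hω⟩ := ω.exists_bound
  have hM0 : 0 < M := by linarith
  choose B hB using fun n => (lam (n + 1)).exists_spline
  have hB : ∀ n, IsSpline (lam (n + 1)) (B n) := fun n => ⟨(hB n).1, (hB n).2⟩
  have hle : 1 / (32 * M) ≤ 1 / (2 * M) := one_div_le_one_div_of_le (by positivity) (by linarith)
  have hε : 1 / (32 * M) ≤ 1 := by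
    rw [div_le_one (by positivity)]
    linarith
  have hε0 : 0 < 1 / (32 * M) := by positivity
  refine ⟨1 / (32 * M) / 2, by positivity, by linarith, fun x hx1 hx2 => ?_, fun k => ?_⟩
  · have hx : x ∈ annulus (1 / (2 * M)) := annulus_mono (by linarith) ⟨hx1, hx2⟩
    exact ⟨fun i => ⟨hω.den_p hx i, hω.den_m hx i⟩, hω.multipliable hx⟩
  · have h := tendstoUniformlyOn_normSchur hB hε0 hε
      (tendstoUniformlyOn_laurentEval hap hbp ham hbm hdp hdm hM hp hm hω
        hB).tendstoLocallyUniformlyOn k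
    rw [Metric.tendstoUniformlyOn_iff] at h ⊢
    intro η hη
    obtain ⟨n, hn⟩ := eventually_atTop.mp (h η hη)
    filter_upwards [eventually_ge_atTop (n + 1)] with N hN
    obtain ⟨m, rfl⟩ : ∃ m, N = m + 1 := ⟨N - 1, by omega⟩
    exact hn m (by omega)
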